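/- **Setting.** Let $T>0$, let $C_0[0,T]$ be the space of real continuous functions $x$ on $[0,T]$ with $x(0)=0$, and let $\mathfrak m$ be Wiener measure on it. A property holds *s-a.e.* if its exceptional set $N$ satisfies $\mathfrak m(\rho N)=0$ for all $\rho>0$; a functional $F$ is *scale-invariant measurable* if $F(\rho\,\cdot)$ is Wiener measurable for all $\rho>0$. Fix a complete orthonormal sequence $(\varphi_j)$ of $L_2[0,T]$ consisting of functions of bounded variation; the Paley–Wiener–Zygmund (PWZ) integral is $\langle u,x\rangle=\lim_{n}\int_0^T\sum_{j\le n}(u,\varphi_j)_2\,\varphi_j\,dx$ whenever this limit exists. For $h\in L_2[0,T]$ let $\mathcal Z_h(x,\cdot)\in C_0[0,T]$ be the continuous version of the Gaussian process $\mathcal Z_h(x,t)=\langle h1_{[0,t]},x\rangle$. Let $\mathbb C_+=\{\lambda\in\mathbb C:\operatorname{Re}\lambda>0\}$. If $x\mapsto\Psi(\lambda^{-1/2},x)$ is $\mathfrak m$-integrable for every real $\lambda>0$ and $\lambda\mapsto\int\Psi(\lambda^{-1/2},x)\,d\mathfrak m(x)$ extends to an analytic function $J^*$ on $\mathbb C_+$,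 then $J^*(\lambda)$ is the *analytic Wiener integral* of $\Psi$ with parameter $\lambda$, and $\lim_{\lambda\to-iq,\ \lambda\in\mathbb C_+}J^*(\lambda)$, if it exists, is the *analytic Feynman integral* with parameter $q\in\mathbb R\setminus\{0\}$. * $T_{\lambda,h}(F)(y)$, $\lambda\in\mathbb C_+$, is the analytic Wiener integral of $F(y+\lambda^{-1/2}\mathcal Z_h(x,\cdot))$. The *generalized Fourier–Feynman transform (GFFT)* $T^{(p)}_{q,h}(F)$ is, for $p=1$, the s-a.e. limit of $T_{\lambda,h}(F)(y)$ as $\lambda\to-iq$ in $\mathbb C_+$, and, for $1<p\le2$, the scale-invariant measurable functional with $\int|T_{\lambda,h}(F)(\rho y)-T^{(p)}_{q,h}(F)(\rho y)|^{p'}d\mathfrak m(y)\to0$ for every $\rho>0$, where $1/p+1/p'=1$. It is determined up to s-a.e. equality. * The *generalized convolution product (GCP)* $(F*G)_q^{(k_1,k_2)}(y)$ is the analytic Feynman integral with parameter $q$ of $$F\Big(\tfrac{y+\lambda^{-1/2}\mathcal Z_{k_1}(x,\cdot)}{\sqrt2}\Big)\,G\Big(\tfrac{y-\lambda^{-1/2}\mathcal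 Z_{k_2}(x,\cdot)}{\sqrt2}\Big).$$ * $\mathcal S(L_2[0,T])$ consists of the functionals $F(x)=\int_{L_2[0,T]}\exp\{i\langle u,x\rangle\}\,df(u)$ with $f$ a complex Borel measure on $L_2[0,T]$, where the formula is required at every $x$ for which $\langle u,x\rangle$ exists for $|f|$-a.e. $u$ (this is the case for s-a.e. $x$), and $F$ is arbitrary at other $x$. **Theorem.** Let $F,G\in\mathcal S(L_2[0,T])$, let $n\ge1$, and let $k_1,k_2,h_1,\dots,h_n$ be functions in $L_\infty[0,T]$, none of them a.e. zero. Let $\mathbf s,\mathbf s_1,\mathbf s_2\in L_\infty[0,T]$ satisfy, a.e. on $[0,T]$, $$\mathbf s^2=h_1^2+\cdots+h_n^2,\qquad \mathbf s_j^2=h_1^2+\cdots+h_n^2+k_j^2\quad(j=1,2),$$ and assume that $\mathbf s^2=k_1k_2$ a.e. on $[0,T]$. Then, for all $p\in[1,2]$ and all real $q\neq0$, the transforms $$A=T^{(p)}_{q,k_1/\sqrt2}\big(T^{(p)}_{q,h_n/\sqrt2}(\cdots T^{(p)}_{q,h_1/\sqrt2}(F)\cdots)\big),\qquad B=T^{(p)}_{q,k_2/\sqrt2}\big(T^{(p)}_{q,h_n/\sqrt2}(\cdots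 T^{(p)}_{q,h_1/\sqrt2}(G)\cdots)\big),$$ $$C=T^{(p)}_{q,\mathbf s_1/\sqrt2}(F),\qquad D=T^{(p)}_{q,\mathbf s_2/\sqrt2}(G)$$ exist, each of them and each intermediate transform having a version in $\mathcal S(L_2[0,T])$. The transform $T^{(p)}_{q,\mathbf s}\big(F(\tfrac{\cdot}{\sqrt2})G(\tfrac{\cdot}{\sqrt2})\big)$ exists as well. Whenever all transforms in $A,B,C,D$ are taken to be versions in $\mathcal S(L_2[0,T])$, the following convolution products exist for s-a.e. $y\in C_0[0,T]$ and $$(A*B)_{-q}^{(k_1,k_2)}(y)=(C*D)_{-q}^{(k_1,k_2)}(y)=T^{(p)}_{q,\mathbf s}\Big(F\big(\tfrac{\cdot}{\sqrt2}\big)G\big(\tfrac{\cdot}{\sqrt2}\big)\Big)(y).$$ -/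

import Mathlib

open MeasureTheory ProbabilityTheory Filter Set Topology

noncomputable section

namespace WienerGFFT

/-! ### Wiener space -/

/-- The space `C₀[0,T]` of real continuous functions on `[0,T]` vanishing at `0`, with pointwise
operations and the sup norm. -/
def C0 (T : ℝ) : Submodule ℝ C(Icc (0 : ℝ) T, ℝ) where
  carrier := {x | ∀ t : Icc (0 : ℝ) T, (t : ℝ) = 0 → x t = 0}
  add_mem' := by
    intro x y hx hy t ht
    simp [hx t ht, hy t ht]
  zero_mem' := by
    intro t _
    rfl
  smul_mem' := by
    intro c x hx t ht
    simp [hx t ht]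

instance (T : ℝ) : MeasurableSpace (C0 T) := borel _

instance (T : ℝ) : BorelSpace (C0 T) := ⟨rfl⟩

/-- The value at time `t` of a path; only times `t ∈ [0,T]` are meaningful. -/
def ev {T : ℝ} (x : C0 T) (t : ℝ) : ℝ :=
  if ht : t ∈ Icc (0 : ℝ) T then (x : C(Icc (0 : ℝ) T, ℝ)) ⟨t, ht⟩ else 0

/-- `m` is Wiener measure: under `m` the coordinate process is a centred Gaussian process
with covariance `min s t`.  This determines the Borel measure `m` uniquely; "Wiener measurable"
means measurable with respect to the completion of `m`. -/
structure IsWienerMeasure {T : ℝ} (m : Measure (C0 T)) : Prop where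
  gaussian : IsGaussianProcess
    (fun (t : Icc (0 : ℝ) T) (x : C0 T) => (x : C(Icc (0 : ℝ) T, ℝ)) t) m
  mean : ∀ t ∈ Icc (0 : ℝ) T, ∫ x, ev x t ∂m = 0
  cov : ∀ s ∈ Icc (0 : ℝ) T, ∀ t ∈ Icc (0 : ℝ) T, ∫ x, ev x s * ev x t ∂m = min s t

/-- `P` holds scale-invariant almost everywhere: the exceptional set `N` satisfies
`m (ρ N) = 0` for every `ρ > 0` (equivalently, with `ρ` replaced by `1/ρ`, for every `ρ > 0`
one has `ρ y ∉ N` for `m`-a.e. `y`). -/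
def SAE {T : ℝ} (m : Measure (C0 T)) (P : C0 T → Prop) : Prop :=
  ∀ ρ : ℝ, 0 < ρ → ∀ᵐ y ∂m, P (ρ • y)

/-- `F (ρ ·)` is Wiener measurable for every `ρ > 0`. -/
def ScaleMeasurable {T : ℝ} (m : Measure (C0 T)) (F : C0 T → ℂ) : Prop :=
  ∀ ρ : ℝ, 0 < ρ → AEStronglyMeasurable (fun y => F (ρ • y)) m

/-! ### The Paley-Wiener-Zygmund integral and the Gaussian processes -/

/-- Lebesgue measure on `[0,T]`. -/
abbrev leb (T : ℝ) : Measure ℝ := volume.restrict (Icc (0 : ℝ) T)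

/-- A complete orthonormal sequence of `L₂[0,T]` that consists of functions of bounded variation
on `[0,T]`. -/
structure IsBVBasis (T : ℝ) (φ : ℕ → ℝ → ℝ) : Prop where
  bv : ∀ j, BoundedVariationOn (φ j) (Icc (0 : ℝ) T)
  orthonormal : ∀ i j, ∫ t, φ i t * φ j t ∂(leb T) = if i = j then 1 else 0
  complete : ∀ u : ℝ → ℝ, MemLp u 2 (leb T) → (∀ j, ∫ t, u t * φ j t ∂(leb T) = 0) →
    u =ᵐ[leb T] 0

/-- The Riemann-Stieltjes integral `∫₀ᵀ φ dx`.  It exists for `φ` of bounded variation and `x`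
continuous, and is then the limit of the Riemann-Stieltjes sums along the uniform partitions. -/
def rsInt {T : ℝ} (φ : ℝ → ℝ) (x : C0 T) : ℝ :=
  limUnder atTop (fun N : ℕ => ∑ i ∈ Finset.range N,
    φ (T * (i : ℝ) / (N : ℝ)) *
      (ev x (T * ((i : ℝ) + 1) / (N : ℝ)) - ev x (T * (i : ℝ) / (N : ℝ))))

/-- The partial sums `∫₀ᵀ (∑_{j<n} (u, φ_j) φ_j) dx` whose limit is the PWZ integral. -/
def pwzSum {T : ℝ} (φ : ℕ → ℝ → ℝ) (u : ℝ → ℝ) (x : C0 T) (n : ℕ) : ℝ :=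
  ∑ j ∈ Finset.range n, (∫ t, u t * φ j t ∂(leb T)) * rsInt (φ j) x

/-- The PWZ integral `⟨u,x⟩` exists and has the value `c`. -/
def HasPWZ {T : ℝ} (φ : ℕ → ℝ → ℝ) (u : ℝ → ℝ) (x : C0 T) (c : ℝ) : Prop :=
  Tendsto (pwzSum φ u x) atTop (𝓝 c)

/-- The PWZ integral `⟨u,x⟩ = ∫₀ᵀ u d̃x` (meaningful where `HasPWZ φ u x c` for some `c`). -/
def pwz {T : ℝ} (φ : ℕ → ℝ → ℝ) (u : ℝ → ℝ) (x : C0 T) : ℝ :=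
  limUnder atTop (pwzSum φ u x)

/-- `Z` is (a version with paths in `C₀[0,T]` of) the Gaussian process
`𝒵_h(x,t) = ∫₀ᵗ h d̃x = ⟨h 1_{[0,t]}, x⟩`. -/
def IsGaussProc {T : ℝ} (m : Measure (C0 T)) (φ : ℕ → ℝ → ℝ) (h : ℝ → ℝ)
    (Z : C0 T → C0 T) : Prop :=
  ∀ t ∈ Icc (0 : ℝ) T, ∀ᵐ x ∂m, HasPWZ φ ((Icc (0 : ℝ) t).indicator h) x (ev (Z x) t)

/-! ### Analytic Wiener integrals, transforms and convolution products -/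

/-- The open right half plane `ℂ₊`. -/
def Cplus : Set ℂ := {z | 0 < z.re}

/-- `J` is, on `ℂ₊`, the analytic Wiener integral with parameter `z` of the scaled functionals
`Ψ r : x ↦ Ψ r x`, `r = z^{-1/2}`: for every real `l > 0` the integral of `Ψ (l^{-1/2})` exists
and is `J l`, and `J` is analytic on `ℂ₊`. -/
def IsAnalyticWiener {T : ℝ} (m : Measure (C0 T)) (Ψ : ℝ → C0 T → ℂ) (J : ℂ → ℂ) : Prop :=
  (∀ l : ℝ, 0 < l → Integrable (Ψ (Real.sqrt l)⁻¹) m ∧ ∫ x, Ψ (Real.sqrt l)⁻¹ x ∂m = J (l : ℂ)) ∧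
  AnalyticOnNhd ℂ J Cplus

/-- `J y z = T_{z,h}(F)(y)` for s-a.e. `y` and all `z ∈ ℂ₊`. -/
def IsWienerTransform {T : ℝ} (m : Measure (C0 T)) (φ : ℕ → ℝ → ℝ) (h : ℝ → ℝ)
    (F : C0 T → ℂ) (J : C0 T → ℂ → ℂ) : Prop :=
  (∃ Z : C0 T → C0 T, IsGaussProc m φ h Z ∧
    SAE m (fun y => IsAnalyticWiener m (fun r x => F (y + r • Z x)) (J y))) ∧
  ∀ z ∈ Cplus, ScaleMeasurable m (fun y => J y z)

/-- `Φ` is (a version of) the `L_p` analytic GFFT `T^{(p)}_{q,h}(F)`, `1 ≤ p ≤ 2`, `q ≠ 0`.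
For `p = 1` the limit is pointwise s-a.e.; for `1 < p ≤ 2` it is the scale-invariant limit in mean
of order `p' = p / (p - 1)`. -/
def IsGFFT {T : ℝ} (m : Measure (C0 T)) (φ : ℕ → ℝ → ℝ) (p q : ℝ) (h : ℝ → ℝ)
    (F Φ : C0 T → ℂ) : Prop :=
  ScaleMeasurable m Φ ∧
  ∃ J : C0 T → ℂ → ℂ, IsWienerTransform m φ h F J ∧
    (p = 1 → SAE m (fun y =>
      Tendsto (fun z => J y z) (𝓝[Cplus] (-(Complex.I * (q : ℂ)))) (𝓝 (Φ y)))) ∧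
    (1 < p → ∀ ρ : ℝ, 0 < ρ →
      Tendsto (fun z => ∫⁻ y, ‖J (ρ • y) z - Φ (ρ • y)‖ₑ ^ (p / (p - 1)) ∂m)
        (𝓝[Cplus] (-(Complex.I * (q : ℂ)))) (𝓝 0))

/-- `R` is (a version of) the GCP `(F * G)_q^{(h₁,h₂)}`: for s-a.e. `y`, `R y` is the generalized
analytic Feynman integral with parameter `q` of
`x ↦ F ((y + 𝒵_{h₁}(x,·)) / √2) G ((y - 𝒵_{h₂}(x,·)) / √2)`. -/
def IsGCP {T : ℝ} (m : Measure (C0 T)) (φ : ℕ → ℝ → ℝ) (q : ℝ) (h₁ h₂ : ℝ → ℝ)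
    (F G R : C0 T → ℂ) : Prop :=
  ∃ Z₁ Z₂ : C0 T → C0 T, IsGaussProc m φ h₁ Z₁ ∧ IsGaussProc m φ h₂ Z₂ ∧
    SAE m (fun y => ∃ J : ℂ → ℂ,
      IsAnalyticWiener m (fun r x =>
        F ((Real.sqrt 2)⁻¹ • (y + r • Z₁ x)) * G ((Real.sqrt 2)⁻¹ • (y - r • Z₂ x))) J ∧
      Tendsto J (𝓝[Cplus] (-(Complex.I * (q : ℂ)))) (𝓝 (R y)))

/-! ### The Banach algebra `𝒮(L₂[0,T])` -/

/-- `L₂[0,T]`. -/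
abbrev L2 (T : ℝ) : Type := Lp ℝ 2 (leb T)

instance (T : ℝ) : MeasurableSpace (L2 T) := borel _

instance (T : ℝ) : BorelSpace (L2 T) := ⟨rfl⟩

/-- `F(x) = ∫ exp(i⟨u,x⟩) df(u)` at every `x` at which the right-hand side is defined, that is,
for which `⟨u,x⟩` exists for `|f|`-a.e. `u` (these are s-a.e. `x`); at all other `x` the value of
`F` is arbitrary. -/
def IsFresnelOf {T : ℝ} (φ : ℕ → ℝ → ℝ) (f : ComplexMeasure (L2 T)) (F : C0 T → ℂ) : Prop :=
  ∀ x : C0 T, (∀ᵐ u : L2 T ∂f.variation, ∃ c, HasPWZ φ (⇑u) x c) →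
    F x = f.integral (fun u : L2 T => Complex.exp (Complex.I * ((pwz φ (⇑u) x : ℝ) : ℂ)))
      (ContinuousLinearMap.mul ℝ ℂ)

/-- `F` is an element of `𝒮(L₂[0,T])`. -/
def InS {T : ℝ} (φ : ℕ → ℝ → ℝ) (F : C0 T → ℂ) : Prop :=
  ∃ f : ComplexMeasure (L2 T), IsFresnelOf φ f F

/-- `Φ` is the transform `T^{(p)}_{q,h}(F)`, taken as an element of `𝒮(L₂[0,T])`. -/
def IsGFFTInS {T : ℝ} (m : Measure (C0 T)) (φ : ℕ → ℝ → ℝ) (p q : ℝ) (h : ℝ → ℝ)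
    (F Φ : C0 T → ℂ) : Prop :=
  InS φ Φ ∧ IsGFFT m φ p q h F Φ

/-- `Φ` is the iterated transform `T_{q,g_n}(⋯ (T_{q,g_1}(F)) ⋯)` for the list `[g_1, …, g_n]`;
every transform is taken as an element of `𝒮(L₂[0,T])`. -/
def IsIteratedGFFT {T : ℝ} (m : Measure (C0 T)) (φ : ℕ → ℝ → ℝ) (p q : ℝ) :
    List (ℝ → ℝ) → (C0 T → ℂ) → (C0 T → ℂ) → Prop
  | [], F, Φ => Φ = F
  | g :: l, F, Φ => ∃ F₁ : C0 T → ℂ, IsGFFTInS m φ p q g F F₁ ∧ IsIteratedGFFT m φ p q l F₁ Φ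

/-- A function of `L_∞[0,T]` that is not a.e. zero. -/
def NonzeroLinfty (T : ℝ) (h : ℝ → ℝ) : Prop :=
  MemLp h ⊤ (leb T) ∧ ¬ h =ᵐ[leb T] 0

/-- The function `h / √2`. -/
def divSqrtTwo (h : ℝ → ℝ) : ℝ → ℝ := fun t => h t / Real.sqrt 2

end WienerGFFT

end

open scoped ENNReal NNReal InnerProductSpace

noncomputable section

namespace WienerGFFT

/-! ### Almost sure convergence from fourth moments of increments -/

section Chaining

set_option linter.unusedSectionVars false

variable {Ω : Type*} [MeasurableSpace Ω] {P : Measure Ω}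

/-! Write the complex measure of `F` in polar form `θ μ` with `|θ| = 1`, and that of `G` as `ϑ ν`.
For a bounded kernel `h` one has `⟨u, 𝒵_h(x,·)⟩ = ⟨hu, x⟩` for almost every `x`, a centred Gaussian
variable of variance `‖hu‖²`. Integrating over `x` with scale `λ^{-1/2}` therefore multiplies the
density at `u` by `exp(-‖hu‖²/(2λ))`, which is analytic in `λ` and bounded by `1` on the right half
plane. At `λ = -iq` this factor is unimodular, so the transform keeps `μ` and only rotates `θ`. In
iterated transforms the energies `‖hu‖²` add. Hence `A` and `C` carry the same density, with energy
`(‖su‖² + ‖k₁u‖²)/2`, and `B` and `D` likewise with `k₂`.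

The convolution product lives on `μ × ν`. The pair `(u,v)` enters through the path character of
`(u+v)/√2` and the Gaussian vector `(k₁u - k₂v)/√2`, and since the parameter is `-q`, its energy is
subtracted from those of the transforms. Because `s² = k₁k₂`, the polarization `⟨k₁u, k₂v⟩ = ⟨su,
sv⟩` leaves exactly `‖s(u+v)‖²/2`, the energy of the transform of the product with kernel `s`
(`energy_add_sub_norm_sq`).

Two analytic points carry the weight. The identity `⟨u, 𝒵_h(x,·)⟩ = ⟨hu, x⟩` must include the
existence of the left side as a limit of partial sums (`ae_ae_hasPWZ_gaussProc`). The terms of these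
sums are multiples of `⟨hφ_j, x⟩`, which need not be independent; convergence comes from a maximal
inequality based on fourth moments (`ae_exists_tendsto_of_fourth_moment`). Secondly, a transform is
determined only s-a.e., while the next operation evaluates it at paths `y + r 𝒵_h(x,·)`, to which
such equality need not pass. Here the choice of a version in `𝒮(L₂[0,T])` is essential: the
functional determines its measure (`withDensity_eq_of_fresnel_eq`), so every such version obeys the
expected formula wherever that formula makes sense (`IsGFFTInS.isFresnel`). -/

theorem two_mul_add_pow_four_le (a b : ℝ≥0∞) :
    2 * (a + b) ^ 4 ≤ 3 * b ^ 4 + 60000 * a ^ 4 := by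
  rcases eq_or_ne a ⊤ with rfl | ha
  · simp
  rcases eq_or_ne b ⊤ with rfl | hb
  · simp
  lift a to ℝ≥0 using ha
  lift b to ℝ≥0 using hb
  norm_cast
  rw [← NNReal.coe_le_coe]
  push_cast
  have ha := a.2
  have hb := b.2
  have ha : 0 ≤ (a : ℝ) := ha
  have hb : 0 ≤ (b : ℝ) := hb
  generalize (a : ℝ) = x at *
  generalize (b : ℝ) = y at *
  -- Cut at `y = 12x`: `2 (13/12)⁴ < 3` serves large `y`, and `2 · 13⁴ = 57122 < 60000` serves small
  -- `y`.
  rcases le_total (12 * x) y with h | h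
  · have h1 : (x + y) ^ 4 ≤ (13 / 12 * y) ^ 4 := by
      apply pow_le_pow_left₀ (by positivity); linarith
    have h2 : (13 / 12 * y) ^ 4 = (13 / 12) ^ 4 * y ^ 4 := by ring
    have h3 : 0 ≤ y ^ 4 := by positivity
    have h4 : 0 ≤ x ^ 4 := by positivity
    nlinarith
  · have h1 : (x + y) ^ 4 ≤ (13 * x) ^ 4 := by
      apply pow_le_pow_left₀ (by positivity); linarith
    have h2 : (13 * x) ^ 4 = 28561 * x ^ 4 := by ring
    have h3 : 0 ≤ y ^ 4 := by positivity
    have h4 : 0 ≤ x ^ 4 := by positivity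
    nlinarith

/-- The maximal fourth power of the increments of `Y` from time `a` to times `a, …, a + n`. -/
noncomputable def maxIncr (Y : ℕ → Ω → ℝ) (a n : ℕ) (x : Ω) : ℝ≥0∞ :=
  (Finset.range (n + 1)).sup fun k => ‖Y (a + k) x - Y a x‖ₑ ^ 4

theorem measurable_maxIncr {Y : ℕ → Ω → ℝ} (hY : ∀ n, Measurable (Y n)) (a n : ℕ) :
    Measurable (maxIncr Y a n) := by
  unfold maxIncr
  simp only [Finset.sup_eq_iSup]
  exact Measurable.iSup fun k => Measurable.iSup fun _ =>
    ((hY _).sub (hY _)).enorm.pow_const 4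

theorem le_maxIncr (Y : ℕ → Ω → ℝ) (a : ℕ) {k n : ℕ} (hk : k ≤ n) (x : Ω) :
    ‖Y (a + k) x - Y a x‖ₑ ^ 4 ≤ maxIncr Y a n x :=
  Finset.le_sup (f := fun k => ‖Y (a + k) x - Y a x‖ₑ ^ 4) (Finset.mem_range.2 (by omega))

/-- An index beyond `j` is reached by the jump to `a + (j+1)` followed by an increment of the second
block. Bounding a maximum by a sum would give a factor `1` per block; the slack `3/2` pays for the
jump. -/
theorem two_mul_maxIncr_le (Y : ℕ → Ω → ℝ) (a j n : ℕ) (x : Ω) :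
    2 * maxIncr Y a (j + 1 + n) x ≤ 3 * maxIncr Y a j x + 3 * maxIncr Y (a + (j + 1)) n x
      + 60000 * ‖Y (a + (j + 1)) x - Y a x‖ₑ ^ 4 := by
  have key : ∀ k ∈ Finset.range (j + 1 + n + 1), 2 * ‖Y (a + k) x - Y a x‖ₑ ^ 4 ≤
      3 * maxIncr Y a j x + 3 * maxIncr Y (a + (j + 1)) n x
      + 60000 * ‖Y (a + (j + 1)) x - Y a x‖ₑ ^ 4 := by
    intro k hk
    rw [Finset.mem_range] at hk
    rcases le_or_gt k j with h | h
    · calc 2 * ‖Y (a + k) x - Y a x‖ₑ ^ 4 ≤ 3 * maxIncr Y a j x := by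
            gcongr
            · norm_num
            · exact le_maxIncr Y a h x
        _ ≤ _ := by rw [add_assoc]; exact le_self_add
    · obtain ⟨i, rfl⟩ : ∃ i, k = j + 1 + i := ⟨k - (j + 1), by omega⟩
      have h1 : ‖Y (a + (j + 1 + i)) x - Y a x‖ₑ ≤
          ‖Y (a + (j + 1)) x - Y a x‖ₑ + ‖Y (a + (j + 1) + i) x - Y (a + (j + 1)) x‖ₑ := by
        rw [← add_assoc a]
        calc _ = ‖(Y (a + (j + 1)) x - Y a x) + (Y (a + (j + 1) + i) x - Y (a + (j + 1)) x)‖ₑ := by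
              congr 1; ring
          _ ≤ _ := enorm_add_le _ _
      calc 2 * ‖Y (a + (j + 1 + i)) x - Y a x‖ₑ ^ 4
          ≤ 2 * (‖Y (a + (j + 1)) x - Y a x‖ₑ
            + ‖Y (a + (j + 1) + i) x - Y (a + (j + 1)) x‖ₑ) ^ 4 := by gcongr
        _ ≤ _ := two_mul_add_pow_four_le _ _
        _ ≤ 3 * maxIncr Y (a + (j + 1)) n x
              + 60000 * ‖Y (a + (j + 1)) x - Y a x‖ₑ ^ 4 := by
            gcongr
            exact le_maxIncr Y (a + (j + 1)) (by omega) x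
        _ ≤ _ := by rw [add_assoc (3 * maxIncr Y a j x)]; exact le_add_self
  rw [mul_comm, ← ENNReal.le_div_iff_mul_le (by simp) (by simp)]
  refine Finset.sup_le fun k hk => ?_
  rw [ENNReal.le_div_iff_mul_le (by simp) (by simp), mul_comm]
  exact key k hk

/-- Maximal inequality from fourth moments of the increments, by bisection. -/
theorem lintegral_maxIncr_le {Y : ℕ → Ω → ℝ} (hY : ∀ n, Measurable (Y n)) {t : ℕ → ℝ}
    (ht : Monotone t) {C : ℝ≥0∞}
    (hC : ∀ m n, m ≤ n → ∫⁻ x, ‖Y n x - Y m x‖ₑ ^ 4 ∂P ≤ C * ENNReal.ofReal (t n - t m) ^ 2)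
    (n : ℕ) : ∀ a, ∫⁻ x, maxIncr Y a n x ∂P ≤
      120000 * C * ENNReal.ofReal (t (a + n) - t a) ^ 2 := by
  induction n using Nat.strong_induction_on with
  | _ n ih =>
    intro a
    rcases Nat.eq_zero_or_pos n with rfl | hn
    · simp [maxIncr]
    set τ := t (a + n) - t a with hτ
    have hτ0 : 0 ≤ τ := sub_nonneg.2 (ht (by omega))
    classical
    let p : ℕ → Prop := fun j => t (a + j) - t a ≤ τ / 2
    have hp0 : p 0 := by simp only [p]; simp; linarith
    -- The last index in the first half of the time interval: the blocks before and after the step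
    -- from `j` to `j+1` both have length at most `τ/2`.
    set j := Nat.findGreatest p (n - 1) with hj
    have hjn : j ≤ n - 1 := Nat.findGreatest_le _
    have hpj : p j := Nat.findGreatest_spec (P := p) (Nat.zero_le _) hp0
    have hsucc : t (a + n) - t (a + (j + 1)) ≤ τ / 2 := by
      rcases Nat.lt_or_ge (n - 1) (j + 1) with h | h
      · have : j + 1 = n := by omega
        rw [this]; simp; linarith
      · have := Nat.findGreatest_is_greatest (P := p) (n := n - 1) (k := j + 1) (by omega) h
        simp only [p, not_le] at this
        linarith
    obtain ⟨i, hi⟩ : ∃ i, n = j + 1 + i := ⟨n - (j + 1), by omega⟩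
    set r := ENNReal.ofReal (τ / 2) with hr
    have hτr : ENNReal.ofReal τ = 2 * r := by
      rw [hr, ← ENNReal.ofReal_ofNat, ← ENNReal.ofReal_mul (by norm_num)]
      congr 1; ring
    have e1 : ∫⁻ x, maxIncr Y a j x ∂P ≤ 120000 * C * r ^ 2 := by
      refine (ih j (by omega) a).trans ?_
      gcongr 120000 * C * ?_ ^ 2
      exact ENNReal.ofReal_le_ofReal hpj
    have e2 : ∫⁻ x, maxIncr Y (a + (j + 1)) i x ∂P ≤ 120000 * C * r ^ 2 := by
      refine (ih i (by omega) _).trans ?_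
      have : a + (j + 1) + i = a + n := by omega
      rw [this]
      gcongr 120000 * C * ?_ ^ 2
      exact ENNReal.ofReal_le_ofReal hsucc
    have e3 : ∫⁻ x, ‖Y (a + (j + 1)) x - Y a x‖ₑ ^ 4 ∂P ≤ C * (2 * r) ^ 2 := by
      refine (hC a (a + (j + 1)) (by omega)).trans ?_
      rw [← hτr]
      gcongr
      rw [hτ]
      gcongr
      exact ht (by omega)
    have hm := measurable_maxIncr hY
    have hD : Measurable fun x => ‖Y (a + (j + 1)) x - Y a x‖ₑ ^ 4 :=
      ((hY _).sub (hY _)).enorm.pow_const 4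
    -- The constant `K = 120000` solves `3K + 3K + 60000 · 4 = 2K · 4`. The induction closes because
    -- squaring a halved time gains `1/4`, more than the two blocks with factor `3/2` lose.
    have main : 2 * ∫⁻ x, maxIncr Y a n x ∂P ≤ 2 * (120000 * C * (2 * r) ^ 2) := by
      calc 2 * ∫⁻ x, maxIncr Y a n x ∂P = ∫⁻ x, 2 * maxIncr Y a n x ∂P := by
            rw [lintegral_const_mul _ (hm _ _)]
        _ ≤ ∫⁻ x, (3 * maxIncr Y a j x + 3 * maxIncr Y (a + (j + 1)) i x
              + 60000 * ‖Y (a + (j + 1)) x - Y a x‖ₑ ^ 4) ∂P := by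
            refine lintegral_mono fun x => ?_
            rw [hi]
            exact two_mul_maxIncr_le Y a j i x
        _ = 3 * ∫⁻ x, maxIncr Y a j x ∂P + 3 * ∫⁻ x, maxIncr Y (a + (j + 1)) i x ∂P
              + 60000 * ∫⁻ x, ‖Y (a + (j + 1)) x - Y a x‖ₑ ^ 4 ∂P := by
            rw [lintegral_add_right _ (hD.const_mul _), lintegral_add_right _ ((hm _ _).const_mul _),
              lintegral_const_mul _ (hm _ _), lintegral_const_mul _ (hm _ _),
              lintegral_const_mul _ hD]
        _ ≤ 3 * (120000 * C * r ^ 2) + 3 * (120000 * C * r ^ 2) + 60000 * (C * (2 * r) ^ 2) := by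
            gcongr
        _ = 2 * (120000 * C * (2 * r) ^ 2) := by ring
    rw [hτr]
    exact (ENNReal.mul_le_mul_iff_right (by simp) (by simp)).1 main

/-- A sequence whose increments have fourth moments `≤ C (t n - t m) ^ 2`, with `t` monotone and
bounded, converges almost surely. -/
theorem ae_exists_tendsto_of_fourth_moment {Y : ℕ → Ω → ℝ} (hY : ∀ n, Measurable (Y n))
    {t : ℕ → ℝ} (ht : Monotone t) (hb : BddAbove (range t)) {C : ℝ≥0∞} (hCtop : C ≠ ⊤)
    (hC : ∀ m n, m ≤ n → ∫⁻ x, ‖Y n x - Y m x‖ₑ ^ 4 ∂P ≤ C * ENNReal.ofReal (t n - t m) ^ 2) :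
    ∀ᵐ x ∂P, ∃ c, Tendsto (fun n => Y n x) atTop (𝓝 c) := by
  set L := ⨆ n, t n
  have hL : Tendsto t atTop (𝓝 L) := tendsto_atTop_ciSup ht hb
  have htL : ∀ n, t n ≤ L := fun n => le_ciSup hb n
  let W : ℕ → Ω → ℝ≥0∞ := fun a x => ⨆ n, maxIncr Y a n x
  have hWm : ∀ a, Measurable (W a) := fun a => Measurable.iSup fun n => measurable_maxIncr hY a n
  have hW : ∀ a, ∫⁻ x, W a x ∂P ≤ 120000 * C * ENNReal.ofReal (L - t a) ^ 2 := by
    intro a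
    rw [lintegral_iSup (fun n => measurable_maxIncr hY a n)]
    · refine iSup_le fun n => (lintegral_maxIncr_le hY ht hC n a).trans ?_
      gcongr
      exact htL _
    · intro n n' hn x
      exact Finset.sup_mono (Finset.range_mono (by omega))
  have hlim : Tendsto (fun a => 120000 * C * ENNReal.ofReal (L - t a) ^ 2) atTop (𝓝 0) := by
    have h1 : Tendsto (fun a => L - t a) atTop (𝓝 0) := by
      simpa using (tendsto_const_nhds (x := L)).sub hL
    have h2 := (ENNReal.continuous_ofReal.tendsto _).comp h1
    have h3 := ((ENNReal.continuous_pow 2).tendsto _).comp h2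
    have h4 := ENNReal.Tendsto.const_mul (a := 120000 * C) h3
      (Or.inr (ENNReal.mul_ne_top (by simp) hCtop))
    simpa [Function.comp_def] using h4
  -- The oscillation after time `a` has integral tending to `0`, so its infimum over `a` vanishes
  -- almost surely, which is the Cauchy property.
  have h0 : ∫⁻ x, ⨅ a, W a x ∂P = 0 := by
    refine le_antisymm (ge_of_tendsto' hlim fun a => ?_) (zero_le)
    exact (lintegral_mono fun x => iInf_le _ a).trans (hW a)
  rw [lintegral_eq_zero_iff (Measurable.iInf hWm)] at h0
  filter_upwards [h0] with x hx
  refine cauchySeq_tendsto_of_complete (Metric.cauchySeq_iff'.2 fun ε hε => ?_)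
  have hpos : (0 : ℝ≥0∞) < ENNReal.ofReal ε ^ 4 := by
    simp [pos_iff_ne_zero, hε]
  have hx' : ⨅ a, W a x < ENNReal.ofReal ε ^ 4 := by
    rw [show ⨅ a, W a x = 0 from hx]; exact hpos
  obtain ⟨a, ha⟩ := iInf_lt_iff.1 hx'
  refine ⟨a, fun n hn => ?_⟩
  obtain ⟨k, rfl⟩ := Nat.exists_eq_add_of_le hn
  have h1 : ‖Y (a + k) x - Y a x‖ₑ ^ 4 < ENNReal.ofReal ε ^ 4 :=
    ((le_maxIncr Y a le_rfl x).trans (le_iSup (fun n => maxIncr Y a n x) k)).trans_lt ha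
  have h2 : ‖Y (a + k) x - Y a x‖ₑ < ENNReal.ofReal ε := (ENNReal.pow_lt_pow_left_iff (by norm_num)).1 h1
  rw [← ofReal_norm, ENNReal.ofReal_lt_ofReal_iff hε] at h2
  rwa [dist_eq_norm]

end Chaining

/-! ### The Riemann-Stieltjes integral of a function of bounded variation -/

/-- The `i`-th point of the uniform partition of `[0,T]` into `N` intervals. -/
def grid (T : ℝ) (N i : ℕ) : ℝ := T * (i : ℝ) / (N : ℝ)

/-- Riemann-Stieltjes sums along the uniform partitions. -/
def rsSum {T : ℝ} (φ : ℝ → ℝ) (x : C0 T) (N : ℕ) : ℝ :=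
  ∑ i ∈ Finset.range N, φ (grid T N i) * (ev x (grid T N (i + 1)) - ev x (grid T N i))

theorem rsInt_eq_limUnder {T : ℝ} (φ : ℝ → ℝ) (x : C0 T) :
    rsInt φ x = limUnder atTop (rsSum φ x) := by
  unfold rsInt rsSum grid
  simp

variable {T : ℝ}

theorem grid_mem (hT : 0 < T) {N i : ℕ} (hi : i ≤ N) : grid T N i ∈ Icc (0 : ℝ) T := by
  rcases Nat.eq_zero_or_pos N with rfl | hN
  · simp [grid, hT.le]
  have hN' : (0 : ℝ) < N := by exact_mod_cast hN
  have hi' : (i : ℝ) ≤ N := by exact_mod_cast hi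
  refine ⟨by unfold grid; positivity, ?_⟩
  rw [grid, div_le_iff₀ hN']
  gcongr

theorem grid_mono (hT : 0 < T) (N : ℕ) : Monotone (grid T N) := by
  intro i j hij
  have : (i : ℝ) ≤ j := by exact_mod_cast hij
  unfold grid
  gcongr

theorem grid_zero (T : ℝ) (N : ℕ) : grid T N 0 = 0 := by simp [grid]

theorem grid_self (T : ℝ) {N : ℕ} (hN : 0 < N) : grid T N N = T := by
  have : (N : ℝ) ≠ 0 := by exact_mod_cast hN.ne'
  simp [grid, this]

theorem grid_mul (T : ℝ) {N M : ℕ} (hM : 0 < M) (i : ℕ) : grid T (N * M) (i * M) = grid T N i := by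
  have : (M : ℝ) ≠ 0 := by exact_mod_cast hM.ne'
  unfold grid
  push_cast
  rw [← mul_assoc, mul_div_mul_right _ _ this]

theorem grid_succ_sub (T : ℝ) (N i : ℕ) : grid T N (i + 1) - grid T N i = T / N := by
  unfold grid
  push_cast
  ring

theorem ev_add (x y : C0 T) (t : ℝ) : ev (x + y) t = ev x t + ev y t := by
  unfold ev; split_ifs <;> simp

theorem ev_smul (c : ℝ) (x : C0 T) (t : ℝ) : ev (c • x) t = c * ev x t := by
  unfold ev; split_ifs <;> simp

theorem ev_zero (x : C0 T) : ev x 0 = 0 := by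
  unfold ev
  split_ifs with h
  · exact x.2 ⟨0, h⟩ rfl
  · rfl

theorem continuous_ev (t : ℝ) : Continuous fun x : C0 T => ev x t := by
  unfold ev
  split_ifs with h
  · exact (ContinuousEvalConst.continuous_eval_const (F := C(Icc (0 : ℝ) T, ℝ)) ⟨t, h⟩).comp continuous_subtype_val
  · exact continuous_const

theorem measurable_ev (t : ℝ) : Measurable fun x : C0 T => ev x t := (continuous_ev t).measurable

theorem exists_ev_modulus (x : C0 T) {ε : ℝ} (hε : 0 < ε) :
    ∃ δ > 0, ∀ s ∈ Icc (0 : ℝ) T, ∀ t ∈ Icc (0 : ℝ) T, |s - t| < δ → |ev x s - ev x t| < ε := by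
  have h := CompactSpace.uniformContinuous_of_continuous (x : C(Icc (0 : ℝ) T, ℝ)).continuous
  obtain ⟨δ, hδ, H⟩ := Metric.uniformContinuous_iff.1 h ε hε
  refine ⟨δ, hδ, fun s hs t ht hst => ?_⟩
  have := H (a := ⟨s, hs⟩) (b := ⟨t, ht⟩) hst
  simpa [ev, hs, ht, Real.dist_eq] using this

theorem sum_range_mul_block (g : ℕ → ℝ) (N M : ℕ) :
    ∑ k ∈ Finset.range (N * M), g k
      = ∑ i ∈ Finset.range N, ∑ j ∈ Finset.range M, g (i * M + j) := by
  induction N with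
  | zero => simp
  | succ n ih => rw [Nat.succ_mul, Finset.sum_range_add, ih, Finset.sum_range_succ]

theorem sum_abs_sub_le_variation (hT : 0 < T) {φ : ℝ → ℝ}
    (hφ : BoundedVariationOn φ (Icc (0 : ℝ) T)) (N : ℕ) :
    ∑ i ∈ Finset.range N, |φ (grid T N (i + 1)) - φ (grid T N i)|
      ≤ (eVariationOn φ (Icc (0 : ℝ) T)).toReal := by
  have h := eVariationOn.sum_le_of_monotoneOn_Iic (f := φ) (s := Icc (0 : ℝ) T) (n := N)
    (u := grid T N) ((grid_mono hT N).monotoneOn _) (fun i hi => grid_mem hT hi)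
  have h2 := ENNReal.toReal_mono hφ h
  rw [ENNReal.toReal_sum (fun _ _ => edist_ne_top _ _)] at h2
  simpa [edist_dist, Real.dist_eq] using h2

/-- Summation by parts moves the differences onto `φ`, where bounded variation controls them; the
boundary term at `0` vanishes with the path. -/
theorem rsSum_eq_abel (φ : ℝ → ℝ) (x : C0 T) {N : ℕ} (hN : 0 < N) :
    rsSum φ x N = φ T * ev x T
      - ∑ i ∈ Finset.range N, ev x (grid T N (i + 1)) * (φ (grid T N (i + 1)) - φ (grid T N i)) := by
  have h := Finset.sum_range_sub (fun i => φ (grid T N i) * ev x (grid T N i)) N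
  simp only [grid_self T hN, grid_zero, ev_zero, mul_zero, sub_zero] at h
  rw [← h, ← Finset.sum_sub_distrib]
  exact Finset.sum_congr rfl fun i _ => by ring

/-- After summation by parts, refining the partition only changes the points at which the path is
evaluated, each by at most the mesh. Its modulus of continuity is then weighted by the variation of
`φ`. -/
theorem abs_rsSum_sub_mul_le (hT : 0 < T) {φ : ℝ → ℝ}
    (hφ : BoundedVariationOn φ (Icc (0 : ℝ) T)) (x : C0 T) {ε δ : ℝ}
    (H : ∀ s ∈ Icc (0 : ℝ) T, ∀ t ∈ Icc (0 : ℝ) T, |s - t| < δ → |ev x s - ev x t| < ε)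
    {N M : ℕ} (hN : 0 < N) (hM : 0 < M) (hNδ : T / N < δ) :
    |rsSum φ x N - rsSum φ x (N * M)| ≤ ε * (eVariationOn φ (Icc (0 : ℝ) T)).toReal := by
  have hNM : 0 < N * M := Nat.mul_pos hN hM
  rw [rsSum_eq_abel φ x hN, rsSum_eq_abel φ x hNM]
  have e1 : ∑ i ∈ Finset.range N, ev x (grid T N (i + 1)) * (φ (grid T N (i + 1)) - φ (grid T N i))
      = ∑ i ∈ Finset.range N, ∑ j ∈ Finset.range M, ev x (grid T N (i + 1)) *
        (φ (grid T (N * M) (i * M + j + 1)) - φ (grid T (N * M) (i * M + j))) := by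
    refine Finset.sum_congr rfl fun i _ => ?_
    rw [← Finset.mul_sum]
    congr 1
    have := Finset.sum_range_sub (fun j => φ (grid T (N * M) (i * M + j))) M
    simp only [← add_assoc] at this
    rw [this, add_zero, grid_mul T hM, ← Nat.succ_mul, grid_mul T hM]
  rw [e1, sum_range_mul_block]
  have e2 := sum_abs_sub_le_variation hT hφ (N * M)
  rw [sum_range_mul_block] at e2
  have hε : 0 ≤ ε := by
    have := H 0 ⟨le_rfl, hT.le⟩ 0 ⟨le_rfl, hT.le⟩ (by
      simp only [sub_self, abs_zero]; exact lt_trans (by positivity) hNδ)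
    simpa using (abs_nonneg _).trans this.le
  calc _ = |∑ i ∈ Finset.range N, ∑ j ∈ Finset.range M,
          (ev x (grid T (N * M) (i * M + j + 1)) - ev x (grid T N (i + 1))) *
          (φ (grid T (N * M) (i * M + j + 1)) - φ (grid T (N * M) (i * M + j)))| := by
        congr 1
        rw [sub_sub_sub_cancel_left, ← Finset.sum_sub_distrib]
        refine Finset.sum_congr rfl fun i _ => ?_
        rw [← Finset.sum_sub_distrib]
        exact Finset.sum_congr rfl fun j _ => by ring
    _ ≤ ∑ i ∈ Finset.range N, ∑ j ∈ Finset.range M, ε *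
          |φ (grid T (N * M) (i * M + j + 1)) - φ (grid T (N * M) (i * M + j))| := by
        refine (Finset.abs_sum_le_sum_abs _ _).trans (Finset.sum_le_sum fun i hi => ?_)
        refine (Finset.abs_sum_le_sum_abs _ _).trans (Finset.sum_le_sum fun j hj => ?_)
        rw [abs_mul]
        rw [Finset.mem_range] at hi hj
        have hle : i * M + j + 1 ≤ (i + 1) * M := by rw [Nat.succ_mul]; omega
        have hle2 : (i + 1) * M ≤ N * M := Nat.mul_le_mul_right _ hi
        gcongr
        refine (H _ (grid_mem hT (hle.trans hle2)) _ (grid_mem hT hi) ?_).le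
        have m1 := grid_mono hT (N * M) hle
        have m2 := grid_mono hT (N * M) (show i * M ≤ i * M + j + 1 by omega)
        rw [grid_mul T hM] at m1 m2
        have m3 := grid_succ_sub T N i
        rw [abs_sub_comm, abs_of_nonneg (by linarith)]
        linarith
    _ = ε * ∑ i ∈ Finset.range N, ∑ j ∈ Finset.range M,
          |φ (grid T (N * M) (i * M + j + 1)) - φ (grid T (N * M) (i * M + j))| := by
        simp_rw [Finset.mul_sum]
    _ ≤ _ := by gcongr

theorem tendsto_rsSum (hT : 0 < T) {φ : ℝ → ℝ} (hφ : BoundedVariationOn φ (Icc (0 : ℝ) T))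
    (x : C0 T) : Tendsto (rsSum φ x) atTop (𝓝 (rsInt φ x)) := by
  rw [rsInt_eq_limUnder]
  set V := (eVariationOn φ (Icc (0 : ℝ) T)).toReal
  have hV : 0 ≤ V := ENNReal.toReal_nonneg
  have hc : CauchySeq (rsSum φ x) := by
    refine Metric.cauchySeq_iff.2 fun ε hε => ?_
    obtain ⟨δ, hδ, H⟩ := exists_ev_modulus x (ε := ε / (2 * (V + 1))) (by positivity)
    obtain ⟨N0, hN0⟩ := exists_nat_gt (T / δ)
    have hN0' : (0 : ℝ) < N0 := lt_trans (by positivity) hN0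
    have hpos : ∀ n ≥ N0, 0 < n ∧ T / n < δ := by
      intro n hn
      have h1 : (N0 : ℝ) ≤ n := by exact_mod_cast hn
      have h2 : (0 : ℝ) < n := lt_of_lt_of_le hN0' h1
      refine ⟨by exact_mod_cast h2, ?_⟩
      rw [div_lt_iff₀ h2]
      rw [div_lt_iff₀ hδ] at hN0
      nlinarith
    -- The partitions into `n` and `k` intervals are compared through their common refinement into
    -- `n * k` intervals.
    refine ⟨N0, fun n hn k hk => ?_⟩
    have a1 := abs_rsSum_sub_mul_le hT hφ x H (hpos n hn).1 (hpos k hk).1 (hpos n hn).2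
    have a2 := abs_rsSum_sub_mul_le hT hφ x H (hpos k hk).1 (hpos n hn).1 (hpos k hk).2
    rw [mul_comm k n, abs_sub_comm] at a2
    have a3 : ε / (2 * (V + 1)) * V < ε / 2 := by
      rw [div_mul_eq_mul_div, div_lt_div_iff₀ (by positivity) (by norm_num)]
      nlinarith
    rw [Real.dist_eq]
    calc _ ≤ |rsSum φ x n - rsSum φ x (n * k)| + |rsSum φ x (n * k) - rsSum φ x k| :=
          abs_sub_le _ _ _
      _ < ε := by linarith
  exact tendsto_nhds_limUnder (cauchySeq_tendsto_of_complete hc)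

theorem rsInt_add (hT : 0 < T) {φ : ℝ → ℝ} (hφ : BoundedVariationOn φ (Icc (0 : ℝ) T))
    (x y : C0 T) : rsInt φ (x + y) = rsInt φ x + rsInt φ y := by
  refine tendsto_nhds_unique (tendsto_rsSum hT hφ (x + y)) ?_
  refine ((tendsto_rsSum hT hφ x).add (tendsto_rsSum hT hφ y)).congr fun N => ?_
  simp only [rsSum, ev_add, ← Finset.sum_add_distrib]
  exact Finset.sum_congr rfl fun i _ => by ring

theorem rsInt_smul (hT : 0 < T) {φ : ℝ → ℝ} (hφ : BoundedVariationOn φ (Icc (0 : ℝ) T))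
    (c : ℝ) (x : C0 T) : rsInt φ (c • x) = c * rsInt φ x := by
  refine tendsto_nhds_unique (tendsto_rsSum hT hφ (c • x)) ?_
  refine ((tendsto_rsSum hT hφ x).const_mul c).congr fun N => ?_
  simp only [rsSum, ev_smul, Finset.mul_sum]
  exact Finset.sum_congr rfl fun i _ => by ring

theorem measurable_rsSum (φ : ℝ → ℝ) (N : ℕ) : Measurable fun x : C0 T => rsSum φ x N := by
  unfold rsSum
  exact Finset.measurable_sum _ fun i _ => ((measurable_ev _).sub (measurable_ev _)).const_mul _

theorem measurable_rsInt (hT : 0 < T) {φ : ℝ → ℝ} (hφ : BoundedVariationOn φ (Icc (0 : ℝ) T)) :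
    Measurable fun x : C0 T => rsInt φ x :=
  measurable_of_tendsto_metrizable (measurable_rsSum φ)
    (tendsto_pi_nhds.2 fun x => tendsto_rsSum hT hφ x)

/-! ### Step functions along the uniform partitions -/

/-- The step function with value `φ (grid T N i)` on `(grid T N i, grid T N (i+1)]`. -/
def stepFn (T : ℝ) (φ : ℝ → ℝ) (N : ℕ) (t : ℝ) : ℝ :=
  ∑ i ∈ Finset.range N, (Ioc (grid T N i) (grid T N (i + 1))).indicator (fun _ => φ (grid T N i)) t

theorem measurable_stepFn (T : ℝ) (φ : ℝ → ℝ) (N : ℕ) : Measurable (stepFn T φ N) := by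
  unfold stepFn
  exact Finset.measurable_sum _ fun i _ => measurable_const.indicator measurableSet_Ioc

/-- The index is chosen before `φ`, so that step functions of several integrands can be combined at
one grid point. -/
theorem exists_stepFn_eq (hT : 0 < T) {N : ℕ} (hN : 0 < N) {t : ℝ} (ht : t ∈ Ioc (0 : ℝ) T) :
    ∃ i < N, t ∈ Ioc (grid T N i) (grid T N (i + 1)) ∧ ∀ φ, stepFn T φ N t = φ (grid T N i) := by
  classical
  have hex : ∃ i, t ≤ grid T N (i + 1) := ⟨N - 1, by
    rw [Nat.sub_add_cancel hN, grid_self T hN]; exact ht.2⟩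
  set i := Nat.find hex
  have hi : t ≤ grid T N (i + 1) := Nat.find_spec hex
  have hiN : i < N := by
    have : i ≤ N - 1 := Nat.find_min' hex (by
      rw [Nat.sub_add_cancel hN, grid_self T hN]; exact ht.2)
    omega
  have hlow : grid T N i < t := by
    rcases Nat.eq_zero_or_pos i with h | h
    · rw [h, grid_zero]; exact ht.1
    · have := Nat.find_min hex (m := i - 1) (by omega)
      rw [Nat.sub_add_cancel h] at this
      exact not_le.1 this
  refine ⟨i, hiN, ⟨hlow, hi⟩, fun φ => ?_⟩
  unfold stepFn
  rw [Finset.sum_eq_single i]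
  · have hmem : t ∈ Ioc (grid T N i) (grid T N (i + 1)) := ⟨hlow, hi⟩
    exact indicator_of_mem hmem _
  · intro j _ hji
    refine indicator_of_notMem (fun hj => ?_) _
    rcases lt_or_gt_of_ne hji with h | h
    · exact absurd (hj.2.trans (grid_mono hT N h)) (not_le.2 hlow)
    · exact absurd (hi.trans (grid_mono hT N h)) (not_le.2 hj.1)
  · intro h
    exact absurd (Finset.mem_range.2 hiN) h

theorem leb_eq_restrict_Ioc (T : ℝ) : leb T = volume.restrict (Ioc (0 : ℝ) T) :=
  (restrict_Ioc_eq_restrict_Icc).symm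

theorem ae_leb_mem (T : ℝ) : ∀ᵐ t ∂(leb T), t ∈ Ioc (0 : ℝ) T := by
  rw [leb_eq_restrict_Ioc]
  exact ae_restrict_mem measurableSet_Ioc

theorem abs_le_of_boundedVariationOn (hT : 0 < T) {φ : ℝ → ℝ}
    (hφ : BoundedVariationOn φ (Icc (0 : ℝ) T)) {t : ℝ} (ht : t ∈ Icc (0 : ℝ) T) :
    |φ t| ≤ |φ 0| + (eVariationOn φ (Icc (0 : ℝ) T)).toReal := by
  have h0 : (0 : ℝ) ∈ Icc (0 : ℝ) T := ⟨le_rfl, hT.le⟩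
  have := hφ.dist_le ht h0
  rw [Real.dist_eq] at this
  have h2 := abs_sub_abs_le_abs_sub (φ t) (φ 0)
  linarith

theorem abs_stepFn_le (hT : 0 < T) {φ : ℝ → ℝ} {B : ℝ} (hB : ∀ t ∈ Icc (0 : ℝ) T, |φ t| ≤ B)
    (N : ℕ) {t : ℝ} (ht : t ∈ Ioc (0 : ℝ) T) : |stepFn T φ N t| ≤ B := by
  rcases Nat.eq_zero_or_pos N with rfl | hN
  · simp only [stepFn, Finset.range_zero, Finset.sum_empty, abs_zero]
    exact (abs_nonneg _).trans (hB T ⟨hT.le, le_rfl⟩)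
  obtain ⟨i, hi, -, h⟩ := exists_stepFn_eq hT hN ht
  rw [h]
  exact hB _ (grid_mem hT hi.le)

/-- A function of bounded variation is differentiable, hence continuous, almost everywhere, and the
step function takes its values within one mesh of `t`. -/
theorem ae_tendsto_stepFn (hT : 0 < T) {φ : ℝ → ℝ} (hφ : BoundedVariationOn φ (Icc (0 : ℝ) T)) :
    ∀ᵐ t ∂(leb T), Tendsto (fun N => stepFn T φ N t) atTop (𝓝 (φ t)) := by
  have h := (uIcc_of_le hT.le ▸ hφ : BoundedVariationOn φ (uIcc 0 T)).ae_differentiableAt_of_mem_uIcc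
  rw [uIcc_of_le hT.le] at h
  filter_upwards [ae_leb_mem T, ae_restrict_of_ae h] with t ht hd
  have hc := (hd ⟨ht.1.le, ht.2⟩).continuousAt
  have hex : ∀ N : ℕ, ∃ s, (0 < N → stepFn T φ N t = φ s) ∧ |s - t| ≤ T / N := by
    intro N
    rcases Nat.eq_zero_or_pos N with rfl | hN
    -- For `N = 0` the bound `T / N` is `0` by convention, which forces `s = t`.
    · exact ⟨t, fun h => absurd h (lt_irrefl _), by simp⟩
    obtain ⟨i, hi, hti, h⟩ := exists_stepFn_eq hT hN ht
    refine ⟨grid T N i, fun _ => h φ, ?_⟩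
    have := grid_succ_sub T N i
    rw [abs_sub_comm, abs_of_nonneg (by linarith [hti.1])]
    linarith [hti.2]
  choose s hs hs' using hex
  have hst : Tendsto s atTop (𝓝 t) := by
    rw [tendsto_iff_dist_tendsto_zero]
    refine squeeze_zero (fun _ => dist_nonneg) (fun N => ?_) (tendsto_const_div_atTop_nhds_zero_nat T)
    rw [Real.dist_eq]
    exact hs' N
  refine (hc.tendsto.comp hst).congr' ?_
  filter_upwards [eventually_gt_atTop 0] with N hN
  exact (hs N hN).symm

/-- Boundedness is clear; measurability comes from the approximation by step functions. -/
theorem memLp_of_boundedVariationOn (hT : 0 < T) {φ : ℝ → ℝ}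
    (hφ : BoundedVariationOn φ (Icc (0 : ℝ) T)) (p : ℝ≥0∞) : MemLp φ p (leb T) := by
  refine MemLp.of_bound (aestronglyMeasurable_of_tendsto_ae atTop
    (fun N => (measurable_stepFn T φ N).aestronglyMeasurable) (ae_tendsto_stepFn hT hφ))
    (|φ 0| + (eVariationOn φ (Icc (0 : ℝ) T)).toReal) ?_
  filter_upwards [ae_leb_mem T] with t ht
  exact abs_le_of_boundedVariationOn hT hφ (Ioc_subset_Icc_self ht)

variable {T : ℝ} {m : Measure (C0 T)} {φ : ℕ → ℝ → ℝ}

/-! ### Gaussian laws under Wiener measure -/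

theorem IsWienerMeasure.isProbabilityMeasure (hT : 0 < T) (hm : IsWienerMeasure m) :
    IsProbabilityMeasure m := by
  have : Nonempty (Icc (0 : ℝ) T) := ⟨⟨0, le_rfl, hT.le⟩⟩
  exact hm.gaussian.isProbabilityMeasure

theorem IsWienerMeasure.memLp_ev (hm : IsWienerMeasure m) {t : ℝ} (ht : t ∈ Icc (0 : ℝ) T) :
    MemLp (fun x : C0 T => ev x t) 2 m := by
  have := (hm.gaussian.hasGaussianLaw_eval ⟨t, ht⟩).memLp_two
  convert this using 2 with x
  simp [ev, ht]

/-- The increment of a path over the `i`-th interval of the uniform partition. -/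
def incr (N i : ℕ) (x : C0 T) : ℝ := ev x (grid T N (i + 1)) - ev x (grid T N i)

theorem IsWienerMeasure.memLp_incr (hT : 0 < T) (hm : IsWienerMeasure m) {N i : ℕ} (hi : i < N) :
    MemLp (incr (T := T) N i) 2 m :=
  (hm.memLp_ev (grid_mem hT hi)).sub (hm.memLp_ev (grid_mem hT hi.le))

theorem IsWienerMeasure.integral_incr (hT : 0 < T) (hm : IsWienerMeasure m) {N i : ℕ}
    (hi : i < N) : ∫ x, incr (T := T) N i x ∂m = 0 := by
  have := hm.isProbabilityMeasure hT
  unfold incr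
  rw [integral_sub ((hm.memLp_ev (grid_mem hT hi)).integrable (by norm_num))
    ((hm.memLp_ev (grid_mem hT hi.le)).integrable (by norm_num)), hm.mean _ (grid_mem hT hi),
    hm.mean _ (grid_mem hT hi.le), sub_zero]

theorem IsWienerMeasure.integral_incr_mul_incr (hT : 0 < T) (hm : IsWienerMeasure m) {N i j : ℕ}
    (hi : i < N) (hj : j < N) :
    ∫ x, incr (T := T) N i x * incr N j x ∂m = if i = j then T / N else 0 := by
  have hint : ∀ a ≤ N, ∀ b ≤ N,
      Integrable (fun x : C0 T => ev x (grid T N a) * ev x (grid T N b)) m := fun a ha b hb =>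
    (hm.memLp_ev (grid_mem hT ha)).integrable_mul (hm.memLp_ev (grid_mem hT hb))
  have hval : ∀ a ≤ N, ∀ b ≤ N, ∫ x : C0 T, ev x (grid T N a) * ev x (grid T N b) ∂m
      = grid T N (min a b) := fun a ha b hb => by
    rw [hm.cov _ (grid_mem hT ha) _ (grid_mem hT hb), (grid_mono hT N).map_min]
  have e : ∀ x : C0 T, incr N i x * incr N j x =
      (ev x (grid T N (i + 1)) * ev x (grid T N (j + 1)) - ev x (grid T N (i + 1)) * ev x (grid T N j))
      - (ev x (grid T N i) * ev x (grid T N (j + 1)) - ev x (grid T N i) * ev x (grid T N j)) := by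
    intro x; unfold incr; ring
  simp_rw [e]
  have i1 : Integrable (fun x : C0 T => ev x (grid T N (i + 1)) * ev x (grid T N (j + 1))
      - ev x (grid T N (i + 1)) * ev x (grid T N j)) m := (hint _ hi _ hj).sub (hint _ hi _ hj.le)
  have i2 : Integrable (fun x : C0 T => ev x (grid T N i) * ev x (grid T N (j + 1))
      - ev x (grid T N i) * ev x (grid T N j)) m :=
    (hint _ hi.le _ hj).sub (hint _ hi.le _ hj.le)
  rw [integral_sub i1 i2,
    integral_sub (hint _ hi _ hj) (hint _ hi _ hj.le),
    integral_sub (hint _ hi.le _ hj) (hint _ hi.le _ hj.le),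
    hval _ hi _ hj, hval _ hi _ hj.le, hval _ hi.le _ hj, hval _ hi.le _ hj.le]
  rcases lt_trichotomy i j with h | h | h
  · rw [min_eq_left (by omega), min_eq_left (by omega), min_eq_left (by omega),
      min_eq_left (by omega), if_neg h.ne]
    ring
  · subst h
    rw [if_pos rfl, min_self, min_eq_right (by omega), min_eq_left (by omega), min_self,
      ← grid_succ_sub T N i]
    ring
  · rw [min_eq_right (by omega), min_eq_right (by omega), min_eq_right (by omega),
      min_eq_right (by omega), if_neg h.ne']
    ring

/-- The increments are jointly Gaussian, centred and orthogonal with variance `T / N`, so only the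
variance of the linear combination has to be computed. -/
theorem IsWienerMeasure.map_sum_incr (hT : 0 < T) (hm : IsWienerMeasure m) (N : ℕ) (c : ℕ → ℝ) :
    m.map (fun x : C0 T => ∑ i ∈ Finset.range N, c i * incr N i x)
      = gaussianReal 0 (T / N * ∑ i ∈ Finset.range N, c i ^ 2).toNNReal := by
  have hp := hm.isProbabilityMeasure hT
  have hG := hm.gaussian.hasGaussianLaw_increments (n := N)
    (t := fun i => ⟨grid T N i, grid_mem hT (Nat.lt_succ_iff.1 i.2)⟩)
  let L : (Fin N → ℝ) →L[ℝ] ℝ := ∑ i : Fin N, c i • ContinuousLinearMap.proj i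
  have hS : HasGaussianLaw (fun x : C0 T => ∑ i ∈ Finset.range N, c i * incr N i x) m := by
    suffices e : (fun x : C0 T => ∑ i ∈ Finset.range N, c i * incr N i x) = L ∘ fun (x : C0 T) (i : Fin N) =>
        (x : C(Icc (0 : ℝ) T, ℝ)) ⟨grid T N i.succ, grid_mem hT (Nat.lt_succ_iff.1 i.succ.2)⟩
        - (x : C(Icc (0 : ℝ) T, ℝ))
          ⟨grid T N i.castSucc, grid_mem hT (Nat.lt_succ_iff.1 i.castSucc.2)⟩ by
      rw [e]; exact hG.map L
    funext x
    rw [Finset.sum_range]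
    simp only [L, Function.comp, _root_.sum_apply, _root_.smul_apply,
      ContinuousLinearMap.proj_apply, smul_eq_mul]
    refine Finset.sum_congr rfl fun i _ => ?_
    have h1 := grid_mem hT (Nat.lt_succ_iff.1 i.succ.2)
    have h2 := grid_mem hT (Nat.lt_succ_iff.1 i.castSucc.2)
    simp only [Fin.val_succ, Fin.val_castSucc] at h1 h2
    simp [incr, ev, h1, h2]
  have hint : ∀ i ∈ Finset.range N, Integrable (fun x : C0 T => c i * incr N i x) m := fun i hi =>
    ((hm.memLp_incr hT (Finset.mem_range.1 hi)).integrable (by norm_num)).const_mul _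
  have hmean : ∫ x : C0 T, ∑ i ∈ Finset.range N, c i * incr N i x ∂m = 0 := by
    rw [integral_finsetSum _ hint]
    refine Finset.sum_eq_zero fun i hi => ?_
    rw [integral_const_mul, hm.integral_incr hT (Finset.mem_range.1 hi), mul_zero]
  have hvar : Var[fun x : C0 T => ∑ i ∈ Finset.range N, c i * incr N i x; m]
      = T / N * ∑ i ∈ Finset.range N, c i ^ 2 := by
    rw [variance_of_integral_eq_zero hS.aemeasurable hmean]
    have e : ∀ x : C0 T, (∑ i ∈ Finset.range N, c i * incr N i x) ^ 2
        = ∑ i ∈ Finset.range N, ∑ j ∈ Finset.range N,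
          c i * c j * (incr N i x * incr N j x) := by
      intro x
      rw [sq, Finset.sum_mul_sum]
      exact Finset.sum_congr rfl fun i _ => Finset.sum_congr rfl fun j _ => by ring
    have hint2 : ∀ i ∈ Finset.range N, ∀ j ∈ Finset.range N,
        Integrable (fun x : C0 T => c i * c j * (incr N i x * incr N j x)) m := fun i hi j hj =>
      ((hm.memLp_incr hT (Finset.mem_range.1 hi)).integrable_mul
        (hm.memLp_incr hT (Finset.mem_range.1 hj))).const_mul _
    simp_rw [e]
    rw [integral_finsetSum _ fun i hi => integrable_finsetSum _ (hint2 i hi), Finset.mul_sum]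
    refine Finset.sum_congr rfl fun i hi => ?_
    rw [integral_finsetSum _ (hint2 i hi), Finset.sum_eq_single i]
    · rw [integral_const_mul, hm.integral_incr_mul_incr hT (Finset.mem_range.1 hi)
        (Finset.mem_range.1 hi), if_pos rfl]
      ring
    · intro j hj hji
      rw [integral_const_mul, hm.integral_incr_mul_incr hT (Finset.mem_range.1 hi)
        (Finset.mem_range.1 hj), if_neg hji.symm, mul_zero]
    · exact fun h => absurd hi h
  rw [hS.map_eq_gaussianReal, hmean, hvar]

theorem integral_exp_of_map_eq {Ω : Type*} [MeasurableSpace Ω] {P : Measure Ω} {X : Ω → ℝ}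
    (hX : AEMeasurable X P) {v : ℝ≥0} (h : P.map X = gaussianReal 0 v) :
    ∫ x, Complex.exp (Complex.I * (X x : ℂ)) ∂P = Complex.exp (-(v : ℂ) / 2) := by
  have h1 := charFun_gaussianReal (μ := 0) (v := v) 1
  rw [← h, charFun_apply_real, integral_map hX (by fun_prop)] at h1
  convert h1 using 1
  · refine integral_congr_ae (ae_of_all _ fun x => ?_)
    simp [mul_comm]
  · congr 1
    push_cast
    ring

theorem map_eq_gaussianReal_of_integral_exp {Ω : Type*} [MeasurableSpace Ω] {P : Measure Ω}
    [IsProbabilityMeasure P] {X : Ω → ℝ} (hX : AEMeasurable X P) (v : ℝ≥0)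
    (h : ∀ t : ℝ, ∫ x, Complex.exp (Complex.I * ((t * X x : ℝ) : ℂ)) ∂P
      = Complex.exp (-((v * t ^ 2 : ℝ) : ℂ) / 2)) :
    P.map X = gaussianReal 0 v := by
  have := Measure.isProbabilityMeasure_map hX
  refine Measure.ext_of_charFun (funext fun t => ?_)
  rw [charFun_gaussianReal, charFun_apply_real, integral_map hX (by fun_prop)]
  convert h t using 1
  · refine integral_congr_ae (ae_of_all _ fun x => ?_)
    simp [mul_comm]
  · congr 1
    push_cast
    ring

theorem integral_stepFn (hT : 0 < T) (χ : ℝ → ℝ) (N : ℕ) :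
    ∫ t, stepFn T χ N t ∂(leb T) = T / N * ∑ i ∈ Finset.range N, χ (grid T N i) := by
  unfold stepFn
  have hsub : ∀ i ∈ Finset.range N, Ioc (grid T N i) (grid T N (i + 1)) ⊆ Icc 0 T := by
    intro i hi t ht
    rw [Finset.mem_range] at hi
    exact ⟨(grid_mem hT hi.le).1.trans ht.1.le, ht.2.trans (grid_mem hT hi).2⟩
  rw [integral_finsetSum, Finset.mul_sum]
  · refine Finset.sum_congr rfl fun i hi => ?_
    rw [integral_indicator_const _ measurableSet_Ioc, measureReal_restrict_apply measurableSet_Ioc,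
      inter_eq_self_of_subset_left (hsub i hi), Measure.real, Real.volume_Ioc, grid_succ_sub,
      ENNReal.toReal_ofReal (by positivity), smul_eq_mul]
  · intro i _
    exact (integrable_const _).indicator measurableSet_Ioc

/-- The left side is the integral of the step function of `ψ²` with `ψ = ∑ a_j φ_j`. Dominated
convergence gives `∫ ψ²`, and orthonormality evaluates it. -/
theorem tendsto_sum_sq_grid (hT : 0 < T) (hφ : IsBVBasis T φ) (a : ℕ → ℝ) (n : ℕ) :
    Tendsto (fun N : ℕ => T / N * ∑ i ∈ Finset.range N,
      (∑ j ∈ Finset.range n, a j * φ j (grid T N i)) ^ 2) atTop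
      (𝓝 (∑ j ∈ Finset.range n, a j ^ 2)) := by
  have hφL : ∀ j, MemLp (φ j) 2 (leb T) := fun j => memLp_of_boundedVariationOn hT (hφ.bv j) 2
  let ψ : ℝ → ℝ := fun t => ∑ j ∈ Finset.range n, a j * φ j t
  have hlim : ∫ t, ψ t ^ 2 ∂(leb T) = ∑ j ∈ Finset.range n, a j ^ 2 := by
    have e : ∀ t, ψ t ^ 2 = ∑ i ∈ Finset.range n, ∑ j ∈ Finset.range n,
        a i * a j * (φ i t * φ j t) := by
      intro t
      rw [sq, Finset.sum_mul_sum]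
      exact Finset.sum_congr rfl fun i _ => Finset.sum_congr rfl fun j _ => by ring
    have hint : ∀ i j, Integrable (fun t => a i * a j * (φ i t * φ j t)) (leb T) := fun i j =>
      ((hφL i).integrable_mul (hφL j)).const_mul _
    simp_rw [e]
    rw [integral_finsetSum _ fun i _ => integrable_finsetSum _ fun j _ => hint i j]
    refine Finset.sum_congr rfl fun i hi => ?_
    rw [integral_finsetSum _ fun j _ => hint i j, Finset.sum_eq_single i]
    · rw [integral_const_mul, hφ.orthonormal, if_pos rfl]; ring
    · intro j _ hji
      rw [integral_const_mul, hφ.orthonormal, if_neg hji.symm, mul_zero]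
    · exact fun h => absurd hi h
  have hBex : ∀ j, ∃ B, ∀ t ∈ Icc (0 : ℝ) T, |φ j t| ≤ B := fun j =>
    ⟨_, fun t ht => abs_le_of_boundedVariationOn hT (hφ.bv j) ht⟩
  choose B hB using hBex
  have hψB : ∀ t ∈ Icc (0 : ℝ) T, |ψ t ^ 2| ≤ (∑ j ∈ Finset.range n, |a j| * B j) ^ 2 := by
    intro t ht
    rw [abs_pow]
    gcongr
    refine (Finset.abs_sum_le_sum_abs _ _).trans (Finset.sum_le_sum fun j _ => ?_)
    rw [abs_mul]
    gcongr
    exact hB j t ht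
  have hstep : ∀ᵐ t ∂(leb T), Tendsto (fun N => stepFn T (fun t => ψ t ^ 2) N t) atTop
      (𝓝 (ψ t ^ 2)) := by
    filter_upwards [ae_all_iff.2 fun j => ae_tendsto_stepFn hT (hφ.bv j), ae_leb_mem T] with t ht htT
    have h1 : Tendsto (fun N => (∑ j ∈ Finset.range n, a j * stepFn T (φ j) N t) ^ 2) atTop
        (𝓝 (ψ t ^ 2)) :=
      (tendsto_finsetSum _ fun j _ => (ht j).const_mul (a j)).pow 2
    refine h1.congr' ?_
    filter_upwards [eventually_gt_atTop 0] with N hN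
    obtain ⟨i, -, -, h⟩ := exists_stepFn_eq hT hN htT
    simp only [h, ψ]
  have := tendsto_integral_of_dominated_convergence (μ := leb T)
    (fun _ => (∑ j ∈ Finset.range n, |a j| * B j) ^ 2)
    (fun N => (measurable_stepFn T (fun t => ψ t ^ 2) N).aestronglyMeasurable)
    (integrable_const _) (fun N => by
      filter_upwards [ae_leb_mem T] with t ht using abs_stepFn_le hT hψB N ht) hstep
  rw [hlim] at this
  refine this.congr fun N => ?_
  rw [integral_stepFn hT]

/-- The integrals `∫ φ_j dx` are independent standard Gaussian variables. -/
theorem integral_exp_sum_rsInt (hT : 0 < T) (hm : IsWienerMeasure m) (hφ : IsBVBasis T φ)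
    (a : ℕ → ℝ) (n : ℕ) :
    ∫ x : C0 T, Complex.exp (Complex.I * ((∑ j ∈ Finset.range n, a j * rsInt (φ j) x : ℝ) : ℂ)) ∂m
      = Complex.exp (-((∑ j ∈ Finset.range n, a j ^ 2 : ℝ) : ℂ) / 2) := by
  have hp := hm.isProbabilityMeasure hT
  have hmeas : ∀ N, Measurable fun x : C0 T => ∑ j ∈ Finset.range n, a j * rsSum (φ j) x N :=
    fun N => Finset.measurable_sum _ fun j _ => (measurable_rsSum (φ j) N).const_mul _
  have h1 : ∀ N : ℕ, ∫ x : C0 T, Complex.exp (Complex.I *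
      ((∑ j ∈ Finset.range n, a j * rsSum (φ j) x N : ℝ) : ℂ)) ∂m
      = Complex.exp (-((T / N * ∑ i ∈ Finset.range N,
      (∑ j ∈ Finset.range n, a j * φ j (grid T N i)) ^ 2 : ℝ) : ℂ) / 2) := by
    intro N
    have e : (fun x : C0 T => ∑ j ∈ Finset.range n, a j * rsSum (φ j) x N)
        = fun x => ∑ i ∈ Finset.range N, (∑ j ∈ Finset.range n, a j * φ j (grid T N i))
          * incr N i x := by
      funext x
      simp only [rsSum, incr, Finset.mul_sum, Finset.sum_mul]
      rw [Finset.sum_comm]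
      exact Finset.sum_congr rfl fun i _ => Finset.sum_congr rfl fun j _ => by ring
    have := integral_exp_of_map_eq (hmeas N).aemeasurable (by rw [e]; exact hm.map_sum_incr hT N _)
    rw [this]
    congr 3
    rw [Complex.ofReal_inj]
    exact Real.coe_toNNReal _ (by positivity)
  have h2 : Tendsto (fun N => ∫ x : C0 T, Complex.exp (Complex.I *
      ((∑ j ∈ Finset.range n, a j * rsSum (φ j) x N : ℝ) : ℂ)) ∂m) atTop
      (𝓝 (∫ x : C0 T, Complex.exp (Complex.I *
        ((∑ j ∈ Finset.range n, a j * rsInt (φ j) x : ℝ) : ℂ)) ∂m)) := by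
    refine tendsto_integral_of_dominated_convergence (fun _ => 1)
      (fun N => ?_) (integrable_const _) (fun N => ae_of_all _ fun x => ?_) (ae_of_all _ fun x => ?_)
    · exact (Complex.measurable_exp.comp
        ((Complex.measurable_ofReal.comp (hmeas N)).const_mul _)).aestronglyMeasurable
    · rw [mul_comm, Complex.norm_exp_ofReal_mul_I]
    · have hc : Continuous fun r : ℝ => Complex.exp (Complex.I * (r : ℂ)) := by fun_prop
      exact (hc.tendsto _).comp (tendsto_finsetSum _ fun j _ =>
        (tendsto_rsSum hT (hφ.bv j) x).const_mul (a j))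
  refine tendsto_nhds_unique h2 ?_
  simp_rw [h1]
  have hc : Continuous fun r : ℝ => Complex.exp (-(r : ℂ) / 2) := by fun_prop
  exact (hc.tendsto _).comp (tendsto_sum_sq_grid hT hφ a n)

/-! ### Fourth moments of Gaussian variables -/

variable {T : ℝ} {m : Measure (C0 T)} {φ : ℕ → ℝ → ℝ}

/-- The fourth moment of the standard Gaussian law. -/
def gaussFourth : ℝ≥0∞ := ∫⁻ y, ‖y‖ₑ ^ 4 ∂(gaussianReal 0 1)

theorem gaussFourth_ne_top : gaussFourth ≠ ⊤ := by
  have h := (memLp_id_gaussianReal (μ := 0) (v := 1) 4).eLpNorm_lt_top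
  rw [eLpNorm_lt_top_iff_lintegral_rpow_enorm_lt_top (by norm_num) (by norm_num)] at h
  refine ne_of_lt ?_
  unfold gaussFourth
  convert h using 3 with y
  norm_num

/-- Scaling from the standard Gaussian law by `√v`. The square of the variance on the right is what
the fourth moment criterion for convergence needs. -/
theorem lintegral_fourth_of_map_eq {Ω : Type*} [MeasurableSpace Ω] {P : Measure Ω} {X : Ω → ℝ}
    (hX : AEMeasurable X P) {v : ℝ≥0} (h : P.map X = gaussianReal 0 v) :
    ∫⁻ x, ‖X x‖ₑ ^ 4 ∂P = gaussFourth * (v : ℝ≥0∞) ^ 2 := by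
  have hm4 : Measurable fun y : ℝ => ‖y‖ₑ ^ 4 := by fun_prop
  have h1 : gaussianReal 0 v = (gaussianReal 0 1).map (fun y => Real.sqrt v * y) := by
    rw [gaussianReal_map_const_mul, mul_zero]
    congr 1
    ext
    simp
  rw [← lintegral_map' (f := fun y : ℝ => ‖y‖ₑ ^ 4) (g := X) hm4.aemeasurable hX, h, h1,
    lintegral_map hm4 (by fun_prop), gaussFourth, mul_comm, ← lintegral_const_mul _ hm4]
  refine lintegral_congr fun y => ?_
  rw [enorm_mul, mul_pow]
  congr 1
  rw [Real.enorm_eq_ofReal (Real.sqrt_nonneg _), ← ENNReal.ofReal_pow (Real.sqrt_nonneg _),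
    show Real.sqrt v ^ 4 = (v : ℝ) ^ 2 by
      rw [show (4 : ℕ) = 2 * 2 by norm_num, pow_mul, Real.sq_sqrt v.coe_nonneg],
    ENNReal.ofReal_pow v.coe_nonneg, ENNReal.ofReal_coe_nnreal]

/-! ### The orthonormal basis of `L₂[0,T]` -/

/-- The `j`-th element of the orthonormal sequence as an element of `L₂[0,T]`. -/
def basisVec (hT : 0 < T) (hφ : IsBVBasis T φ) (j : ℕ) : L2 T :=
  (memLp_of_boundedVariationOn hT (hφ.bv j) 2).toLp

theorem inner_basisVec (hT : 0 < T) (hφ : IsBVBasis T φ) (j : ℕ) (u : L2 T) :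
    ⟪basisVec hT hφ j, u⟫_ℝ = ∫ t, u t * φ j t ∂(leb T) := by
  rw [L2.inner_def]
  refine integral_congr_ae ?_
  filter_upwards [(memLp_of_boundedVariationOn hT (hφ.bv j) 2).coeFn_toLp] with t ht
  simp [basisVec, ht]

theorem orthonormal_basisVec (hT : 0 < T) (hφ : IsBVBasis T φ) :
    Orthonormal ℝ (basisVec hT hφ) := by
  classical
  rw [orthonormal_iff_ite]
  intro i j
  rw [inner_basisVec, show (if i = j then (1 : ℝ) else 0) = if j = i then 1 else 0 by
    simp only [eq_comm], ← hφ.orthonormal j i]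
  refine integral_congr_ae ?_
  filter_upwards [(memLp_of_boundedVariationOn hT (hφ.bv j) 2).coeFn_toLp] with t ht
  rw [basisVec, ht]

/-- The orthonormal sequence as a Hilbert basis of `L₂[0,T]`. -/
def hilbertBasis (hT : 0 < T) (hφ : IsBVBasis T φ) : HilbertBasis ℕ ℝ (L2 T) :=
  HilbertBasis.mkOfOrthogonalEqBot (orthonormal_basisVec hT hφ) (by
    rw [Submodule.eq_bot_iff]
    intro u hu
    rw [Lp.eq_zero_iff_ae_eq_zero]
    refine hφ.complete _ (Lp.memLp u) fun j => ?_
    rw [← inner_basisVec hT hφ]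
    exact (Submodule.mem_orthogonal _ _).1 hu _ (Submodule.subset_span ⟨j, rfl⟩))

theorem hilbertBasis_apply (hT : 0 < T) (hφ : IsBVBasis T φ) (j : ℕ) :
    hilbertBasis hT hφ j = basisVec hT hφ j := by
  simp [hilbertBasis]

theorem hasSum_sq_inner (hT : 0 < T) (hφ : IsBVBasis T φ) (u : L2 T) :
    HasSum (fun j => ⟪basisVec hT hφ j, u⟫_ℝ ^ 2) (‖u‖ ^ 2) := by
  have h := (hilbertBasis hT hφ).hasSum_inner_mul_inner u u
  rw [real_inner_self_eq_norm_sq] at h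
  have e : (fun j => ⟪basisVec hT hφ j, u⟫_ℝ ^ 2) =
      fun j => ⟪u, hilbertBasis hT hφ j⟫_ℝ * ⟪hilbertBasis hT hφ j, u⟫_ℝ := by
    funext j
    rw [hilbertBasis_apply, real_inner_comm, sq]
  rw [e]
  exact h

theorem tendsto_sum_inner_smul (hT : 0 < T) (hφ : IsBVBasis T φ) (u : L2 T) :
    Tendsto (fun n => ∑ j ∈ Finset.range n, ⟪basisVec hT hφ j, u⟫_ℝ • basisVec hT hφ j) atTop
      (𝓝 u) := by
  have h := ((hilbertBasis hT hφ).hasSum_repr u).tendsto_sum_nat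
  simpa only [HilbertBasis.repr_apply_apply, hilbertBasis_apply] using h

theorem pwzSum_eq (hT : 0 < T) (hφ : IsBVBasis T φ) (u : L2 T) (x : C0 T) (n : ℕ) :
    pwzSum φ u x n = ∑ j ∈ Finset.range n, ⟪basisVec hT hφ j, u⟫_ℝ * rsInt (φ j) x := by
  simp only [pwzSum, inner_basisVec]

theorem pwzSum_congr {u v : ℝ → ℝ} (h : u =ᵐ[leb T] v) (x : C0 T) : pwzSum φ u x = pwzSum φ v x := by
  funext n
  unfold pwzSum
  refine Finset.sum_congr rfl fun j _ => ?_
  congr 1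
  exact integral_congr_ae (by filter_upwards [h] with t ht; rw [ht])

theorem HasPWZ.congr {u v : ℝ → ℝ} (h : u =ᵐ[leb T] v) {x : C0 T} {c : ℝ} (hu : HasPWZ φ u x c) :
    HasPWZ φ v x c := by
  unfold HasPWZ
  rwa [← pwzSum_congr h]

theorem hasPWZ_add (hT : 0 < T) (hφ : IsBVBasis T φ) {u v : L2 T} {x : C0 T} {c d : ℝ}
    (hu : HasPWZ φ u x c) (hv : HasPWZ φ v x d) : HasPWZ φ (u + v : L2 T) x (c + d) := by
  refine (Tendsto.add hu hv).congr fun n => ?_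
  simp only [pwzSum_eq hT hφ, inner_add_right, ← Finset.sum_add_distrib]
  exact Finset.sum_congr rfl fun j _ => by ring

theorem hasPWZ_smul (hT : 0 < T) (hφ : IsBVBasis T φ) (r : ℝ) {u : L2 T} {x : C0 T} {c : ℝ}
    (hu : HasPWZ φ u x c) : HasPWZ φ (r • u : L2 T) x (r * c) := by
  refine (Tendsto.const_mul r hu).congr fun n => ?_
  simp only [pwzSum_eq hT hφ, inner_smul_right, Finset.mul_sum]
  exact Finset.sum_congr rfl fun j _ => by ring

theorem hasPWZ_sub (hT : 0 < T) (hφ : IsBVBasis T φ) {u v : L2 T} {x : C0 T} {c d : ℝ}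
    (hu : HasPWZ φ u x c) (hv : HasPWZ φ v x d) : HasPWZ φ (u - v : L2 T) x (c - d) := by
  have := hasPWZ_add hT hφ hu (hasPWZ_smul hT hφ (-1) hv)
  simpa [sub_eq_add_neg] using this

theorem hasPWZ_path_add (hT : 0 < T) (hφ : IsBVBasis T φ) {u : ℝ → ℝ} {x y : C0 T} {c d : ℝ}
    (hx : HasPWZ φ u x c) (hy : HasPWZ φ u y d) : HasPWZ φ u (x + y) (c + d) := by
  refine (Tendsto.add hx hy).congr fun n => ?_
  simp only [pwzSum, rsInt_add hT (hφ.bv _), ← Finset.sum_add_distrib]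
  exact Finset.sum_congr rfl fun j _ => by ring

theorem hasPWZ_path_smul (hT : 0 < T) (hφ : IsBVBasis T φ) (r : ℝ) {u : ℝ → ℝ} {x : C0 T} {c : ℝ}
    (hx : HasPWZ φ u x c) : HasPWZ φ u (r • x) (r * c) := by
  refine (Tendsto.const_mul r hx).congr fun n => ?_
  simp only [pwzSum, rsInt_smul hT (hφ.bv _), Finset.mul_sum]
  exact Finset.sum_congr rfl fun j _ => by ring

/-- An everywhere defined version of `⟨u,x⟩`, jointly measurable in `(u,x)`. -/
def pw (φ : ℕ → ℝ → ℝ) (u : L2 T) (x : C0 T) : ℝ := limsup (fun n => pwzSum φ u x n) atTop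

theorem HasPWZ.pw_eq {u : L2 T} {x : C0 T} {c : ℝ} (h : HasPWZ φ u x c) : pw φ u x = c :=
  Tendsto.limsup_eq h

theorem HasPWZ.pwz_eq {u : ℝ → ℝ} {x : C0 T} {c : ℝ} (h : HasPWZ φ u x c) : pwz φ u x = c :=
  Tendsto.limUnder_eq h

theorem measurable_pwzSum_prod (hT : 0 < T) (hφ : IsBVBasis T φ) (n : ℕ) :
    Measurable fun z : L2 T × C0 T => pwzSum φ z.1 z.2 n := by
  simp only [pwzSum_eq hT hφ]
  refine Finset.measurable_sum _ fun j _ => ?_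
  have h1 : Measurable fun u : L2 T => ⟪basisVec hT hφ j, u⟫_ℝ :=
    (innerSL ℝ (basisVec hT hφ j)).continuous.measurable
  exact (h1.comp measurable_fst).mul ((measurable_rsInt hT (hφ.bv j)).comp measurable_snd)

theorem measurable_pw (hT : 0 < T) (hφ : IsBVBasis T φ) :
    Measurable fun z : L2 T × C0 T => pw φ z.1 z.2 :=
  Measurable.limsup (measurable_pwzSum_prod hT hφ)

theorem measurable_pw_right (hT : 0 < T) (hφ : IsBVBasis T φ) (u : L2 T) :
    Measurable fun x : C0 T => pw φ u x :=
  Measurable.of_uncurry_left (f := fun (u : L2 T) (x : C0 T) => pw φ u x) (measurable_pw hT hφ)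

theorem measurable_pw_left (hT : 0 < T) (hφ : IsBVBasis T φ) (x : C0 T) :
    Measurable fun u : L2 T => pw φ u x :=
  Measurable.of_uncurry_right (f := fun (u : L2 T) (x : C0 T) => pw φ u x) (measurable_pw hT hφ)

theorem measurable_pwzSum (hT : 0 < T) (hφ : IsBVBasis T φ) (u : L2 T) (n : ℕ) :
    Measurable fun x : C0 T => pwzSum φ u x n :=
  Measurable.of_uncurry_left (f := fun (u : L2 T) (x : C0 T) => pwzSum φ u x n)
    (measurable_pwzSum_prod hT hφ n)

/-! ### Laws of the Paley-Wiener-Zygmund integrals -/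

theorem map_sum_mul_rsInt (hT : 0 < T) (hm : IsWienerMeasure m) (hφ : IsBVBasis T φ)
    (a : ℕ → ℝ) (n : ℕ) :
    m.map (fun x => ∑ j ∈ Finset.range n, a j * rsInt (φ j) x)
      = gaussianReal 0 (∑ j ∈ Finset.range n, a j ^ 2).toNNReal := by
  have := hm.isProbabilityMeasure hT
  refine map_eq_gaussianReal_of_integral_exp (Finset.measurable_sum _ fun j _ =>
    (measurable_rsInt hT (hφ.bv j)).const_mul _).aemeasurable _ fun t => ?_
  have h := integral_exp_sum_rsInt hT hm hφ (fun j => t * a j) n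
  simp only [mul_assoc] at h
  simp only [Finset.mul_sum]
  rw [h]
  congr 3
  rw [Complex.ofReal_inj, Real.coe_toNNReal _ (Finset.sum_nonneg fun _ _ => sq_nonneg _),
    Finset.sum_mul]
  exact Finset.sum_congr rfl fun j _ => by ring

theorem lintegral_fourth_pwzSum_sub (hT : 0 < T) (hm : IsWienerMeasure m) (hφ : IsBVBasis T φ)
    (u : L2 T) (k n : ℕ) (hkn : k ≤ n) :
    ∫⁻ x, ‖pwzSum φ u x n - pwzSum φ u x k‖ₑ ^ 4 ∂m ≤ gaussFourth * ENNReal.ofReal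
      (∑ j ∈ Finset.range n, ⟪basisVec hT hφ j, u⟫_ℝ ^ 2
        - ∑ j ∈ Finset.range k, ⟪basisVec hT hφ j, u⟫_ℝ ^ 2) ^ 2 := by
  obtain ⟨i, rfl⟩ := Nat.exists_eq_add_of_le hkn
  let a : ℕ → ℝ := fun j => if j < k then 0 else ⟪basisVec hT hφ j, u⟫_ℝ
  -- Used twice: for the linear sums, giving the difference of partial sums, and for the squares,
  -- giving its variance.
  have ha : ∀ g : ℝ → ℕ → ℝ, (∀ j, g 0 j = 0) → ∑ j ∈ Finset.range (k + i), g (a j) j =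
      ∑ j ∈ Finset.range (k + i), g ⟪basisVec hT hφ j, u⟫_ℝ j
        - ∑ j ∈ Finset.range k, g ⟪basisVec hT hφ j, u⟫_ℝ j := by
    intro g hg
    rw [Finset.sum_range_add, Finset.sum_range_add, add_sub_cancel_left,
      Finset.sum_eq_zero, zero_add]
    · exact Finset.sum_congr rfl fun j _ => by simp [a]
    · intro j hj
      simp [a, Finset.mem_range.1 hj, hg]
  have h1 : ∀ x : C0 T, pwzSum φ u x (k + i) - pwzSum φ u x k
      = ∑ j ∈ Finset.range (k + i), a j * rsInt (φ j) x := by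
    intro x
    rw [pwzSum_eq hT hφ, pwzSum_eq hT hφ, ha (fun c j => c * rsInt (φ j) x) (by simp)]
  simp only [h1]
  rw [lintegral_fourth_of_map_eq (Finset.measurable_sum _ fun j _ =>
    (measurable_rsInt hT (hφ.bv j)).const_mul _).aemeasurable (map_sum_mul_rsInt hT hm hφ a _),
    ← ha (fun c j => c ^ 2) (by simp)]
  rfl

/-- The fourth moment criterion with clock `∑_{j<n} (u, φ_j)²`, which is bounded by Bessel's
inequality. -/
theorem ae_hasPWZ (hT : 0 < T) (hm : IsWienerMeasure m) (hφ : IsBVBasis T φ) (u : L2 T) :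
    ∀ᵐ x ∂m, HasPWZ φ u x (pw φ u x) := by
  have hs := hasSum_sq_inner hT hφ u
  have := ae_exists_tendsto_of_fourth_moment (P := m) (Y := fun n x => pwzSum φ u x n)
    (t := fun n => ∑ j ∈ Finset.range n, ⟪basisVec hT hφ j, u⟫_ℝ ^ 2)
    (measurable_pwzSum hT hφ u)
    (fun a b hab => Finset.sum_le_sum_of_subset_of_nonneg (Finset.range_mono hab)
      fun _ _ _ => sq_nonneg _)
    ⟨‖u‖ ^ 2, by
      rintro _ ⟨n, rfl⟩
      exact sum_le_hasSum _ (fun _ _ => sq_nonneg _) hs⟩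
    gaussFourth_ne_top (lintegral_fourth_pwzSum_sub hT hm hφ u)
  filter_upwards [this] with x ⟨c, hc⟩
  have hc' : HasPWZ φ u x c := hc
  rwa [hc'.pw_eq]

/-- Pass to the limit in the characteristic functions of the partial sums; Parseval turns the sum of
squares into `‖u‖²`. -/
theorem integral_exp_pw (hT : 0 < T) (hm : IsWienerMeasure m) (hφ : IsBVBasis T φ) (u : L2 T) :
    ∫ x, Complex.exp (Complex.I * (pw φ u x : ℂ)) ∂m = Complex.exp (-((‖u‖ ^ 2 : ℝ) : ℂ) / 2) := by
  have hp := hm.isProbabilityMeasure hT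
  have h2 : Tendsto (fun n => ∫ x, Complex.exp (Complex.I * (pwzSum φ u x n : ℂ)) ∂m) atTop
      (𝓝 (∫ x, Complex.exp (Complex.I * (pw φ u x : ℂ)) ∂m)) := by
    refine tendsto_integral_of_dominated_convergence (fun _ => 1)
      (fun n => ?_) (integrable_const _) (fun n => ae_of_all _ fun x => ?_) ?_
    · exact (Complex.measurable_exp.comp ((Complex.measurable_ofReal.comp
        (measurable_pwzSum hT hφ u n)).const_mul _)).aestronglyMeasurable
    · rw [mul_comm, Complex.norm_exp_ofReal_mul_I]
    · filter_upwards [ae_hasPWZ hT hm hφ u] with x hx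
      have hc : Continuous fun r : ℝ => Complex.exp (Complex.I * (r : ℂ)) := by fun_prop
      exact (hc.tendsto _).comp hx
  refine tendsto_nhds_unique h2 ?_
  have e : ∀ n, ∫ x, Complex.exp (Complex.I * (pwzSum φ u x n : ℂ)) ∂m = Complex.exp
      (-((∑ j ∈ Finset.range n, ⟪basisVec hT hφ j, u⟫_ℝ ^ 2 : ℝ) : ℂ) / 2) := by
    intro n
    simp only [pwzSum_eq hT hφ]
    exact integral_exp_sum_rsInt hT hm hφ _ n
  simp_rw [e]
  have hc : Continuous fun r : ℝ => Complex.exp (-(r : ℂ) / 2) := by fun_prop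
  exact (hc.tendsto _).comp (hasSum_sq_inner hT hφ u).tendsto_sum_nat

theorem ae_pw_smul (hT : 0 < T) (hm : IsWienerMeasure m) (hφ : IsBVBasis T φ) (r : ℝ) (u : L2 T) :
    ∀ᵐ x ∂m, pw φ (r • u) x = r * pw φ u x := by
  filter_upwards [ae_hasPWZ hT hm hφ u] with x hx
  exact (hasPWZ_smul hT hφ r hx).pw_eq

theorem ae_pw_sub (hT : 0 < T) (hm : IsWienerMeasure m) (hφ : IsBVBasis T φ) (u v : L2 T) :
    ∀ᵐ x ∂m, pw φ (u - v) x = pw φ u x - pw φ v x := by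
  filter_upwards [ae_hasPWZ hT hm hφ u, ae_hasPWZ hT hm hφ v] with x hx hy
  exact (hasPWZ_sub hT hφ hx hy).pw_eq

theorem integral_exp_mul_pw (hT : 0 < T) (hm : IsWienerMeasure m) (hφ : IsBVBasis T φ) (r : ℝ)
    (u : L2 T) : ∫ x, Complex.exp (Complex.I * ((r * pw φ u x : ℝ) : ℂ)) ∂m
      = Complex.exp (-((‖u‖ ^ 2 * r ^ 2 : ℝ) : ℂ) / 2) := by
  have h := integral_exp_pw hT hm hφ (r • u)
  rw [norm_smul, mul_pow, Real.norm_eq_abs, sq_abs, mul_comm] at h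
  rw [← h]
  refine integral_congr_ae ?_
  filter_upwards [ae_pw_smul hT hm hφ r u] with x hx
  rw [hx]

theorem map_pw (hT : 0 < T) (hm : IsWienerMeasure m) (hφ : IsBVBasis T φ) (u : L2 T) :
    m.map (pw φ u) = gaussianReal 0 (‖u‖₊ ^ 2) := by
  have := hm.isProbabilityMeasure hT
  exact map_eq_gaussianReal_of_integral_exp (measurable_pw_right hT hφ u).aemeasurable _ fun r => by
    rw [integral_exp_mul_pw hT hm hφ]
    simp

theorem lintegral_fourth_pw_sub (hT : 0 < T) (hm : IsWienerMeasure m) (hφ : IsBVBasis T φ)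
    (u v : L2 T) : ∫⁻ x, ‖pw φ u x - pw φ v x‖ₑ ^ 4 ∂m = gaussFourth * ‖u - v‖ₑ ^ 4 := by
  have h := lintegral_fourth_of_map_eq (measurable_pw_right hT hφ (u - v)).aemeasurable
    (map_pw hT hm hφ (u - v))
  have e : ((‖u - v‖₊ ^ 2 : ℝ≥0) : ℝ≥0∞) ^ 2 = ‖u - v‖ₑ ^ 4 := by
    rw [ENNReal.coe_pow, ← pow_mul]; rfl
  rw [e] at h
  rw [← h]
  refine lintegral_congr_ae ?_
  filter_upwards [ae_pw_sub hT hm hφ u v] with x hx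
  rw [hx]

/-- If `u n → u` in `L₂` and `⟨u n, x⟩` converges a.s. to `X`, then `X = ⟨u, x⟩` a.s. -/
theorem ae_eq_pw_of_tendsto (hT : 0 < T) (hm : IsWienerMeasure m) (hφ : IsBVBasis T φ)
    {u : ℕ → L2 T} {v : L2 T} (hu : Tendsto u atTop (𝓝 v)) {X : C0 T → ℝ}
    (hX : ∀ᵐ x ∂m, Tendsto (fun n => pw φ (u n) x) atTop (𝓝 (X x))) :
    ∀ᵐ x ∂m, X x = pw φ v x := by
  have h0 : Tendsto (fun n => ∫⁻ x, ‖pw φ (u n) x - pw φ v x‖ₑ ^ 4 ∂m) atTop (𝓝 0) := by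
    simp_rw [lintegral_fourth_pw_sub hT hm hφ]
    have h1 : Tendsto (fun n => ‖u n - v‖ₑ) atTop (𝓝 0) := by
      have := (continuous_enorm.tendsto _).comp (hu.sub_const v)
      simpa [Function.comp_def] using this
    have h2 := ENNReal.Tendsto.const_mul (a := gaussFourth) (((ENNReal.continuous_pow 4).tendsto _).comp h1)
      (Or.inr gaussFourth_ne_top)
    simpa [Function.comp_def] using h2
  have hmeas : ∀ n, Measurable fun x => ‖pw φ (u n) x - pw φ v x‖ₑ ^ 4 := fun n =>
    ((measurable_pw_right hT hφ _).sub (measurable_pw_right hT hφ _)).enorm.pow_const 4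
  -- Fatou's lemma is applied to the approximating integrands, since `X` is not assumed measurable.
  have h3 : ∫⁻ x, liminf (fun n => ‖pw φ (u n) x - pw φ v x‖ₑ ^ 4) atTop ∂m = 0 := by
    refine le_antisymm ?_ zero_le
    rw [← h0.liminf_eq]
    exact lintegral_liminf_le hmeas
  rw [lintegral_eq_zero_iff (Measurable.liminf hmeas)] at h3
  filter_upwards [h3, hX] with x h3 hx
  have h4 : Tendsto (fun n => pw φ (u n) x - pw φ v x) atTop (𝓝 (X x - pw φ v x)) :=
    hx.sub_const _
  have h5 : Tendsto (fun n => ‖pw φ (u n) x - pw φ v x‖ₑ ^ 4) atTop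
      (𝓝 (‖X x - pw φ v x‖ₑ ^ 4)) :=
    ((ENNReal.continuous_pow 4).tendsto _).comp ((continuous_enorm.tendsto _).comp h4)
  have h6 : ‖X x - pw φ v x‖ₑ ^ 4 = 0 := h5.liminf_eq.symm.trans h3
  simpa [sub_eq_zero] using h6

variable {T : ℝ} {m : Measure (C0 T)} {φ : ℕ → ℝ → ℝ} {h : ℝ → ℝ}

/-! ### Multiplication operators and indicator functions in `L₂[0,T]` -/

/-- Multiplication by `h ∈ L_∞[0,T]` as an operator on `L₂[0,T]`. -/
def mulOp (hh : MemLp h ⊤ (leb T)) : L2 T →L[ℝ] L2 T :=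
  (ContinuousLinearMap.mul ℝ ℝ).holderL (leb T) ⊤ 2 2 hh.toLp

theorem coeFn_mulOp (hh : MemLp h ⊤ (leb T)) (u : L2 T) :
    mulOp hh u =ᵐ[leb T] fun t => h t * u t := by
  have h1 : mulOp hh u = (ContinuousLinearMap.mul ℝ ℝ).holder 2 (hh.toLp) u := rfl
  rw [h1]
  filter_upwards [(ContinuousLinearMap.mul ℝ ℝ).coeFn_holder (r := 2) hh.toLp u, hh.coeFn_toLp]
    with t h2 h3
  rw [h2, h3]
  rfl

/-- The indicator function of `[0,t]` as an element of `L₂[0,T]`. -/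
def ind (T t : ℝ) : L2 T := indicatorConstLp 2 (measurableSet_Icc (a := (0 : ℝ)) (b := t))
  (measure_ne_top _ _) 1

theorem coeFn_ind (T t : ℝ) : ind T t =ᵐ[leb T] (Icc (0 : ℝ) t).indicator fun _ => 1 :=
  indicatorConstLp_coeFn

theorem coeFn_mulOp_ind (hh : MemLp h ⊤ (leb T)) (t : ℝ) :
    mulOp hh (ind T t) =ᵐ[leb T] (Icc (0 : ℝ) t).indicator h := by
  filter_upwards [coeFn_mulOp hh (ind T t), coeFn_ind T t] with r h1 h2
  rw [h1, h2]
  by_cases hr : r ∈ Icc (0 : ℝ) t <;> simp [hr]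

theorem norm_sq_eq_integral (u : L2 T) : ‖u‖ ^ 2 = ∫ t, u t * u t ∂(leb T) := by
  rw [← real_inner_self_eq_norm_sq, L2.inner_def]
  rfl

theorem norm_sq_ind_sub {s t : ℝ} (hs : 0 ≤ s) (hst : s ≤ t) (ht : t ≤ T) :
    ‖ind T t - ind T s‖ ^ 2 = t - s := by
  rw [norm_sq_eq_integral]
  have e : ∀ᵐ r ∂(leb T), (ind T t - ind T s : L2 T) r * (ind T t - ind T s : L2 T) r
      = (Ioc s t).indicator (fun _ => (1 : ℝ)) r := by
    filter_upwards [Lp.coeFn_sub (ind T t) (ind T s), coeFn_ind T t, coeFn_ind T s, ae_leb_mem T]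
      with r h1 h2 h3 h4
    rw [h1, Pi.sub_apply, h2, h3]
    by_cases a : r ≤ t <;> by_cases b : r ≤ s
    · simp [indicator, a, b, h4.1.le]
    · simp [indicator, a, b, h4.1.le, not_le.1 b]
    · exact absurd (b.trans hst) a
    · simp [indicator, a, b]
  rw [integral_congr_ae e, integral_indicator_const _ measurableSet_Ioc,
    measureReal_restrict_apply measurableSet_Ioc, inter_eq_self_of_subset_left, Measure.real,
    Real.volume_Ioc, ENNReal.toReal_ofReal (sub_nonneg.2 hst), smul_eq_mul, mul_one]
  exact fun r hr => ⟨hs.trans hr.1.le, hr.2.trans ht⟩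

theorem norm_sq_ind_sub_abs {s t : ℝ} (hs : s ∈ Icc (0 : ℝ) T) (ht : t ∈ Icc (0 : ℝ) T) :
    ‖ind T t - ind T s‖ ^ 2 = |t - s| := by
  rcases le_total s t with hst | hst
  · rw [norm_sq_ind_sub hs.1 hst ht.2, abs_of_nonneg (sub_nonneg.2 hst)]
  · rw [norm_sub_rev, norm_sq_ind_sub ht.1 hst hs.2, abs_sub_comm, abs_of_nonneg (sub_nonneg.2 hst)]

theorem ind_zero (T : ℝ) : ind T 0 = 0 := by
  rw [Lp.eq_zero_iff_ae_eq_zero]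
  filter_upwards [coeFn_ind T 0, ae_leb_mem T] with r h1 h2
  rw [h1]
  rw [indicator_of_notMem fun h3 => absurd h3.2 (not_le.2 h2.1)]
  rfl

theorem enorm_mulOp_sub_pow_four (A : L2 T →L[ℝ] L2 T) (u v : L2 T) {τ : ℝ} (hτ : ‖u - v‖ ^ 2 = τ) :
    ‖A u - A v‖ₑ ^ 4 ≤ ‖A‖ₑ ^ 4 * ENNReal.ofReal τ ^ 2 := by
  rw [← map_sub]
  have h1 : ‖A (u - v)‖ₑ ≤ ‖A‖ₑ * ‖u - v‖ₑ := A.le_opENorm _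
  calc ‖A (u - v)‖ₑ ^ 4 ≤ (‖A‖ₑ * ‖u - v‖ₑ) ^ 4 := by gcongr
    _ = ‖A‖ₑ ^ 4 * ENNReal.ofReal τ ^ 2 := by
      rw [mul_pow, ← hτ, ENNReal.ofReal_pow (norm_nonneg _), ofReal_norm, ← pow_mul]

/-! ### Existence of the Gaussian processes -/

/-- The largest point `≤ t` of the dyadic partition of order `N`. -/
def dyad (T : ℝ) (N : ℕ) (t : ℝ) : ℝ := grid T (2 ^ N) ⌊2 ^ N * t / T⌋₊

theorem dyad_floor_le (hT : 0 < T) {t : ℝ} (ht : t ∈ Icc (0 : ℝ) T) (N : ℕ) :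
    ⌊2 ^ N * t / T⌋₊ ≤ 2 ^ N := by
  refine Nat.floor_le_of_le ?_
  push_cast
  rw [div_le_iff₀ hT]
  gcongr
  exact ht.2

theorem dyad_mem (hT : 0 < T) {t : ℝ} (ht : t ∈ Icc (0 : ℝ) T) (N : ℕ) :
    dyad T N t ∈ Icc (0 : ℝ) T := grid_mem hT (dyad_floor_le hT ht N)

theorem abs_dyad_sub_le (hT : 0 < T) {t : ℝ} (ht : t ∈ Icc (0 : ℝ) T) (N : ℕ) :
    |dyad T N t - t| ≤ T / 2 ^ N := by
  have h2 : (0 : ℝ) < 2 ^ N := by positivity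
  have ha : 0 ≤ 2 ^ N * t / T := div_nonneg (mul_nonneg h2.le ht.1) hT.le
  have h1 := Nat.floor_le ha
  have h3 := (Nat.lt_floor_add_one (2 ^ N * t / T)).le
  have e : t = T / 2 ^ N * (2 ^ N * t / T) := by field_simp
  have e2 : dyad T N t = T / 2 ^ N * (⌊2 ^ N * t / T⌋₊ : ℝ) := by
    unfold dyad grid; push_cast; ring
  have hp : 0 < T / 2 ^ N := by positivity
  rw [abs_le, e2]
  constructor
  · nlinarith [mul_le_mul_of_nonneg_left h3 hp.le]
  · nlinarith [mul_le_mul_of_nonneg_left h1 hp.le]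

theorem tendsto_dyad (hT : 0 < T) {t : ℝ} (ht : t ∈ Icc (0 : ℝ) T) :
    Tendsto (fun N => dyad T N t) atTop (𝓝 t) := by
  rw [tendsto_iff_dist_tendsto_zero]
  refine squeeze_zero (g := fun N : ℕ => T / 2 ^ N) (fun _ => dist_nonneg)
    (fun N => abs_dyad_sub_le hT ht N) ?_
  have := (tendsto_pow_atTop_nhds_zero_of_lt_one (r := (1 / 2 : ℝ)) (by norm_num)
    (by norm_num)).const_mul T
  simpa [div_eq_mul_inv] using this

/-- A function with geometrically small dyadic increments has a continuous dyadic limit. -/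
theorem exists_C0_of_dyadic (hT : 0 < T) {y : ℝ → ℝ} (h0 : y 0 = 0) {K : ℝ}
    (hK : ∀ N k : ℕ, k < 2 ^ N →
      |y (grid T (2 ^ N) (k + 1)) - y (grid T (2 ^ N) k)| ≤ K * (9 / 10) ^ N) :
    ∃ z : C0 T, ∀ t ∈ Icc (0 : ℝ) T, Tendsto (fun N => y (dyad T N t)) atTop (𝓝 (ev z t)) := by
  have hK0 : 0 ≤ K := by simpa using (abs_nonneg _).trans (hK 0 0 (by norm_num))
  -- Successive dyadic approximations of `t` from below are equal or adjacent points of the finer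
  -- partition.
  have hdist : ∀ t ∈ Icc (0 : ℝ) T, ∀ N : ℕ,
      dist (y (dyad T N t)) (y (dyad T (N + 1) t)) ≤ K * (9 / 10) ^ N := by
    intro t ht N
    set k := ⌊2 ^ N * t / T⌋₊ with hk
    set k' := ⌊2 ^ (N + 1) * t / T⌋₊ with hk'
    have ha : 0 ≤ 2 ^ N * t / T := div_nonneg (mul_nonneg (by positivity) ht.1) hT.le
    have e : (2 : ℝ) ^ (N + 1) * t / T = 2 * (2 ^ N * t / T) := by rw [pow_succ]; ring
    have l1 : 2 * k ≤ k' := by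
      rw [hk', e]
      refine Nat.le_floor ?_
      push_cast
      linarith [Nat.floor_le ha]
    have l2 : k' < 2 * k + 2 := by
      rw [hk', e]
      refine (Nat.floor_lt (by positivity)).2 ?_
      push_cast
      linarith [Nat.lt_floor_add_one (2 ^ N * t / T)]
    have l3 : k' ≤ 2 ^ (N + 1) := dyad_floor_le hT ht (N + 1)
    have g : grid T (2 ^ N) k = grid T (2 ^ (N + 1)) (2 * k) := by
      rw [pow_succ, mul_comm 2 k, grid_mul T (by norm_num)]
    have d1 : dyad T N t = grid T (2 ^ (N + 1)) (2 * k) := g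
    have d2 : dyad T (N + 1) t = grid T (2 ^ (N + 1)) k' := rfl
    rw [d1, d2]
    rcases Nat.lt_or_ge (2 * k) k' with hlt | hge
    · have : k' = 2 * k + 1 := by omega
      rw [this, dist_comm, Real.dist_eq]
      refine (hK (N + 1) (2 * k) (by omega)).trans ?_
      rw [pow_succ]
      have : (0 : ℝ) ≤ (9 / 10) ^ N := by positivity
      nlinarith [mul_nonneg hK0 this]
    · have : k' = 2 * k := by omega
      rw [this, dist_self]
      positivity
  have hex : ∀ t ∈ Icc (0 : ℝ) T, ∃ c, Tendsto (fun N => y (dyad T N t)) atTop (𝓝 c) := fun t ht =>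
    cauchySeq_tendsto_of_complete
      (cauchySeq_of_le_geometric (9 / 10) K (by norm_num) (hdist t ht))
  choose! g hg using hex
  -- The factor `10` is `1 / (1 - 9/10)`, from summing the geometric tail.
  have hgd : ∀ t ∈ Icc (0 : ℝ) T, ∀ N, dist (y (dyad T N t)) (g t) ≤ 10 * K * (9 / 10) ^ N := by
    intro t ht N
    have := dist_le_of_le_geometric_of_tendsto (9 / 10) K (by norm_num) (hdist t ht) (hg t ht) N
    refine this.trans (le_of_eq ?_)
    ring
  -- Points closer than the mesh have dyadic approximations that are equal or adjacent. With two
  -- tails of size `10` this gives the constant `21` below.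
  have hmod : ∀ s ∈ Icc (0 : ℝ) T, ∀ t ∈ Icc (0 : ℝ) T, s ≤ t → ∀ N : ℕ, t - s < T / 2 ^ N →
      |y (dyad T N s) - y (dyad T N t)| ≤ K * (9 / 10) ^ N := by
    intro s hs t ht hst N hN
    have l1 : ⌊2 ^ N * s / T⌋₊ ≤ ⌊2 ^ N * t / T⌋₊ := by
      refine Nat.floor_mono ?_
      gcongr
    have l2 : ⌊2 ^ N * t / T⌋₊ < ⌊2 ^ N * s / T⌋₊ + 2 := by
      refine (Nat.floor_lt (div_nonneg (mul_nonneg (by positivity) ht.1) hT.le)).2 ?_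
      push_cast
      have h1 := Nat.lt_floor_add_one (2 ^ N * s / T)
      have h2 : 2 ^ N * t / T < 2 ^ N * s / T + 1 := by
        rw [div_add_one hT.ne', div_lt_div_iff_of_pos_right hT]
        rw [lt_div_iff₀ (by positivity)] at hN
        linarith
      linarith
    unfold dyad
    rcases Nat.lt_or_ge ⌊2 ^ N * s / T⌋₊ ⌊2 ^ N * t / T⌋₊ with hlt | hge
    · have : ⌊2 ^ N * t / T⌋₊ = ⌊2 ^ N * s / T⌋₊ + 1 := by omega
      have l3 := dyad_floor_le hT ht N
      rw [this, abs_sub_comm]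
      exact hK N _ (by omega)
    · have : ⌊2 ^ N * t / T⌋₊ = ⌊2 ^ N * s / T⌋₊ := by omega
      rw [this, sub_self, abs_zero]
      positivity
  have hcont : Continuous fun t : Icc (0 : ℝ) T => g t := by
    rw [Metric.continuous_iff]
    intro t ε hε
    have hlim : Tendsto (fun N : ℕ => 21 * K * (9 / 10 : ℝ) ^ N) atTop (𝓝 0) := by
      have := (tendsto_pow_atTop_nhds_zero_of_lt_one (r := (9 / 10 : ℝ)) (by norm_num)
        (by norm_num)).const_mul (21 * K)
      simpa using this
    obtain ⟨N, hN⟩ := (hlim.eventually (gt_mem_nhds hε)).exists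
    refine ⟨T / 2 ^ N, by positivity, fun s hs => ?_⟩
    have hs' : |(s : ℝ) - t| < T / 2 ^ N := hs
    have key : |y (dyad T N s) - y (dyad T N t)| ≤ K * (9 / 10) ^ N := by
      rcases le_total (s : ℝ) t with hst | hst
      · exact hmod _ s.2 _ t.2 hst N (by rw [abs_sub_comm] at hs'; exact (le_abs_self _).trans_lt hs')
      · rw [abs_sub_comm]
        exact hmod _ t.2 _ s.2 hst N ((le_abs_self _).trans_lt hs')
    have a1 := hgd s s.2 N
    have a2 := hgd t t.2 N
    rw [dist_comm] at a1
    calc dist (g s) (g t) ≤ dist (g s) (y (dyad T N s)) + dist (y (dyad T N s)) (y (dyad T N t))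
          + dist (y (dyad T N t)) (g t) := dist_triangle4 _ _ _ _
      _ ≤ 10 * K * (9 / 10) ^ N + K * (9 / 10) ^ N + 10 * K * (9 / 10) ^ N := by
          gcongr
          exact key
      _ = 21 * K * (9 / 10) ^ N := by ring
      _ < ε := hN
  refine ⟨⟨⟨fun t => g t, hcont⟩, fun t ht => ?_⟩, fun t ht => ?_⟩
  · change g t = 0
    rw [ht]
    refine tendsto_nhds_unique (hg 0 ⟨le_rfl, hT.le⟩) ?_
    have : ∀ N, y (dyad T N 0) = 0 := fun N => by simp [dyad, grid_zero, h0]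
    simp only [this]
    exact tendsto_const_nhds
  · have := hg t ht
    have e : ∀ z : C0 T, ev z t = (z : C(Icc (0 : ℝ) T, ℝ)) ⟨t, ht⟩ := fun z => by rw [ev, dif_pos ht]
    rw [e]
    exact this

theorem pw_zero (hT : 0 < T) (hφ : IsBVBasis T φ) (x : C0 T) : pw φ (0 : L2 T) x = 0 := by
  have : HasPWZ φ (0 : L2 T) x 0 := by
    refine tendsto_const_nhds.congr fun n => ?_
    rw [pwzSum_eq hT hφ]
    simp
  exact this.pw_eq

/-- The Kolmogorov continuity argument. At level `N` there are `2^N` increments, each with fourth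
moment of order `4^{-N}`. The weight `(8/5)^N` keeps the total summable with ratio `4/5`, and since
`(8/5) (9/10)⁴ > 1`, a finite weighted sum forces decay like `(9/10)^N`. -/
theorem ae_dyadic_increments (hT : 0 < T) (hm : IsWienerMeasure m) (hφ : IsBVBasis T φ)
    (A : L2 T →L[ℝ] L2 T) : ∀ᵐ x ∂m, ∃ K : ℝ, ∀ N k : ℕ, k < 2 ^ N →
      |pw φ (A (ind T (grid T (2 ^ N) (k + 1)))) x - pw φ (A (ind T (grid T (2 ^ N) k))) x|
        ≤ K * (9 / 10) ^ N := by
  let d : ℕ → ℕ → C0 T → ℝ := fun N k x =>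
    pw φ (A (ind T (grid T (2 ^ N) (k + 1)))) x - pw φ (A (ind T (grid T (2 ^ N) k))) x
  have hd : ∀ N k, Measurable (d N k) := fun N k =>
    (measurable_pw_right hT hφ _).sub (measurable_pw_right hT hφ _)
  let r : ℝ≥0∞ := ENNReal.ofReal (8 / 5)
  let S : C0 T → ℝ≥0∞ := fun x => ∑' N : ℕ, r ^ N * ∑ k ∈ Finset.range (2 ^ N), ‖d N k x‖ₑ ^ 4
  have hSm : Measurable S := Measurable.tsum fun N =>
    (Finset.measurable_sum _ fun k _ => (hd N k).enorm.pow_const 4).const_mul _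
  have hS : ∫⁻ x, S x ∂m < ⊤ := by
    rw [lintegral_tsum fun N => ((Finset.measurable_sum _ fun k _ =>
      (hd N k).enorm.pow_const 4).const_mul _).aemeasurable]
    let C : ℝ≥0∞ := gaussFourth * ‖A‖ₑ ^ 4
    have hC : C ≠ ⊤ := ENNReal.mul_ne_top gaussFourth_ne_top (by simp)
    have hle : ∀ N : ℕ, ∫⁻ x, r ^ N * ∑ k ∈ Finset.range (2 ^ N), ‖d N k x‖ₑ ^ 4 ∂m
        ≤ C * ENNReal.ofReal T ^ 2 * ENNReal.ofReal (4 / 5) ^ N := by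
      intro N
      rw [lintegral_const_mul _ (Finset.measurable_sum _ fun k _ => (hd N k).enorm.pow_const 4),
        lintegral_finsetSum _ fun k _ => (hd N k).enorm.pow_const 4]
      have h1 : ∀ k ∈ Finset.range (2 ^ N),
          ∫⁻ x, ‖d N k x‖ₑ ^ 4 ∂m ≤ C * ENNReal.ofReal (T / 2 ^ N) ^ 2 := by
        intro k hk
        rw [Finset.mem_range] at hk
        simp only [d, C]
        rw [lintegral_fourth_pw_sub hT hm hφ, mul_assoc]
        gcongr
        refine enorm_mulOp_sub_pow_four A _ _ ?_
        rw [norm_sq_ind_sub (grid_mem hT hk.le).1 (grid_mono hT _ (Nat.le_succ k))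
          (grid_mem hT hk).2]
        have := grid_succ_sub T (2 ^ N) k
        push_cast at this
        exact this
      calc r ^ N * ∑ k ∈ Finset.range (2 ^ N), ∫⁻ x, ‖d N k x‖ₑ ^ 4 ∂m
          ≤ r ^ N * ∑ k ∈ Finset.range (2 ^ N), C * ENNReal.ofReal (T / 2 ^ N) ^ 2 := by
            gcongr with k hk
            exact h1 k hk
        _ = C * (r ^ N * (2 ^ N * ENNReal.ofReal (T / 2 ^ N) ^ 2)) := by
            rw [Finset.sum_const, Finset.card_range, nsmul_eq_mul]
            push_cast
            ring
        _ = C * ENNReal.ofReal T ^ 2 * ENNReal.ofReal (4 / 5) ^ N := by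
            rw [mul_assoc C]
            congr 1
            change ENNReal.ofReal (8 / 5) ^ N * _ = _
            rw [show (2 : ℝ≥0∞) = ENNReal.ofReal 2 by simp, ← ENNReal.ofReal_pow (by norm_num),
              ← ENNReal.ofReal_pow (by norm_num), ← ENNReal.ofReal_pow (by positivity),
              ← ENNReal.ofReal_pow hT.le, ← ENNReal.ofReal_pow (by norm_num),
              ← ENNReal.ofReal_mul (by positivity), ← ENNReal.ofReal_mul (by positivity),
              ← ENNReal.ofReal_mul (by positivity)]
            congr 1
            have : (4 / 5 : ℝ) ^ N = (8 / 5) ^ N / 2 ^ N := by rw [← div_pow]; norm_num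
            rw [this]
            field_simp
    refine (ENNReal.tsum_le_tsum hle).trans_lt ?_
    rw [ENNReal.tsum_mul_left, ENNReal.tsum_geometric]
    refine ENNReal.mul_lt_top (ENNReal.mul_lt_top hC.lt_top (by simp)) ?_
    rw [ENNReal.inv_lt_top, tsub_pos_iff_lt, ENNReal.ofReal_lt_one]
    norm_num
  filter_upwards [ae_lt_top hSm hS.ne] with x hx
  refine ⟨(S x).toReal + 1, fun N k hk => ?_⟩
  have h1 : r ^ N * ‖d N k x‖ₑ ^ 4 ≤ S x :=
    (mul_le_mul_right (Finset.single_le_sum (f := fun k => ‖d N k x‖ₑ ^ 4)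
      (fun _ _ => zero_le) (Finset.mem_range.2 hk)) _).trans
      (ENNReal.le_tsum (f := fun N => r ^ N * ∑ k ∈ Finset.range (2 ^ N), ‖d N k x‖ₑ ^ 4) N)
  have h2 := ENNReal.toReal_mono hx.ne h1
  rw [ENNReal.toReal_mul, ENNReal.toReal_pow, ENNReal.toReal_pow, toReal_enorm, Real.norm_eq_abs,
    ENNReal.toReal_ofReal (by norm_num)] at h2
  change |d N k x| ≤ _
  set s := (S x).toReal
  have hs : 0 ≤ s := ENNReal.toReal_nonneg
  refine le_of_pow_le_pow_left₀ (n := 4) (by norm_num) (by positivity) ?_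
  have h3 : (1 : ℝ) ≤ (8 / 5) ^ N * ((9 / 10) ^ N) ^ 4 := by
    rw [← pow_mul, mul_comm N 4, pow_mul, ← mul_pow]
    exact one_le_pow₀ (by norm_num)
  have h4 : s ≤ (s + 1) ^ 4 := by nlinarith [pow_nonneg hs 2, pow_nonneg hs 3, pow_nonneg hs 4]
  have h5 : 0 ≤ |d N k x| ^ 4 := by positivity
  calc |d N k x| ^ 4 = 1 * |d N k x| ^ 4 := (one_mul _).symm
    _ ≤ ((8 / 5) ^ N * ((9 / 10) ^ N) ^ 4) * |d N k x| ^ 4 := by gcongr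
    _ = ((8 / 5) ^ N * |d N k x| ^ 4) * ((9 / 10) ^ N) ^ 4 := by ring
    _ ≤ (s + 1) ^ 4 * ((9 / 10) ^ N) ^ 4 := by gcongr; exact h2.trans h4
    _ = ((s + 1) * (9 / 10) ^ N) ^ 4 := by ring

/-- The Gaussian process `𝒵_h` has a version with continuous paths. -/
theorem exists_isGaussProc (hT : 0 < T) (hm : IsWienerMeasure m) (hφ : IsBVBasis T φ)
    (hh : MemLp h ⊤ (leb T)) : ∃ Z, IsGaussProc m φ h Z := by
  classical
  let y : C0 T → ℝ → ℝ := fun x t => pw φ (mulOp hh (ind T t)) x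
  let p : C0 T → C0 T → Prop := fun x z =>
    ∀ t ∈ Icc (0 : ℝ) T, Tendsto (fun N => y x (dyad T N t)) atTop (𝓝 (ev z t))
  have hp : ∀ᵐ x ∂m, ∃ z, p x z := by
    filter_upwards [ae_dyadic_increments hT hm hφ (mulOp hh)] with x ⟨K, hK⟩
    refine exists_C0_of_dyadic hT ?_ hK
    change pw φ (mulOp hh (ind T 0)) x = 0
    rw [ind_zero, map_zero]
    exact pw_zero hT hφ x
  -- `Z` is chosen path by path and need not be measurable: a Gaussian process version is only
  -- required to have the right value almost surely at each time.
  let Z : C0 T → C0 T := fun x => if hx : ∃ z, p x z then hx.choose else 0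
  refine ⟨Z, fun t ht => ?_⟩
  have hind : Tendsto (fun N => ind T (dyad T N t)) atTop (𝓝 (ind T t)) := by
    rw [tendsto_iff_norm_sub_tendsto_zero]
    have h1 : Tendsto (fun N => Real.sqrt |dyad T N t - t|) atTop (𝓝 0) := by
      have h2 : Tendsto (fun N => |dyad T N t - t|) atTop (𝓝 0) := by
        have := ((tendsto_dyad hT ht).sub_const t).abs
        simpa using this
      have := (Real.continuous_sqrt.tendsto 0).comp h2
      simpa [Function.comp_def] using this
    refine h1.congr fun N => ?_
    rw [← norm_sq_ind_sub_abs ht (dyad_mem hT ht N), Real.sqrt_sq (norm_nonneg _)]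
  have hlim := ae_eq_pw_of_tendsto hT hm hφ (((mulOp hh).continuous.tendsto _).comp hind)
    (X := fun x => ev (Z x) t) (by
      filter_upwards [hp] with x hx
      have : p x (Z x) := by
        simp only [Z, dif_pos hx]
        exact hx.choose_spec
      exact this t ht)
  filter_upwards [hlim, ae_hasPWZ hT hm hφ (mulOp hh (ind T t))] with x h1 h2
  rw [h1]
  exact h2.congr (coeFn_mulOp_ind hh t)

variable {T : ℝ} {m : Measure (C0 T)} {φ : ℕ → ℝ → ℝ} {h : ℝ → ℝ} {Z : C0 T → C0 T}

/-! ### The PWZ integral along the paths of a Gaussian process -/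

/-- The step functions `stepFn` as elements of `L₂[0,T]`. -/
def stepVec (T : ℝ) (φ : ℝ → ℝ) (N : ℕ) : L2 T :=
  ∑ i ∈ Finset.range N, φ (grid T N i) • (ind T (grid T N (i + 1)) - ind T (grid T N i))

theorem coeFn_stepVec (hT : 0 < T) (φ : ℝ → ℝ) (N : ℕ) :
    stepVec T φ N =ᵐ[leb T] stepFn T φ N := by
  have h1 : ∀ᵐ t ∂(leb T), ∀ i, (φ (grid T N i) • (ind T (grid T N (i + 1)) - ind T (grid T N i)) :
      L2 T) t = (Ioc (grid T N i) (grid T N (i + 1))).indicator (fun _ => φ (grid T N i)) t := by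
    rw [ae_all_iff]
    intro i
    filter_upwards [Lp.coeFn_smul (φ (grid T N i)) (ind T (grid T N (i + 1)) - ind T (grid T N i)),
      Lp.coeFn_sub (ind T (grid T N (i + 1))) (ind T (grid T N i)), coeFn_ind T (grid T N (i + 1)),
      coeFn_ind T (grid T N i), ae_leb_mem T] with t h1 h2 h3 h4 h5
    rw [h1, Pi.smul_apply, h2, Pi.sub_apply, h3, h4]
    have hst := grid_mono hT N (Nat.le_succ i)
    by_cases a : t ≤ grid T N (i + 1) <;> by_cases b : t ≤ grid T N i
    · simp [indicator, a, b, h5.1.le]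
    · simp [indicator, a, b, h5.1.le, not_le.1 b]
    · exact absurd (b.trans hst) a
    · simp [indicator, a, b]
  filter_upwards [h1, Lp.coeFn_finsetSum (Finset.range N) fun i =>
    (φ (grid T N i) • (ind T (grid T N (i + 1)) - ind T (grid T N i)) : L2 T)] with t h1 h2
  unfold stepVec stepFn
  rw [h2, Finset.sum_apply]
  exact Finset.sum_congr rfl fun i _ => h1 i

theorem tendsto_stepVec (hT : 0 < T) (hφ : IsBVBasis T φ) (j : ℕ) :
    Tendsto (stepVec T (φ j)) atTop (𝓝 (basisVec hT hφ j)) := by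
  set B := |φ j 0| + (eVariationOn (φ j) (Icc (0 : ℝ) T)).toReal
  have hB : ∀ t ∈ Icc (0 : ℝ) T, |φ j t| ≤ B := fun t ht =>
    abs_le_of_boundedVariationOn hT (hφ.bv j) ht
  rw [tendsto_iff_norm_sub_tendsto_zero]
  have h1 : Tendsto (fun N => ‖stepVec T (φ j) N - basisVec hT hφ j‖ ^ 2) atTop (𝓝 0) := by
    have e : ∀ N, ‖stepVec T (φ j) N - basisVec hT hφ j‖ ^ 2
        = ∫ t, (stepFn T (φ j) N t - φ j t) ^ 2 ∂(leb T) := by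
      intro N
      rw [norm_sq_eq_integral]
      refine integral_congr_ae ?_
      filter_upwards [Lp.coeFn_sub (stepVec T (φ j) N) (basisVec hT hφ j), coeFn_stepVec hT (φ j) N,
        (memLp_of_boundedVariationOn hT (hφ.bv j) 2).coeFn_toLp] with t h1 h2 h3
      rw [h1, Pi.sub_apply, h2, basisVec, h3]
      ring
    simp only [e]
    have h0 : ∫ t, (0 : ℝ) ∂(leb T) = 0 := integral_zero _ _
    rw [← h0]
    refine tendsto_integral_of_dominated_convergence (fun _ => (2 * B) ^ 2) (fun N => ?_)
      (integrable_const _) (fun N => ?_) ?_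
    · exact (((measurable_stepFn T _ N).aestronglyMeasurable).sub
        (memLp_of_boundedVariationOn hT (hφ.bv j) 2).1).pow 2
    · filter_upwards [ae_leb_mem T] with t ht
      rw [norm_pow]
      have h2 := abs_stepFn_le hT hB N ht
      have h3 := hB t ⟨ht.1.le, ht.2⟩
      gcongr
      exact (abs_sub _ _).trans (by linarith)
    · filter_upwards [ae_tendsto_stepFn hT (hφ.bv j)] with t ht
      have := (ht.sub_const (φ j t)).pow 2
      simpa using this
  have h2 := (Real.continuous_sqrt.tendsto 0).comp h1
  simpa [Function.comp_def, Real.sqrt_sq] using h2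

theorem hasPWZ_zero (hT : 0 < T) (hφ : IsBVBasis T φ) (x : C0 T) : HasPWZ φ (0 : L2 T) x 0 := by
  refine tendsto_const_nhds.congr fun n => ?_
  rw [pwzSum_eq hT hφ]
  simp

theorem hasPWZ_sum (hT : 0 < T) (hφ : IsBVBasis T φ) {ι : Type*} (s : Finset ι) {u : ι → L2 T}
    {x : C0 T} {c : ι → ℝ} (hu : ∀ i ∈ s, HasPWZ φ (u i) x (c i)) :
    HasPWZ φ (∑ i ∈ s, u i : L2 T) x (∑ i ∈ s, c i) := by
  classical
  induction s using Finset.induction_on with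
  | empty => simpa using hasPWZ_zero hT hφ x
  | insert i s hi ih =>
    rw [Finset.sum_insert hi, Finset.sum_insert hi]
    exact hasPWZ_add hT hφ (hu i (Finset.mem_insert_self i s))
      (ih fun k hk => hu k (Finset.mem_insert_of_mem hk))

/-- The Riemann–Stieltjes sums along `Z x` are integrals `⟨h ψ_N, x⟩` with step functions `ψ_N →
φ_j` in `L₂`. They converge pathwise to the left side, so `ae_eq_pw_of_tendsto` identifies the
limit. -/
theorem ae_rsInt_gaussProc (hT : 0 < T) (hm : IsWienerMeasure m) (hφ : IsBVBasis T φ)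
    (hh : MemLp h ⊤ (leb T)) (hZ : IsGaussProc m φ h Z) (j : ℕ) :
    ∀ᵐ x ∂m, rsInt (φ j) (Z x) = pw φ (mulOp hh (basisVec hT hφ j)) x := by
  refine ae_eq_pw_of_tendsto hT hm hφ (u := fun N => mulOp hh (stepVec T (φ j) N))
    (((mulOp hh).continuous.tendsto _).comp (tendsto_stepVec hT hφ j)) ?_
  have h1 : ∀ᵐ x ∂m, ∀ N, ∀ i ≤ N,
      HasPWZ φ (mulOp hh (ind T (grid T N i))) x (ev (Z x) (grid T N i)) := by
    rw [ae_all_iff]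
    intro N
    rw [ae_all_iff]
    intro i
    by_cases hi : i ≤ N
    · filter_upwards [hZ _ (grid_mem hT hi)] with x hx _
      exact hx.congr (coeFn_mulOp_ind hh _).symm
    · exact ae_of_all _ fun x hx => absurd hx hi
  filter_upwards [h1] with x hx
  refine (tendsto_rsSum hT (hφ.bv j) (Z x)).congr fun N => ?_
  refine (HasPWZ.pw_eq ?_).symm
  have e : mulOp hh (stepVec T (φ j) N) = ∑ i ∈ Finset.range N, φ j (grid T N i) •
      (mulOp hh (ind T (grid T N (i + 1))) - mulOp hh (ind T (grid T N i))) := by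
    simp only [stepVec, map_sum, map_smul, map_sub]
  rw [e]
  refine hasPWZ_sum hT hφ _ fun i hi => ?_
  rw [Finset.mem_range] at hi
  exact hasPWZ_smul hT hφ _ (hasPWZ_sub hT hφ (hx N _ hi) (hx N _ hi.le))

theorem norm_sq_sum_inner_smul_sub (hT : 0 < T) (hφ : IsBVBasis T φ) (u : L2 T) {k n : ℕ}
    (hkn : k ≤ n) :
    ‖∑ j ∈ Finset.range n, ⟪basisVec hT hφ j, u⟫_ℝ • basisVec hT hφ j
      - ∑ j ∈ Finset.range k, ⟪basisVec hT hφ j, u⟫_ℝ • basisVec hT hφ j‖ ^ 2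
    = ∑ j ∈ Finset.range n, ⟪basisVec hT hφ j, u⟫_ℝ ^ 2
      - ∑ j ∈ Finset.range k, ⟪basisVec hT hφ j, u⟫_ℝ ^ 2 := by
  rw [← Finset.sum_Ico_eq_sub _ hkn, ← Finset.sum_Ico_eq_sub _ hkn, ← real_inner_self_eq_norm_sq,
    (orthonormal_basisVec hT hφ).inner_sum]
  exact Finset.sum_congr rfl fun j _ => by simp [sq]

/-- The variables `⟨A φ_j, x⟩` are in general dependent, so the series is not one of independent
terms. Boundedness of `A` still bounds the variance of a block by `‖A‖²` times a block of `∑ (u,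
φ_j)²`, and the fourth moment criterion applies. -/
theorem ae_tendsto_sum_mul_pw (hT : 0 < T) (hm : IsWienerMeasure m) (hφ : IsBVBasis T φ)
    (A : L2 T →L[ℝ] L2 T) (u : L2 T) :
    ∀ᵐ x ∂m, Tendsto (fun n => ∑ j ∈ Finset.range n,
      ⟪basisVec hT hφ j, u⟫_ℝ * pw φ (A (basisVec hT hφ j)) x) atTop (𝓝 (pw φ (A u) x)) := by
  let v : ℕ → L2 T := fun n => ∑ j ∈ Finset.range n, ⟪basisVec hT hφ j, u⟫_ℝ • basisVec hT hφ j
  have hv : Tendsto v atTop (𝓝 u) := tendsto_sum_inner_smul hT hφ u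
  have hs := hasSum_sq_inner hT hφ u
  have h1 := ae_exists_tendsto_of_fourth_moment (P := m) (Y := fun n x => pw φ (A (v n)) x)
    (t := fun n => ∑ j ∈ Finset.range n, ⟪basisVec hT hφ j, u⟫_ℝ ^ 2)
    (C := gaussFourth * ‖A‖ₑ ^ 4)
    (fun n => measurable_pw_right hT hφ _)
    (fun a b hab => Finset.sum_le_sum_of_subset_of_nonneg (Finset.range_mono hab)
      fun _ _ _ => sq_nonneg _)
    ⟨‖u‖ ^ 2, by
      rintro _ ⟨n, rfl⟩
      exact sum_le_hasSum _ (fun _ _ => sq_nonneg _) hs⟩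
    (ENNReal.mul_ne_top gaussFourth_ne_top (by simp)) (fun k n hkn => by
      rw [lintegral_fourth_pw_sub hT hm hφ, mul_assoc]
      gcongr
      exact enorm_mulOp_sub_pow_four A _ _ (norm_sq_sum_inner_smul_sub hT hφ u hkn))
  choose! X hX using fun x (hx : ∃ c, Tendsto (fun n => pw φ (A (v n)) x) atTop (𝓝 c)) => hx
  have h2 := ae_eq_pw_of_tendsto hT hm hφ ((A.continuous.tendsto _).comp hv) (X := X) (by
    filter_upwards [h1] with x hx using hX x hx)
  have h3 : ∀ᵐ x ∂m, ∀ j, HasPWZ φ (A (basisVec hT hφ j)) x (pw φ (A (basisVec hT hφ j)) x) :=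
    ae_all_iff.2 fun j => ae_hasPWZ hT hm hφ _
  filter_upwards [h1, h2, h3] with x h1 h2 h3
  rw [← h2]
  refine (hX x h1).congr fun n => ?_
  refine HasPWZ.pw_eq ?_
  have e : A (v n) = ∑ j ∈ Finset.range n, ⟪basisVec hT hφ j, u⟫_ℝ • A (basisVec hT hφ j) := by
    simp only [v, map_sum, map_smul]
  rw [e]
  exact hasPWZ_sum hT hφ _ fun j _ => hasPWZ_smul hT hφ _ (h3 j)

theorem ae_ae_swap {α β : Type*} [MeasurableSpace α] [MeasurableSpace β] {μ : Measure α}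
    {ν : Measure β} [SFinite μ] [SFinite ν] {S : Set (α × β)} (hS : MeasurableSet S)
    (h : ∀ a, ∀ᵐ b ∂ν, (a, b) ∈ S) : ∀ᵐ b ∂ν, ∀ᵐ a ∂μ, (a, b) ∈ S :=
  (Measure.ae_ae_comm (p := fun a b => (a, b) ∈ S) hS).1 (ae_of_all _ h)

theorem measurable_pw_mulOp (hT : 0 < T) (hφ : IsBVBasis T φ) (A : L2 T →L[ℝ] L2 T) :
    Measurable fun z : L2 T × C0 T => pw φ (A z.1) z.2 := by
  have hn : ∀ n, Measurable fun z : L2 T × C0 T => pwzSum φ (A z.1) z.2 n := fun n => by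
    simp only [pwzSum_eq hT hφ]
    refine Finset.measurable_sum _ fun j _ => ?_
    have h1 : Measurable fun u : L2 T => ⟪basisVec hT hφ j, A u⟫_ℝ :=
      ((innerSL ℝ (basisVec hT hφ j)).continuous.comp A.continuous).measurable
    exact (h1.comp measurable_fst).mul ((measurable_rsInt hT (hφ.bv j)).comp measurable_snd)
  exact Measurable.limsup hn

theorem ae_ae_hasPWZ (hT : 0 < T) (hm : IsWienerMeasure m) (hφ : IsBVBasis T φ)
    (μ : Measure (L2 T)) [SFinite μ] : ∀ᵐ x ∂m, ∀ᵐ u : L2 T ∂μ, HasPWZ φ u x (pw φ u x) := by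
  have := hm.isProbabilityMeasure hT
  have hsf : SFinite m := @instSFiniteOfSigmaFinite _ _ m (IsFiniteMeasure.toSigmaFinite m)
  exact ae_ae_swap (S := {z : L2 T × C0 T | HasPWZ φ z.1 z.2 (pw φ z.1 z.2)})
    (measurableSet_tendsto_fun (measurable_pwzSum_prod hT hφ) (measurable_pw hT hφ))
    fun u => ae_hasPWZ hT hm hφ u

theorem measurable_sum_mul_pw (hT : 0 < T) (hφ : IsBVBasis T φ) (A : L2 T →L[ℝ] L2 T) (n : ℕ) :
    Measurable fun z : L2 T × C0 T => ∑ j ∈ Finset.range n,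
      ⟪basisVec hT hφ j, z.1⟫_ℝ * pw φ (A (basisVec hT hφ j)) z.2 := by
  refine Finset.measurable_sum _ fun j _ => ?_
  have h1 : Measurable fun u : L2 T => ⟪basisVec hT hφ j, u⟫_ℝ :=
    (innerSL ℝ (basisVec hT hφ j)).continuous.measurable
  exact (h1.comp measurable_fst).mul ((measurable_pw_right hT hφ _).comp measurable_snd)

/-- The relation `⟨u, 𝒵_h(x,·)⟩ = ⟨hu, x⟩`, existence of the left side included. The null set of
paths depends on `u`; Fubini exchanges the quantifiers. It is applied to the series in `⟨hφ_j, x⟩`,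
which is jointly measurable, and not to `Z`, which need not be. -/
theorem ae_ae_hasPWZ_gaussProc (hT : 0 < T) (hm : IsWienerMeasure m) (hφ : IsBVBasis T φ)
    (hh : MemLp h ⊤ (leb T)) (hZ : IsGaussProc m φ h Z) (μ : Measure (L2 T)) [SFinite μ] :
    ∀ᵐ x ∂m, ∀ᵐ u : L2 T ∂μ, HasPWZ φ u (Z x) (pw φ (mulOp hh u) x) := by
  have := hm.isProbabilityMeasure hT
  have hsf : SFinite m := @instSFiniteOfSigmaFinite _ _ m (IsFiniteMeasure.toSigmaFinite m)
  have h1 := ae_ae_swap (μ := μ) (ν := m) (S := {z : L2 T × C0 T | Tendsto (fun n =>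
      ∑ j ∈ Finset.range n, ⟪basisVec hT hφ j, z.1⟫_ℝ * pw φ (mulOp hh (basisVec hT hφ j)) z.2) atTop
      (𝓝 (pw φ (mulOp hh z.1) z.2))})
    (measurableSet_tendsto_fun (measurable_sum_mul_pw hT hφ (mulOp hh))
      (measurable_pw_mulOp hT hφ (mulOp hh)))
    fun u => ae_tendsto_sum_mul_pw hT hm hφ (mulOp hh) u
  have h2 : ∀ᵐ x ∂m, ∀ j, rsInt (φ j) (Z x) = pw φ (mulOp hh (basisVec hT hφ j)) x :=
    ae_all_iff.2 fun j => ae_rsInt_gaussProc hT hm hφ hh hZ j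
  filter_upwards [h1, h2] with x h1 h2
  filter_upwards [h1] with u hu
  refine Tendsto.congr (fun n => ?_) hu
  rw [pwzSum_eq hT hφ]
  exact Finset.sum_congr rfl fun j _ => by rw [h2 j]

/-! ### Gaussian convolutions determine a finite signed measure -/

section GaussUnique

set_option linter.unusedSectionVars false

variable {E : Type*} [NormedAddCommGroup E] [InnerProductSpace ℝ E] [MeasurableSpace E]
  [BorelSpace E] [SecondCountableTopology E] {μ : Measure E} [IsFiniteMeasure μ]

theorem exp_neg_norm_sq_mul_exp_inner (u v : E) (t : ℝ) :
    Real.exp (-(‖u‖ ^ 2 / 2)) * Real.exp (t * ⟪u, v⟫_ℝ)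
      = Real.exp ((t * ‖v‖) ^ 2 / 2) * Real.exp (-(‖u - t • v‖ ^ 2 / 2)) := by
  rw [← Real.exp_add, ← Real.exp_add, norm_sub_sq_real, inner_smul_right, norm_smul, mul_pow,
    mul_pow, Real.norm_eq_abs, sq_abs]
  congr 1
  ring

theorem measurable_gauss (v : E) : Measurable fun u : E => Real.exp (-(‖u - v‖ ^ 2 / 2)) := by
  fun_prop

theorem integrable_gauss_mul {k : E → ℝ} (hk : Measurable k) (hk1 : ∀ u, |k u| ≤ 1) (v : E) :
    Integrable (fun u => Real.exp (-(‖u - v‖ ^ 2 / 2)) * k u) μ := by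
  refine Integrable.of_bound ((measurable_gauss v).mul hk).aestronglyMeasurable 1
    (ae_of_all _ fun u => ?_)
  rw [norm_mul, Real.norm_eq_abs, Real.norm_eq_abs, Real.abs_exp]
  exact mul_le_one₀ (Real.exp_le_one_iff.2 (by have := sq_nonneg ‖u - v‖; linarith)) (abs_nonneg _)
    (hk1 u)

/-- The positive part of the signed measure with density `exp(-‖u‖²/2) k(u)`. -/
def gaussPos (μ : Measure E) (k : E → ℝ) : Measure E :=
  μ.withDensity fun u => ENNReal.ofReal (Real.exp (-(‖u‖ ^ 2 / 2)) * k u)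

theorem measurable_exp_mul {k : E → ℝ} (hk : Measurable k) :
    Measurable fun u : E => Real.exp (-(‖u‖ ^ 2 / 2)) * k u := by
  have : Measurable fun u : E => Real.exp (-(‖u‖ ^ 2 / 2)) := by fun_prop
  exact this.mul hk

theorem integrable_max_mul {k : E → ℝ} (hk : Measurable k) (hk1 : ∀ u, |k u| ≤ 1) (v : E)
    (t : ℝ) :
    Integrable (fun u => max (Real.exp (-(‖u‖ ^ 2 / 2)) * k u) 0 * Real.exp (t * ⟪u, v⟫_ℝ)) μ := by
  have h1 := ((integrable_gauss_mul (μ := μ) (hk.max measurable_const) (k := fun u => max (k u) 0)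
    (fun u => by
      rw [abs_of_nonneg (le_max_right _ _)]
      exact max_le ((le_abs_self _).trans (hk1 u)) zero_le_one) (t • v)).const_mul
      (Real.exp ((t * ‖v‖) ^ 2 / 2)))
  refine h1.congr (ae_of_all _ fun u => ?_)
  have e := exp_neg_norm_sq_mul_exp_inner u v t
  have e2 : max (Real.exp (-(‖u‖ ^ 2 / 2)) * k u) 0 = Real.exp (-(‖u‖ ^ 2 / 2)) * max (k u) 0 := by
    rw [mul_max_of_nonneg _ _ (Real.exp_pos _).le, mul_zero]
  simp only [e2]
  rw [← mul_assoc, ← e]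
  ring

theorem mgf_gaussPos {k : E → ℝ} (hk : Measurable k) (v : E) (t : ℝ) :
    mgf (fun u => ⟪u, v⟫_ℝ) (gaussPos μ k) t
      = ∫ u, max (Real.exp (-(‖u‖ ^ 2 / 2)) * k u) 0 * Real.exp (t * ⟪u, v⟫_ℝ) ∂μ := by
  unfold mgf gaussPos
  rw [integral_withDensity_eq_integral_toReal_smul (measurable_exp_mul hk).ennreal_ofReal
    (ae_of_all _ fun _ => ENNReal.ofReal_lt_top)]
  simp only [ENNReal.toReal_ofReal', smul_eq_mul]

theorem lintegral_gaussPos_ne_top {k : E → ℝ} (hk1 : ∀ u, |k u| ≤ 1) :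
    ∫⁻ u, ENNReal.ofReal (Real.exp (-(‖u‖ ^ 2 / 2)) * k u) ∂μ ≠ ⊤ := by
  refine ne_top_of_le_ne_top (b := ∫⁻ _, 1 ∂μ) (by simp) (lintegral_mono fun u => ?_)
  rw [← ENNReal.ofReal_one]
  refine ENNReal.ofReal_le_ofReal ?_
  have h1 : Real.exp (-(‖u‖ ^ 2 / 2)) ≤ 1 :=
    Real.exp_le_one_iff.2 (by have := sq_nonneg ‖u‖; linarith)
  have h2 := (abs_le.1 (hk1 u)).2
  nlinarith [Real.exp_pos (-(‖u‖ ^ 2 / 2))]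

theorem integrable_exp_gaussPos {k : E → ℝ} (hk : Measurable k) (hk1 : ∀ u, |k u| ≤ 1) (v : E)
    (t : ℝ) : Integrable (fun u => Real.exp (t * ⟪u, v⟫_ℝ)) (gaussPos μ k) := by
  unfold gaussPos
  rw [integrable_withDensity_iff_integrable_smul' (measurable_exp_mul hk).ennreal_ofReal
    (ae_of_all _ fun _ => ENNReal.ofReal_lt_top)]
  simpa only [ENNReal.toReal_ofReal', smul_eq_mul] using integrable_max_mul hk hk1 v t

/-- Completing the square turns Gaussian integrals centred at `t • v` into the exponential moments
of `exp(-‖u‖²/2) k(u) dμ`. Its positive and negative parts thus have equal moment generating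
functions in every direction. These are finite everywhere, so analytic continuation to the imaginary
axis gives equal characteristic functions and equal measures. -/
theorem ae_eq_zero_of_integral_gauss_eq_zero [CompleteSpace E] {k : E → ℝ} (hk : Measurable k)
    (hk1 : ∀ u, |k u| ≤ 1) (h : ∀ v, ∫ u, Real.exp (-(‖u - v‖ ^ 2 / 2)) * k u ∂μ = 0) :
    k =ᵐ[μ] 0 := by
  have hk' : Measurable (-k) := hk.neg
  have hk1' : ∀ u, |(-k) u| ≤ 1 := fun u => by simpa using hk1 u
  have : IsFiniteMeasure (gaussPos μ k) := isFiniteMeasure_withDensity (lintegral_gaussPos_ne_top hk1)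
  have : IsFiniteMeasure (gaussPos μ (-k)) :=
    isFiniteMeasure_withDensity (lintegral_gaussPos_ne_top hk1')
  have hmgf : ∀ v : E, mgf (fun u => ⟪u, v⟫_ℝ) (gaussPos μ k)
      = mgf (fun u => ⟪u, v⟫_ℝ) (gaussPos μ (-k)) := by
    intro v
    funext t
    rw [mgf_gaussPos hk, mgf_gaussPos hk', ← sub_eq_zero,
      ← integral_sub (integrable_max_mul hk hk1 v t) (integrable_max_mul hk' hk1' v t)]
    have e : ∀ u : E, max (Real.exp (-(‖u‖ ^ 2 / 2)) * k u) 0 * Real.exp (t * ⟪u, v⟫_ℝ)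
        - max (Real.exp (-(‖u‖ ^ 2 / 2)) * (-k) u) 0 * Real.exp (t * ⟪u, v⟫_ℝ)
        = Real.exp ((t * ‖v‖) ^ 2 / 2) * (Real.exp (-(‖u - t • v‖ ^ 2 / 2)) * k u) := by
      intro u
      rw [← mul_assoc, ← exp_neg_norm_sq_mul_exp_inner, ← sub_mul, Pi.neg_apply, mul_neg,
        max_zero_sub_max_neg_zero_eq_self]
      ring
    simp only [e]
    rw [integral_const_mul, h, mul_zero]
  -- At `t = 0` the moment generating functions are the total masses; the continuation result asks
  -- that both measures vanish together.
  have h0 : gaussPos μ k = 0 ↔ gaussPos μ (-k) = 0 := by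
    have := congrFun (hmgf 0) 0
    rw [mgf_zero', mgf_zero'] at this
    rw [← Measure.measure_univ_eq_zero, ← Measure.measure_univ_eq_zero (μ := gaussPos μ (-k)),
      ← measureReal_eq_zero_iff, ← measureReal_eq_zero_iff, this]
  have heq : gaussPos μ k = gaussPos μ (-k) := by
    refine Measure.ext_of_charFun (funext fun v => ?_)
    have huniv : integrableExpSet (fun u => ⟪u, v⟫_ℝ) (gaussPos μ k) = univ :=
      eq_univ_of_forall fun t => integrable_exp_gaussPos hk hk1 v t
    have h1 := eqOn_complexMGF_of_mgf' (hmgf v) h0 (x := Complex.I) (by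
      rw [mem_ofPred_eq, huniv, interior_univ]; trivial)
    simpa only [complexMGF, charFun_apply, mul_comm] using h1
  have h1 := (withDensity_eq_iff (measurable_exp_mul hk).ennreal_ofReal.aemeasurable
    (measurable_exp_mul hk').ennreal_ofReal.aemeasurable (lintegral_gaussPos_ne_top hk1)).1 heq
  filter_upwards [h1] with u hu
  have h2 := congrArg ENNReal.toReal hu
  simp only [ENNReal.toReal_ofReal'] at h2
  have h3 : Real.exp (-(‖u‖ ^ 2 / 2)) * k u = 0 := by
    rw [← max_zero_sub_max_neg_zero_eq_self (Real.exp (-(‖u‖ ^ 2 / 2)) * k u), h2, Pi.neg_apply,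
      mul_neg, sub_self]
  exact (mul_eq_zero.1 h3).resolve_left (Real.exp_pos _).ne'

/-- Real and imaginary parts of `θ` both vanish almost everywhere, which `|θ| = 1` permits only for
the zero measure. -/
theorem eq_zero_measure_of_integral_gauss_eq_zero [CompleteSpace E] {θ : E → ℂ} (hθ : Measurable θ)
    (hθ1 : ∀ u, ‖θ u‖ = 1)
    (h : ∀ v, ∫ u, ((Real.exp (-(‖u - v‖ ^ 2 / 2)) : ℝ) : ℂ) * θ u ∂μ = 0) : μ = 0 := by
  have hint : ∀ v, Integrable (fun u => ((Real.exp (-(‖u - v‖ ^ 2 / 2)) : ℝ) : ℂ) * θ u) μ := by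
    intro v
    refine Integrable.of_bound ((Complex.measurable_ofReal.comp
      (measurable_gauss v)).mul hθ).aestronglyMeasurable 1 (ae_of_all _ fun u => ?_)
    rw [norm_mul, hθ1, mul_one, Complex.norm_real, Real.norm_eq_abs, Real.abs_exp]
    exact Real.exp_le_one_iff.2 (by have := sq_nonneg ‖u - v‖; linarith)
  have hre : (fun u => (θ u).re) =ᵐ[μ] 0 :=
    ae_eq_zero_of_integral_gauss_eq_zero (Complex.measurable_re.comp hθ)
      (fun u => (Complex.abs_re_le_norm _).trans (hθ1 u).le) fun v => by
        have := Complex.reCLM.integral_comp_comm (hint v)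
        rw [h v] at this
        simpa only [Complex.reCLM_apply, Complex.re_ofReal_mul, Complex.zero_re] using this
  have him : (fun u => (θ u).im) =ᵐ[μ] 0 :=
    ae_eq_zero_of_integral_gauss_eq_zero (Complex.measurable_im.comp hθ)
      (fun u => (Complex.abs_im_le_norm _).trans (hθ1 u).le) fun v => by
        have := Complex.imCLM.integral_comp_comm (hint v)
        rw [h v] at this
        simpa only [Complex.imCLM_apply, Complex.im_ofReal_mul, Complex.zero_im] using this
  rw [← ae_eq_bot, ← empty_mem_iff_bot]
  filter_upwards [hre, him] with u h1 h2
  have := hθ1 u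
  rw [Complex.ext (z := θ u) (w := 0) h1 h2] at this
  simp at this

end GaussUnique

/-! ### Polar decomposition of complex measures -/

section Polar

variable {X : Type*} [MeasurableSpace X]

theorem withDensity_enorm_of_norm_eq_one {μ : Measure X} {θ : X → ℂ} (hθ : ∀ u, ‖θ u‖ = 1) :
    μ.withDensity (fun u => ‖θ u‖ₑ) = μ := by
  have : (fun u => ‖θ u‖ₑ) = 1 := by
    funext u
    rw [← ofReal_norm, hθ, ENNReal.ofReal_one]
    rfl
  rw [this, withDensity_one]

theorem integrable_of_norm_eq_one {μ : Measure X} [IsFiniteMeasure μ] {θ : X → ℂ}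
    (hθm : Measurable θ) (hθ : ∀ u, ‖θ u‖ = 1) : Integrable θ μ :=
  Integrable.of_bound hθm.aestronglyMeasurable 1 (ae_of_all _ fun u => (hθ u).le)

theorem variation_withDensity_of_norm_eq_one {μ : Measure X} [IsFiniteMeasure μ] {θ : X → ℂ}
    (hθm : Measurable θ) (hθ : ∀ u, ‖θ u‖ = 1) : (μ.withDensityᵥ θ).variation = μ := by
  rw [Measure.variation_withDensityᵥ (integrable_of_norm_eq_one hθm hθ),
    withDensity_enorm_of_norm_eq_one hθ]

/-- The variation is dominated by the total variations of the real and imaginary parts, which are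
finite. -/
theorem isFiniteMeasure_variation (f : ComplexMeasure X) : IsFiniteMeasure f.variation := by
  have h : f.variation ≤ (ComplexMeasure.re f).totalVariation + (ComplexMeasure.im f).totalVariation := by
    refine VectorMeasure.variation_le_of_forall_enorm_le fun s _ => ?_
    have h1 : ‖f s‖ₑ ≤ ‖ComplexMeasure.re f s‖ₑ + ‖ComplexMeasure.im f s‖ₑ := by
      rw [← ofReal_norm, ← ofReal_norm, ← ofReal_norm, ← ENNReal.ofReal_add (norm_nonneg _)
        (norm_nonneg _)]
      exact ENNReal.ofReal_le_ofReal (Complex.norm_le_abs_re_add_abs_im (f s))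
    exact h1.trans (add_le_add (SignedMeasure.enorm_le_totalVariation _ _)
      (SignedMeasure.enorm_le_totalVariation _ _))
  exact isFiniteMeasure_of_le _ h

/-- Radon–Nikodym for the real and imaginary parts gives a density `θ₀`. The variation of `θ₀ μ` is
`|θ₀| μ`, and it equals `μ`, so `|θ₀| = 1` almost everywhere. -/
theorem exists_polar (f : ComplexMeasure X) :
    ∃ θ : X → ℂ, Measurable θ ∧ (∀ u, ‖θ u‖ = 1) ∧ f = f.variation.withDensityᵥ θ := by
  classical
  have hfin := isFiniteMeasure_variation f
  set μ := f.variation with hμ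
  have hac : ∀ s, MeasurableSet s → μ s = 0 → f s = 0 := fun s _ h => by
    rw [← enorm_eq_zero]
    exact le_antisymm ((VectorMeasure.enorm_measure_le_variation f s).trans h.le) zero_le
  have hre : μ.withDensityᵥ ((ComplexMeasure.re f).rnDeriv μ) = ComplexMeasure.re f :=
    SignedMeasure.withDensityᵥ_rnDeriv_eq _ _ (VectorMeasure.AbsolutelyContinuous.mk fun s hs h => by
      rw [Measure.toENNRealVectorMeasure_apply_measurable hs] at h
      exact congrArg Complex.re (hac s hs h))
  have him : μ.withDensityᵥ ((ComplexMeasure.im f).rnDeriv μ) = ComplexMeasure.im f :=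
    SignedMeasure.withDensityᵥ_rnDeriv_eq _ _ (VectorMeasure.AbsolutelyContinuous.mk fun s hs h => by
      rw [Measure.toENNRealVectorMeasure_apply_measurable hs] at h
      exact congrArg Complex.im (hac s hs h))
  set g₁ := (ComplexMeasure.re f).rnDeriv μ
  set g₂ := (ComplexMeasure.im f).rnDeriv μ
  have hg₁ : Integrable g₁ μ := SignedMeasure.integrable_rnDeriv _ _
  have hg₂ : Integrable g₂ μ := SignedMeasure.integrable_rnDeriv _ _
  let θ₀ : X → ℂ := fun u => (g₁ u : ℂ) + (g₂ u : ℂ) * Complex.I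
  have hθ₀m : Measurable θ₀ :=
    (Complex.measurable_ofReal.comp (SignedMeasure.measurable_rnDeriv _ _)).add
      ((Complex.measurable_ofReal.comp (SignedMeasure.measurable_rnDeriv _ _)).mul_const _)
  have hθ₀ : Integrable θ₀ μ := hg₁.ofReal.add (hg₂.ofReal.mul_const _)
  have hf : f = μ.withDensityᵥ θ₀ := by
    ext s hs
    rw [withDensityᵥ_apply hθ₀ hs]
    have e1 : (f s).re = ∫ u in s, g₁ u ∂μ := by
      rw [← withDensityᵥ_apply hg₁ hs, hre]; rfl
    have e2 : (f s).im = ∫ u in s, g₂ u ∂μ := by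
      rw [← withDensityᵥ_apply hg₂ hs, him]; rfl
    rw [integral_add (μ := μ.restrict s) (f := fun u => (g₁ u : ℂ))
        (g := fun u => (g₂ u : ℂ) * Complex.I) hg₁.ofReal.integrableOn
        (hg₂.ofReal.mul_const Complex.I).integrableOn,
      integral_mul_const, integral_complex_ofReal, integral_complex_ofReal, ← e1, ← e2,
      Complex.re_add_im]
  have h1 : ∀ᵐ u ∂μ, ‖θ₀ u‖ₑ = 1 := by
    have h2 : μ.withDensity (fun u => ‖θ₀ u‖ₑ) = μ.withDensity 1 := by
      rw [← Measure.variation_withDensityᵥ hθ₀, ← hf, withDensity_one]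
    exact (withDensity_eq_iff hθ₀m.enorm.aemeasurable aemeasurable_const hθ₀.2.ne).1 h2
  -- Redefining `θ₀` on a null set makes the modulus `1` everywhere, which spares later arguments an
  -- exceptional set.
  refine ⟨fun u => if ‖θ₀ u‖ = 1 then θ₀ u else 1, Measurable.ite
    (measurableSet_eq_fun hθ₀m.norm measurable_const) hθ₀m measurable_const, fun u => ?_, ?_⟩
  · by_cases h : ‖θ₀ u‖ = 1
    · simpa only [if_pos h] using h
    · simp only [if_neg h, norm_one]
  · refine hf.trans (WithDensityᵥEq.congr_ae ?_)
    filter_upwards [h1] with u hu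
    have : ‖θ₀ u‖ = 1 := by rw [← toReal_enorm, hu, ENNReal.toReal_one]
    rw [if_pos this]

/-- Reduces integrals against a complex measure to Bochner integrals: clear for simple functions,
and both sides are continuous under bounded pointwise limits. -/
theorem integral_complexMeasure {μ : Measure X} [IsFiniteMeasure μ] {θ : X → ℂ}
    (hθm : Measurable θ) (hθ : ∀ u, ‖θ u‖ = 1) {g : X → ℂ} (hg : Measurable g) (hg1 : ∀ u, ‖g u‖ ≤ 1) :
    (μ.withDensityᵥ θ).integral g (ContinuousLinearMap.mul ℝ ℂ) = ∫ u, g u * θ u ∂μ := by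
  have hv := variation_withDensity_of_norm_eq_one (μ := μ) hθm hθ
  have hfin := isFiniteMeasure_variation (μ.withDensityᵥ θ)
  have hi := integrable_of_norm_eq_one (μ := μ) hθm hθ
  have hs : ∀ s : SimpleFunc X ℂ, (μ.withDensityᵥ θ).integral s (ContinuousLinearMap.mul ℝ ℂ)
      = ∫ u, s u * θ u ∂μ := by
    intro s
    have hsi : ∀ s : SimpleFunc X ℂ, Integrable (fun u => s u * θ u) μ := fun s =>
      (SimpleFunc.integrable_of_isFiniteMeasure s).mul_bdd (c := 1) hθm.aestronglyMeasurable
        (ae_of_all _ fun u => (hθ u).le)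
    induction s using SimpleFunc.induction with
    | const c hA =>
      rename_i A
      have e : (SimpleFunc.piecewise A hA (SimpleFunc.const X c) (SimpleFunc.const X 0) : X → ℂ)
          = A.indicator fun _ => c := by
        simp only [SimpleFunc.coe_piecewise, SimpleFunc.coe_const]
        ext u
        by_cases hu : u ∈ A <;> simp [hu]
      rw [e, VectorMeasure.integral_indicator_const c hA, ContinuousLinearMap.mul_apply',
        withDensityᵥ_apply hi hA, ← integral_const_mul, ← integral_indicator hA]
      congr 1
      ext u
      by_cases hu : u ∈ A <;> simp [hu]
    | add hd h1 h2 =>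
      rename_i s t
      have e : ((s + t : SimpleFunc X ℂ) : X → ℂ) = fun u => s u + t u := rfl
      rw [e, VectorMeasure.integral_fun_add (SimpleFunc.integrable_of_isFiniteMeasure s)
        (SimpleFunc.integrable_of_isFiniteMeasure t), h1, h2, ← integral_add (hsi s) (hsi t)]
      simp only [add_mul]
  have hgs := hg.stronglyMeasurable
  have hbd : ∀ n u, ‖hgs.approxBounded 1 n u‖ ≤ 1 := fun n u =>
    hgs.norm_approxBounded_le zero_le_one n u
  have h1 := VectorMeasure.tendsto_integral_of_dominated_convergence (μ := μ.withDensityᵥ θ)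
    (B := ContinuousLinearMap.mul ℝ ℂ) (f := g) (fun _ => 1)
    (fun n => (SimpleFunc.stronglyMeasurable (hgs.approxBounded 1 n)).aestronglyMeasurable) (integrable_const _)
    (fun n => ae_of_all _ fun u => hbd n u)
    (ae_of_all _ fun u => StronglyMeasurable.tendsto_approxBounded_of_norm_le hgs (hg1 u))
  have h2 : Tendsto (fun n => ∫ u, hgs.approxBounded 1 n u * θ u ∂μ) atTop
      (𝓝 (∫ u, g u * θ u ∂μ)) := by
    refine tendsto_integral_of_dominated_convergence (fun _ => 1) (fun n =>
      ((SimpleFunc.stronglyMeasurable _).aestronglyMeasurable.mul hθm.aestronglyMeasurable))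
      (integrable_const _) (fun n => ae_of_all _ fun u => ?_) (ae_of_all _ fun u => ?_)
    · rw [norm_mul, hθ, mul_one]
      exact hbd n u
    · exact (StronglyMeasurable.tendsto_approxBounded_of_norm_le hgs (hg1 u)).mul_const _
  refine tendsto_nhds_unique h1 (h2.congr fun n => (hs _).symm)

end Polar

/-! ### Fubini for bounded measurable functions -/

section Fubini

variable {X Y : Type*} [MeasurableSpace X] [MeasurableSpace Y] {P : Measure X} {ν : Measure Y}
  [IsFiniteMeasure P] [IsFiniteMeasure ν] {f : X × Y → ℂ}

theorem integral_swap_of_norm_le (hf : Measurable f) (hf1 : ∀ z, ‖f z‖ ≤ 1) :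
    ∫ x, ∫ y, f (x, y) ∂ν ∂P = ∫ y, ∫ x, f (x, y) ∂P ∂ν :=
  integral_integral_swap (f := fun x y => f (x, y))
    (Integrable.of_bound hf.aestronglyMeasurable 1 (ae_of_all _ hf1))

theorem measurable_integral_left (hf : Measurable f) : Measurable fun y => ∫ x, f (x, y) ∂P :=
  hf.stronglyMeasurable.integral_prod_left'.measurable

end Fubini

variable {T : ℝ} {m : Measure (C0 T)} {φ : ℕ → ℝ → ℝ} {h : ℝ → ℝ} {Z : C0 T → C0 T}

/-! ### Fresnel integrals -/

/-- The character `exp(ir)`. -/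
def expI (r : ℝ) : ℂ := Complex.exp (Complex.I * (r : ℂ))

theorem norm_expI (r : ℝ) : ‖expI r‖ = 1 := by
  unfold expI
  rw [mul_comm, Complex.norm_exp_ofReal_mul_I]

theorem expI_add (r s : ℝ) : expI (r + s) = expI r * expI s := by
  unfold expI
  rw [← Complex.exp_add, Complex.ofReal_add, mul_add]

theorem measurable_expI : Measurable expI := by
  unfold expI
  fun_prop

/-- The representation `F(x) = ∫ exp(i⟨u,x⟩) θ(u) dμ(u)` of an element of `𝒮(L₂[0,T])` by a polar
decomposition of the complex measure. -/
def IsFresnel (φ : ℕ → ℝ → ℝ) (μ : Measure (L2 T)) (θ : L2 T → ℂ) (F : C0 T → ℂ) : Prop :=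
  ∀ x : C0 T, (∀ᵐ u : L2 T ∂μ, ∃ c, HasPWZ φ (⇑u) x c) → F x = ∫ u, expI (pw φ u x) * θ u ∂μ

theorem integral_pwz_eq (hT : 0 < T) (hφ : IsBVBasis T φ) {μ : Measure (L2 T)} [IsFiniteMeasure μ]
    {θ : L2 T → ℂ} (hθm : Measurable θ) (hθ : ∀ u, ‖θ u‖ = 1) {x : C0 T}
    (hx : ∀ᵐ u : L2 T ∂μ, ∃ c, HasPWZ φ (⇑u) x c) :
    (μ.withDensityᵥ θ).integral (fun u : L2 T => Complex.exp (Complex.I * ((pwz φ (⇑u) x : ℝ) : ℂ)))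
      (ContinuousLinearMap.mul ℝ ℂ) = ∫ u, expI (pw φ u x) * θ u ∂μ := by
  have hg : Measurable fun u : L2 T => expI (pw φ u x) :=
    measurable_expI.comp (measurable_pw_left hT hφ x)
  rw [← integral_complexMeasure hθm hθ hg fun u => (norm_expI _).le]
  refine VectorMeasure.integral_congr_ae ?_
  rw [variation_withDensity_of_norm_eq_one hθm hθ]
  filter_upwards [hx] with u ⟨c, hc⟩
  rw [hc.pwz_eq, ← hc.pw_eq]
  rfl

theorem isFresnelOf_iff (hT : 0 < T) (hφ : IsBVBasis T φ) {μ : Measure (L2 T)} [IsFiniteMeasure μ]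
    {θ : L2 T → ℂ} (hθm : Measurable θ) (hθ : ∀ u, ‖θ u‖ = 1) (F : C0 T → ℂ) :
    IsFresnelOf φ (μ.withDensityᵥ θ) F ↔ IsFresnel φ μ θ F := by
  unfold IsFresnelOf IsFresnel
  rw [variation_withDensity_of_norm_eq_one hθm hθ]
  refine forall_congr' fun x => forall_congr' fun hx => ?_
  rw [integral_pwz_eq hT hφ hθm hθ hx]

theorem exists_isFresnel (hT : 0 < T) (hφ : IsBVBasis T φ) {F : C0 T → ℂ} (hF : InS φ F) :
    ∃ (μ : Measure (L2 T)) (θ : L2 T → ℂ), IsFiniteMeasure μ ∧ Measurable θ ∧ (∀ u, ‖θ u‖ = 1) ∧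
      IsFresnel φ μ θ F := by
  obtain ⟨f, hf⟩ := hF
  obtain ⟨θ, hθm, hθ, e⟩ := exists_polar f
  have hfin := isFiniteMeasure_variation f
  refine ⟨f.variation, θ, hfin, hθm, hθ, ?_⟩
  rw [← isFresnelOf_iff hT hφ hθm hθ, ← e]
  exact hf

theorem secondCountable_L2 (T : ℝ) : SecondCountableTopology (L2 T) := by
  have : Fact ((2 : ℝ≥0∞) ≠ ⊤) := ⟨by norm_num⟩
  infer_instance

theorem measurable_pw_prod {Ω : Type*} [MeasurableSpace Ω] (hT : 0 < T) (hφ : IsBVBasis T φ)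
    {a : Ω → L2 T} (ha : Measurable a) :
    Measurable fun z : Ω × C0 T => pw φ (a z.1) z.2 := by
  have hn : ∀ n, Measurable fun z : Ω × C0 T => pwzSum φ (a z.1) z.2 n := fun n => by
    simp only [pwzSum_eq hT hφ]
    refine Finset.measurable_sum _ fun j _ => ?_
    have h1 : Measurable fun ω => ⟪basisVec hT hφ j, a ω⟫_ℝ :=
      (innerSL ℝ (basisVec hT hφ j)).continuous.measurable.comp ha
    exact (h1.comp measurable_fst).mul ((measurable_rsInt hT (hφ.bv j)).comp measurable_snd)
  exact Measurable.limsup hn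

theorem measurable_expI_pw {Ω : Type*} [MeasurableSpace Ω] (hT : 0 < T) (hφ : IsBVBasis T φ)
    {a : Ω → L2 T} (ha : Measurable a) (r : ℝ) :
    Measurable fun z : Ω × C0 T => expI (r * pw φ (a z.1) z.2) :=
  measurable_expI.comp ((measurable_pw_prod hT hφ ha).const_mul r)

theorem integral_expI_pw (hT : 0 < T) (hm : IsWienerMeasure m) (hφ : IsBVBasis T φ) (r : ℝ)
    (u : L2 T) : ∫ x, expI (r * pw φ u x) ∂m
      = ((Real.exp (-(‖u‖ ^ 2 * r ^ 2 / 2)) : ℝ) : ℂ) := by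
  rw [Complex.ofReal_exp]
  refine (integral_exp_mul_pw hT hm hφ r u).trans ?_
  congr 1
  push_cast
  ring

/-- Testing the functional against `exp(-i⟨v,x⟩)` and integrating over Wiener space gives the
integral of `exp(-‖u-v‖²/2) θ(u)`, which therefore vanishes for every `v`. -/
theorem measure_eq_zero_of_fresnel_eq_zero (hT : 0 < T) (hm : IsWienerMeasure m)
    (hφ : IsBVBasis T φ) {μ : Measure (L2 T)} [IsFiniteMeasure μ] {θ : L2 T → ℂ}
    (hθm : Measurable θ) (hθ : ∀ u, ‖θ u‖ = 1)
    (h0 : ∀ᵐ x ∂m, ∫ u, expI (pw φ u x) * θ u ∂μ = 0) : μ = 0 := by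
  have := secondCountable_L2 T
  have hp := hm.isProbabilityMeasure hT
  refine eq_zero_measure_of_integral_gauss_eq_zero hθm hθ fun v => ?_
  let f : L2 T × C0 T → ℂ := fun z =>
    expI (1 * pw φ z.1 z.2) * expI ((-1) * pw φ v z.2) * θ z.1
  have hf : Measurable f :=
    ((measurable_expI_pw hT hφ measurable_id 1).mul
      (measurable_expI_pw hT hφ (a := fun _ => v) measurable_const (-1))).mul
      (hθm.comp measurable_fst)
  have hf1 : ∀ z, ‖f z‖ ≤ 1 := fun z => by
    simp only [f, norm_mul, norm_expI, hθ, mul_one, le_refl]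
  have h1 := integral_swap_of_norm_le (P := μ) (ν := m) hf hf1
  have h2 : ∀ u, ∫ x, f (u, x) ∂m = ((Real.exp (-(‖u - v‖ ^ 2 / 2)) : ℝ) : ℂ) * θ u := by
    intro u
    simp only [f]
    rw [integral_mul_const]
    congr 1
    have h3 := integral_expI_pw hT hm hφ 1 (u - v)
    rw [one_pow, mul_one] at h3
    rw [← h3]
    refine integral_congr_ae ?_
    filter_upwards [ae_pw_sub hT hm hφ u v] with x hx
    rw [hx, ← expI_add]
    congr 1
    ring
  have h3 : ∀ᵐ x ∂m, ∫ u, f (u, x) ∂μ = 0 := by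
    filter_upwards [h0] with x hx
    have e : ∀ u, f (u, x) = expI ((-1) * pw φ v x) * (expI (pw φ u x) * θ u) := fun u => by
      simp only [f, one_mul]; ring
    simp only [e]
    rw [integral_const_mul, hx, mul_zero]
  simp only [h2] at h1
  rw [h1, integral_congr_ae h3, integral_zero]

/-- Apply the vanishing criterion to a polar decomposition of the difference of the two complex
measures. -/
theorem withDensity_eq_of_fresnel_eq (hT : 0 < T) (hm : IsWienerMeasure m)
    (hφ : IsBVBasis T φ) {μ μ' : Measure (L2 T)} [IsFiniteMeasure μ] [IsFiniteMeasure μ']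
    {θ θ' : L2 T → ℂ} (hθm : Measurable θ) (hθ : ∀ u, ‖θ u‖ = 1) (hθm' : Measurable θ')
    (hθ' : ∀ u, ‖θ' u‖ = 1)
    (h0 : ∀ᵐ x ∂m, ∫ u, expI (pw φ u x) * θ u ∂μ = ∫ u, expI (pw φ u x) * θ' u ∂μ') :
    μ.withDensityᵥ θ = μ'.withDensityᵥ θ' := by
  obtain ⟨ϑ, hϑm, hϑ, e⟩ := exists_polar (μ.withDensityᵥ θ - μ'.withDensityᵥ θ')
  have f1 := isFiniteMeasure_variation (μ.withDensityᵥ θ)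
  have f2 := isFiniteMeasure_variation (μ'.withDensityᵥ θ')
  have f3 := isFiniteMeasure_variation (μ.withDensityᵥ θ - μ'.withDensityᵥ θ')
  have h1 : (μ.withDensityᵥ θ - μ'.withDensityᵥ θ').variation = 0 := by
    refine measure_eq_zero_of_fresnel_eq_zero hT hm hφ hϑm hϑ ?_
    filter_upwards [h0] with x hx
    have hg : Measurable fun u : L2 T => expI (pw φ u x) :=
      measurable_expI.comp (measurable_pw_left hT hφ x)
    have hg1 : ∀ u : L2 T, ‖expI (pw φ u x)‖ ≤ 1 := fun u => (norm_expI _).le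
    rw [← integral_complexMeasure hϑm hϑ hg hg1, ← e,
      VectorMeasure.integral_sub_vectorMeasure
        (Integrable.of_bound hg.aestronglyMeasurable 1 (ae_of_all _ hg1))
        (Integrable.of_bound hg.aestronglyMeasurable 1 (ae_of_all _ hg1)),
      integral_complexMeasure hθm hθ hg hg1, integral_complexMeasure hθm' hθ' hg hg1, hx, sub_self]
  rw [VectorMeasure.variation_eq_zero] at h1
  exact sub_eq_zero.1 h1

/-! ### Analytic Wiener integrals of Gaussian type -/

/-- The factor `exp(-t/(2z))`. -/
def damp (t : ℝ) (z : ℂ) : ℂ := Complex.exp (-(t : ℂ) / (2 * z))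

theorem norm_damp (t : ℝ) (z : ℂ) :
    ‖damp t z‖ = Real.exp (-(t / (2 * Complex.normSq z) * z.re)) := by
  unfold damp
  rw [Complex.norm_exp]
  congr 1
  have : -(t : ℂ) / (2 * z) = ((-(t / 2) : ℝ) : ℂ) * z⁻¹ := by
    push_cast
    rw [mul_comm 2 z, ← div_div, div_eq_mul_inv _ (2 : ℂ), div_eq_mul_inv _ z]
    ring
  rw [this, Complex.re_ofReal_mul, Complex.inv_re, ← div_div]
  ring

theorem norm_damp_le_one {t : ℝ} (ht : 0 ≤ t) {z : ℂ} (hz : 0 ≤ z.re) : ‖damp t z‖ ≤ 1 := by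
  rw [norm_damp]
  refine Real.exp_le_one_iff.2 (neg_nonpos.2 (mul_nonneg (div_nonneg ht ?_) hz))
  exact mul_nonneg zero_le_two (Complex.normSq_nonneg z)

theorem norm_damp_eq_one (t : ℝ) {z : ℂ} (hz : z.re = 0) : ‖damp t z‖ = 1 := by
  rw [norm_damp, hz, mul_zero, neg_zero, Real.exp_zero]

theorem damp_add (s t : ℝ) (z : ℂ) : damp (s + t) z = damp s z * damp t z := by
  unfold damp
  rw [← Complex.exp_add]
  congr 1
  push_cast
  ring

theorem damp_zero (z : ℂ) : damp 0 z = 1 := by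
  simp [damp]

theorem measurable_damp (z : ℂ) : Measurable fun t => damp t z := by
  unfold damp
  fun_prop

theorem hasDerivAt_damp (t : ℝ) {z : ℂ} (hz : z ≠ 0) :
    HasDerivAt (damp t) ((t : ℂ) / (2 * z ^ 2) * damp t z) z := by
  have h1 : HasDerivAt (fun z : ℂ => -(t : ℂ) / 2 * z⁻¹) (-(t : ℂ) / 2 * -(z ^ 2)⁻¹) z :=
    (hasDerivAt_inv hz).const_mul _
  have h2 := h1.cexp
  have e : damp t = fun z => Complex.exp (-(t : ℂ) / 2 * z⁻¹) := by
    funext w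
    unfold damp
    rw [← div_div, div_eq_mul_inv _ w]
  rw [e]
  refine h2.congr_deriv ?_
  field_simp

/-- The bound is `c Re z · exp(-c Re z) ≤ 1`. It does not depend on `t`, so differentiation under
the integral needs no moments of the measure. -/
theorem norm_deriv_damp_le {t : ℝ} (ht : 0 ≤ t) {z : ℂ} (hz : 0 < z.re) :
    ‖(t : ℂ) / (2 * z ^ 2) * damp t z‖ ≤ 1 / z.re := by
  rw [norm_mul, norm_damp, norm_div, norm_mul, norm_pow, ← Complex.normSq_eq_norm_sq,
    Complex.norm_real, Real.norm_of_nonneg ht, Complex.norm_ofNat]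
  set c := t / (2 * Complex.normSq z)
  rw [le_div_iff₀ hz]
  have h1 := Real.add_one_le_exp (c * z.re)
  have h2 := Real.exp_pos (-(c * z.re))
  have h3 : Real.exp (-(c * z.re)) * Real.exp (c * z.re) = 1 := by
    rw [← Real.exp_add, neg_add_cancel, Real.exp_zero]
  nlinarith

theorem isOpen_Cplus : IsOpen Cplus := isOpen_lt continuous_const Complex.continuous_re

theorem convex_Cplus : Convex ℝ Cplus := convex_halfSpace_re_gt 0

theorem neBot_nhdsWithin_Cplus {z : ℂ} (hz : 0 ≤ z.re) : (𝓝[Cplus] z).NeBot := by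
  rw [← mem_closure_iff_nhdsWithin_neBot]
  have : closure Cplus = {z : ℂ | 0 ≤ z.re} := Complex.closure_setOfPred_lt_re 0
  rw [this]
  exact hz

section Analytic

variable {Ω : Type*} [MeasurableSpace Ω] {μ : Measure Ω} [IsFiniteMeasure μ] {Θ : Ω → ℂ}
  {B : Ω → ℝ}

theorem analyticOnNhd_integral_damp (hΘ : Measurable Θ) (hΘ1 : ∀ ω, ‖Θ ω‖ ≤ 1) (hB : Measurable B)
    (hB0 : ∀ ω, 0 ≤ B ω) : AnalyticOnNhd ℂ (fun z => ∫ ω, Θ ω * damp (B ω) z ∂μ) Cplus := by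
  refine DifferentiableOn.analyticOnNhd (fun z₀ hz₀ => ?_) isOpen_Cplus
  have hz₀' : 0 < z₀.re := hz₀
  have hmeas : ∀ z, Measurable fun ω => Θ ω * damp (B ω) z := fun z =>
    hΘ.mul ((measurable_damp z).comp hB)
  let s : Set ℂ := {z | z₀.re / 2 < z.re}
  have hs : s ∈ 𝓝 z₀ := (isOpen_lt continuous_const Complex.continuous_re).mem_nhds
    (by change z₀.re / 2 < z₀.re; linarith)
  have hsz : ∀ z ∈ s, 0 < z.re := fun z hz => (half_pos hz₀').trans hz
  have h := hasDerivAt_integral_of_dominated_loc_of_deriv_le (μ := μ) (𝕜 := ℂ) (x₀ := z₀) (s := s)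
    (F := fun z ω => Θ ω * damp (B ω) z)
    (F' := fun z ω => Θ ω * ((B ω : ℂ) / (2 * z ^ 2) * damp (B ω) z))
    (bound := fun _ => 2 / z₀.re) hs
    (Eventually.of_forall fun z => (hmeas z).aestronglyMeasurable)
    (Integrable.of_bound (hmeas z₀).aestronglyMeasurable 1 (ae_of_all _ fun ω => by
      rw [norm_mul]
      exact mul_le_one₀ (hΘ1 ω) (norm_nonneg _) (norm_damp_le_one (hB0 ω) hz₀'.le)))
    (hΘ.mul (((Complex.measurable_ofReal.comp hB).div_const _).mul
      ((measurable_damp z₀).comp hB))).aestronglyMeasurable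
    (ae_of_all _ fun ω z hz => by
      rw [norm_mul]
      have h1 := norm_deriv_damp_le (hB0 ω) (hsz z hz)
      have h2 : 1 / z.re ≤ 2 / z₀.re := by
        rw [div_le_div_iff₀ (hsz z hz) hz₀']
        have : z₀.re / 2 < z.re := hz
        linarith
      calc ‖Θ ω‖ * _ ≤ 1 * (1 / z.re) := mul_le_mul (hΘ1 ω) h1 (norm_nonneg _) zero_le_one
        _ ≤ 2 / z₀.re := by rw [one_mul]; exact h2)
    (integrable_const _)
    (ae_of_all _ fun ω z hz => (hasDerivAt_damp (B ω) (fun h0 => by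
      have := hsz z hz
      rw [h0] at this
      exact lt_irrefl _ this)).const_mul (Θ ω))
  exact h.2.differentiableAt.differentiableWithinAt

theorem tendsto_integral_norm_damp_sub (hB : Measurable B) (hB0 : ∀ ω, 0 ≤ B ω) {z₀ : ℂ}
    (hz₀ : z₀ ≠ 0) (hz₀' : 0 ≤ z₀.re) :
    Tendsto (fun z => ∫ ω, ‖damp (B ω) z - damp (B ω) z₀‖ ∂μ) (𝓝[Cplus] z₀) (𝓝 0) := by
  have h0 : ∫ ω, (0 : ℝ) ∂μ = 0 := integral_zero _ _
  rw [← h0]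
  refine tendsto_integral_filter_of_dominated_convergence (fun _ => 2)
    (Eventually.of_forall fun z => (((measurable_damp z).comp hB).sub
      ((measurable_damp z₀).comp hB)).norm.aestronglyMeasurable) ?_ (integrable_const _)
    (ae_of_all _ fun ω => ?_)
  · filter_upwards [self_mem_nhdsWithin] with z hz
    refine ae_of_all _ fun ω => ?_
    rw [norm_norm]
    have h1 := norm_damp_le_one (hB0 ω) (z := z) (le_of_lt hz)
    have h2 := norm_damp_le_one (hB0 ω) hz₀'
    exact (norm_sub_le _ _).trans (by linarith)
  · have h1 : Tendsto (damp (B ω)) (𝓝[Cplus] z₀) (𝓝 (damp (B ω) z₀)) :=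
      (hasDerivAt_damp (B ω) hz₀).continuousAt.tendsto.mono_left nhdsWithin_le_nhds
    have h2 := (h1.sub_const (damp (B ω) z₀)).norm
    simpa using h2

/-- The bound does not involve `Θ`. When `Θ` carries the character of a path `y`, convergence is
thus uniform in `y`, as the limit in mean requires. -/
theorem norm_integral_damp_sub_le (hΘ : Measurable Θ) (hΘ1 : ∀ ω, ‖Θ ω‖ ≤ 1) (hB : Measurable B)
    (hB0 : ∀ ω, 0 ≤ B ω) {z z₀ : ℂ} (hz : 0 ≤ z.re) (hz₀ : 0 ≤ z₀.re) :
    ‖∫ ω, Θ ω * damp (B ω) z ∂μ - ∫ ω, Θ ω * damp (B ω) z₀ ∂μ‖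
      ≤ ∫ ω, ‖damp (B ω) z - damp (B ω) z₀‖ ∂μ := by
  have hmeas : ∀ z, Measurable fun ω => damp (B ω) z := fun z => (measurable_damp z).comp hB
  have hdi : ∀ z : ℂ, 0 ≤ z.re → Integrable (fun ω => damp (B ω) z) μ := fun z hz =>
    Integrable.of_bound (hmeas z).aestronglyMeasurable 1
      (ae_of_all _ fun ω => norm_damp_le_one (hB0 ω) hz)
  have hi : ∀ z : ℂ, 0 ≤ z.re → Integrable (fun ω => Θ ω * damp (B ω) z) μ := fun z hz =>
    (hdi z hz).bdd_mul (c := 1) hΘ.aestronglyMeasurable (ae_of_all _ hΘ1)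
  rw [← integral_sub (hi z hz) (hi z₀ hz₀)]
  refine (norm_integral_le_integral_norm _).trans (integral_mono_of_nonneg
    (ae_of_all _ fun _ => norm_nonneg _) ((hdi z hz).sub (hdi z₀ hz₀)).norm
    (ae_of_all _ fun ω => ?_))
  simp only [← mul_sub, norm_mul]
  exact mul_le_of_le_one_left (norm_nonneg _) (hΘ1 ω)

theorem tendsto_integral_damp (hΘ : Measurable Θ) (hΘ1 : ∀ ω, ‖Θ ω‖ ≤ 1) (hB : Measurable B)
    (hB0 : ∀ ω, 0 ≤ B ω) {z₀ : ℂ} (hz₀ : z₀ ≠ 0) (hz₀' : 0 ≤ z₀.re) :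
    Tendsto (fun z => ∫ ω, Θ ω * damp (B ω) z ∂μ) (𝓝[Cplus] z₀)
      (𝓝 (∫ ω, Θ ω * damp (B ω) z₀ ∂μ)) := by
  rw [tendsto_iff_norm_sub_tendsto_zero]
  refine squeeze_zero' (Eventually.of_forall fun _ => norm_nonneg _) ?_
    (tendsto_integral_norm_damp_sub (μ := μ) hB hB0 hz₀ hz₀')
  filter_upwards [self_mem_nhdsWithin] with z hz
  exact norm_integral_damp_sub_le hΘ hΘ1 hB hB0 (le_of_lt hz) hz₀'

end Analytic

variable {T : ℝ} {m : Measure (C0 T)} {φ : ℕ → ℝ → ℝ}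

/-! ### Analytic Wiener integrals of Fourier transforms -/

section Core

variable {Ω : Type*} [MeasurableSpace Ω] {μ : Measure Ω} [IsFiniteMeasure μ] {Θ : Ω → ℂ}
  {a b : Ω → L2 T}

/-- By Fubini the path integral is taken first; with `r² = 1/l` the Gaussian characteristic function
is the damping factor at `z = l`, whose integral is analytic in `z`. -/
theorem isAnalyticWiener_of_ae_eq (hT : 0 < T) (hm : IsWienerMeasure m) (hφ : IsBVBasis T φ)
    (hΘ : Measurable Θ) (hΘ1 : ∀ ω, ‖Θ ω‖ ≤ 1) (hb : Measurable b) {Ψ : ℝ → C0 T → ℂ}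
    (hΨ : ∀ r : ℝ, 0 < r → ∀ᵐ x ∂m, Ψ r x = ∫ ω, Θ ω * expI (r * pw φ (b ω) x) ∂μ) :
    IsAnalyticWiener m Ψ fun z => ∫ ω, Θ ω * damp (‖b ω‖ ^ 2) z ∂μ := by
  have hp := hm.isProbabilityMeasure hT
  refine ⟨fun l hl => ?_, analyticOnNhd_integral_damp hΘ hΘ1 (hb.norm.pow_const 2)
    fun ω => sq_nonneg _⟩
  set r := (Real.sqrt l)⁻¹ with hr
  have hr0 : 0 < r := inv_pos.2 (Real.sqrt_pos.2 hl)
  have hr2 : r ^ 2 = l⁻¹ := by rw [hr, inv_pow, Real.sq_sqrt hl.le]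
  let f : Ω × C0 T → ℂ := fun z => Θ z.1 * expI (r * pw φ (b z.1) z.2)
  have hf : Measurable f := (hΘ.comp measurable_fst).mul (measurable_expI_pw hT hφ hb r)
  have hf1 : ∀ z, ‖f z‖ ≤ 1 := fun z => by
    simp only [f, norm_mul, norm_expI, mul_one]
    exact hΘ1 z.1
  have hg : Measurable fun x => ∫ ω, f (ω, x) ∂μ := measurable_integral_left hf
  have hgi : Integrable (fun x => ∫ ω, f (ω, x) ∂μ) m := by
    refine Integrable.of_bound hg.aestronglyMeasurable (μ.real univ) (ae_of_all _ fun x => ?_)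
    refine (norm_integral_le_of_norm_le_const (C := 1) (ae_of_all _ fun ω => hf1 _)).trans ?_
    rw [one_mul]
  have he : Ψ r =ᵐ[m] fun x => ∫ ω, f (ω, x) ∂μ := hΨ r hr0
  refine ⟨hgi.congr he.symm, ?_⟩
  rw [integral_congr_ae he, ← integral_swap_of_norm_le hf hf1]
  refine integral_congr_ae (ae_of_all _ fun ω => ?_)
  simp only [f]
  rw [integral_const_mul, integral_expI_pw hT hm hφ, hr2, Complex.ofReal_exp]
  unfold damp
  congr 2
  push_cast
  field_simp

/-- The identity theorem: both functions agree on the positive reals, which accumulate at `1`. -/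
theorem IsAnalyticWiener.eqOn {Ψ : ℝ → C0 T → ℂ} {J J' : ℂ → ℂ} (h : IsAnalyticWiener m Ψ J)
    (h' : IsAnalyticWiener m Ψ J') : EqOn J J' Cplus := by
  have hr : ∀ l : ℝ, 0 < l → J l = J' l := fun l hl => by
    rw [← (h.1 l hl).2, ← (h'.1 l hl).2]
  have h1 : (1 : ℂ) ∈ Cplus := by
    change (0 : ℝ) < (1 : ℂ).re
    simp
  refine h.2.eqOn_of_preconnected_of_frequently_eq h'.2 convex_Cplus.isPreconnected h1 ?_
  have ht : Tendsto (fun n : ℕ => (((1 : ℝ) + 1 / ((n : ℝ) + 1) : ℝ) : ℂ)) atTop (𝓝[≠] 1) := by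
    refine tendsto_nhdsWithin_iff.2 ⟨?_, Eventually.of_forall fun n => ?_⟩
    · have h2 : Tendsto (fun n : ℕ => (1 : ℝ) + 1 / ((n : ℝ) + 1)) atTop (𝓝 (1 + 0)) :=
        tendsto_one_div_add_atTop_nhds_zero_nat.const_add 1
      have h3 := (Complex.continuous_ofReal.tendsto _).comp h2
      simpa [Function.comp_def] using h3
    · have h2 : (0 : ℝ) < 1 / ((n : ℝ) + 1) := by positivity
      intro h3
      have h4 : (1 : ℝ) + 1 / ((n : ℝ) + 1) = 1 :=
        Complex.ofReal_injective ((mem_singleton_iff.1 h3).trans Complex.ofReal_one.symm)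
      linarith
  exact ht.frequently (Frequently.of_forall fun n => hr _ (by positivity))

end Core

variable {T : ℝ} {m : Measure (C0 T)} {φ : ℕ → ℝ → ℝ}

/-! ### Existence and uniqueness of the transform -/

section Core

set_option linter.unusedSectionVars false

variable {Ω : Type*} [MeasurableSpace Ω] {μ : Measure Ω} [IsFiniteMeasure μ] {Θ : Ω → ℂ}
  {a b : Ω → L2 T}

/-- The analytic Wiener integral `∫ Θ exp(i⟨a,y⟩) exp(-‖b‖²/(2z)) dμ`. -/
def feyn (φ : ℕ → ℝ → ℝ) (μ : Measure Ω) (Θ : Ω → ℂ) (a b : Ω → L2 T) (y : C0 T) (z : ℂ) : ℂ :=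
  ∫ ω, Θ ω * expI (pw φ (a ω) y) * damp (‖b ω‖ ^ 2) z ∂μ

theorem measurable_expI_pw_path (hT : 0 < T) (hφ : IsBVBasis T φ) (ha : Measurable a)
    (y : C0 T) : Measurable fun ω => expI (pw φ (a ω) y) := by
  have h1 := (measurable_expI_pw hT hφ ha 1).comp (measurable_prodMk_right (y := y))
  simpa only [Function.comp_def, one_mul] using h1

theorem measurable_mul_expI (hT : 0 < T) (hφ : IsBVBasis T φ) (hΘ : Measurable Θ)
    (ha : Measurable a) (y : C0 T) : Measurable fun ω => Θ ω * expI (pw φ (a ω) y) :=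
  hΘ.mul (measurable_expI_pw_path hT hφ ha y)

theorem norm_mul_expI_le (hΘ1 : ∀ ω, ‖Θ ω‖ ≤ 1) (y : C0 T) (ω : Ω) :
    ‖Θ ω * expI (pw φ (a ω) y)‖ ≤ 1 := by
  rw [norm_mul, norm_expI, mul_one]
  exact hΘ1 ω

theorem measurable_feyn (hT : 0 < T) (hφ : IsBVBasis T φ) (hΘ : Measurable Θ)
    (ha : Measurable a) (hb : Measurable b) (z : ℂ) : Measurable fun y => feyn φ μ Θ a b y z := by
  have hf : Measurable fun w : Ω × C0 T =>
      Θ w.1 * expI (1 * pw φ (a w.1) w.2) * damp (‖b w.1‖ ^ 2) z :=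
    ((hΘ.comp measurable_fst).mul (measurable_expI_pw hT hφ ha 1)).mul
      (((measurable_damp z).comp (hb.norm.pow_const 2)).comp measurable_fst)
  have h1 := measurable_integral_left (P := μ) hf
  simp only [one_mul] at h1
  exact h1

theorem scaleMeasurable_of_measurable {F : C0 T → ℂ} (hF : Measurable F) : ScaleMeasurable m F :=
  fun ρ _ => (hF.comp (measurable_const_smul ρ)).aestronglyMeasurable

theorem tendsto_feyn (hT : 0 < T) (hφ : IsBVBasis T φ) (hΘ : Measurable Θ)
    (hΘ1 : ∀ ω, ‖Θ ω‖ ≤ 1) (ha : Measurable a) (hb : Measurable b) (y : C0 T) {z₀ : ℂ}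
    (hz₀ : z₀ ≠ 0) (hz₀' : 0 ≤ z₀.re) :
    Tendsto (feyn φ μ Θ a b y) (𝓝[Cplus] z₀) (𝓝 (feyn φ μ Θ a b y z₀)) :=
  tendsto_integral_damp (measurable_mul_expI hT hφ hΘ ha y) (norm_mul_expI_le hΘ1 y)
    (hb.norm.pow_const 2) (fun _ => sq_nonneg _) hz₀ hz₀'

/-- The functionals `Ψ y r` are Fourier transforms of the data `Θ`, `a`, `b` on `Ω`. -/
def IsFourierRep (m : Measure (C0 T)) (φ : ℕ → ℝ → ℝ) (μ : Measure Ω) (Θ : Ω → ℂ)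
    (a b : Ω → L2 T) (Ψ : C0 T → ℝ → C0 T → ℂ) : Prop :=
  SAE m fun y => ∀ r : ℝ, 0 < r → ∀ᵐ x ∂m,
    Ψ y r x = ∫ ω, Θ ω * expI (pw φ (a ω) y) * expI (r * pw φ (b ω) x) ∂μ

theorem IsFourierRep.isAnalyticWiener (hT : 0 < T) (hm : IsWienerMeasure m) (hφ : IsBVBasis T φ)
    (hΘ : Measurable Θ) (hΘ1 : ∀ ω, ‖Θ ω‖ ≤ 1) (ha : Measurable a) (hb : Measurable b)
    {Ψ : C0 T → ℝ → C0 T → ℂ} (hΨ : IsFourierRep m φ μ Θ a b Ψ) :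
    SAE m fun y => IsAnalyticWiener m (Ψ y) (feyn φ μ Θ a b y) := by
  intro ρ hρ
  filter_upwards [hΨ ρ hρ] with y hy
  exact isAnalyticWiener_of_ae_eq hT hm hφ (measurable_mul_expI hT hφ hΘ ha _)
    (norm_mul_expI_le hΘ1 _) hb hy

theorem neg_I_mul_ne_zero {q : ℝ} (hq : q ≠ 0) : -(Complex.I * (q : ℂ)) ≠ 0 :=
  neg_ne_zero.2 (mul_ne_zero Complex.I_ne_zero (Complex.ofReal_ne_zero.2 hq))

theorem neg_I_mul_re (q : ℝ) : (-(Complex.I * (q : ℂ))).re = 0 := by simp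

/-- Every functional whose Gaussian shifts are Fourier transforms has a GFFT. -/
theorem isGFFT_feyn (hT : 0 < T) (hm : IsWienerMeasure m) (hφ : IsBVBasis T φ)
    (hΘ : Measurable Θ) (hΘ1 : ∀ ω, ‖Θ ω‖ ≤ 1) (ha : Measurable a) (hb : Measurable b)
    {h : ℝ → ℝ} (hh : MemLp h ⊤ (leb T)) {F : C0 T → ℂ}
    (hF : ∀ Z, IsGaussProc m φ h Z → IsFourierRep m φ μ Θ a b fun y r x => F (y + r • Z x))
    {p q : ℝ} (hq : q ≠ 0) :
    IsGFFT m φ p q h F fun y => feyn φ μ Θ a b y (-(Complex.I * (q : ℂ))) := by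
  have hp := hm.isProbabilityMeasure hT
  obtain ⟨Z, hZ⟩ := exists_isGaussProc hT hm hφ hh
  have hq0 := neg_I_mul_ne_zero hq
  have hq1 : 0 ≤ (-(Complex.I * (q : ℂ))).re := (neg_I_mul_re q).ge
  have hB : Measurable fun ω => ‖b ω‖ ^ 2 := hb.norm.pow_const 2
  refine ⟨scaleMeasurable_of_measurable (measurable_feyn hT hφ hΘ ha hb _), feyn φ μ Θ a b,
    ⟨⟨Z, hZ, (hF Z hZ).isAnalyticWiener hT hm hφ hΘ hΘ1 ha hb⟩, fun z _ =>
      scaleMeasurable_of_measurable (measurable_feyn hT hφ hΘ ha hb _)⟩, fun _ ρ _ =>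
      ae_of_all _ fun y => tendsto_feyn hT hφ hΘ hΘ1 ha hb _ hq0 hq1, fun hp1 ρ _ => ?_⟩
  have hpp : 0 < p / (p - 1) := div_pos (by linarith) (by linarith)
  -- A bound for the error that is the same for all `y`; as `m` has mass one, its power bounds the
  -- integral of order `p'`.
  let D : ℂ → ℝ := fun z =>
    ∫ ω, ‖damp (‖b ω‖ ^ 2) z - damp (‖b ω‖ ^ 2) (-(Complex.I * (q : ℂ)))‖ ∂μ
  have hD : Tendsto (fun z => ENNReal.ofReal (D z) ^ (p / (p - 1)))
      (𝓝[Cplus] (-(Complex.I * (q : ℂ)))) (𝓝 0) := by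
    have h1 := tendsto_integral_norm_damp_sub (μ := μ) hB (fun _ => sq_nonneg _) hq0 hq1
    have h2 := (ENNReal.continuous_rpow_const (y := p / (p - 1))).tendsto 0 |>.comp
      (ENNReal.ofReal_zero ▸ (ENNReal.continuous_ofReal.tendsto 0).comp h1)
    rwa [ENNReal.zero_rpow_of_pos hpp] at h2
  refine tendsto_of_tendsto_of_tendsto_of_le_of_le' tendsto_const_nhds hD
    (Eventually.of_forall fun _ => zero_le) ?_
  filter_upwards [self_mem_nhdsWithin] with z hz
  refine (lintegral_mono fun y => ?_).trans (b := ∫⁻ _, ENNReal.ofReal (D z) ^ (p / (p - 1)) ∂m)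
    (by rw [lintegral_const, measure_univ, mul_one])
  refine ENNReal.rpow_le_rpow ?_ hpp.le
  rw [← ofReal_norm]
  exact ENNReal.ofReal_le_ofReal (norm_integral_damp_sub_le (measurable_mul_expI hT hφ hΘ ha _)
    (norm_mul_expI_le hΘ1 _) hB (fun _ => sq_nonneg _) (le_of_lt hz) hq1)

theorem exists_seq_tendsto_Cplus {z₀ : ℂ} (hz₀ : 0 ≤ z₀.re) :
    ∃ z : ℕ → ℂ, (∀ n, z n ∈ Cplus) ∧ Tendsto z atTop (𝓝[Cplus] z₀) := by
  have h0 := neBot_nhdsWithin_Cplus hz₀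
  have h1 : z₀ ∈ closure Cplus := mem_closure_iff_nhdsWithin_neBot.2 h0
  obtain ⟨z, hz, hz'⟩ := mem_closure_iff_seq_limit.1 h1
  exact ⟨z, hz, tendsto_nhdsWithin_iff.2 ⟨hz', Eventually.of_forall hz⟩⟩

/-- The GFFT is unique up to s-a.e. equality. -/
theorem IsGFFT.ae_eq_feyn (hT : 0 < T) (hm : IsWienerMeasure m) (hφ : IsBVBasis T φ)
    (hΘ : Measurable Θ) (hΘ1 : ∀ ω, ‖Θ ω‖ ≤ 1) (ha : Measurable a) (hb : Measurable b)
    {h : ℝ → ℝ} {F : C0 T → ℂ}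
    (hF : ∀ Z, IsGaussProc m φ h Z → IsFourierRep m φ μ Θ a b fun y r x => F (y + r • Z x))
    {p q : ℝ} (hp : 1 ≤ p) (hq : q ≠ 0) {Φ : C0 T → ℂ} (hΦ : IsGFFT m φ p q h F Φ) :
    SAE m fun y => Φ y = feyn φ μ Θ a b y (-(Complex.I * (q : ℂ))) := by
  -- The given transform comes with its own version `Z` of the process, which is why the
  -- representation is assumed for every version.
  obtain ⟨hΦm, J, ⟨⟨Z, hZ, hJ⟩, -⟩, h1, h2⟩ := hΦ
  have hW := (hF Z hZ).isAnalyticWiener hT hm hφ hΘ hΘ1 ha hb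
  have hq0 := neg_I_mul_ne_zero hq
  have hq1 : 0 ≤ (-(Complex.I * (q : ℂ))).re := (neg_I_mul_re q).ge
  have hne := neBot_nhdsWithin_Cplus hq1
  have hEq : SAE m fun y => EqOn (J y) (feyn φ μ Θ a b y) Cplus := fun ρ hρ => by
    filter_upwards [hJ ρ hρ, hW ρ hρ] with y hy1 hy2 using hy1.eqOn hy2
  intro ρ hρ
  rcases hp.eq_or_lt with hp1 | hp1
  · filter_upwards [h1 hp1.symm ρ hρ, hEq ρ hρ] with y hy1 hy2
    refine tendsto_nhds_unique (hy1.congr' ?_) (tendsto_feyn hT hφ hΘ hΘ1 ha hb _ hq0 hq1)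
    filter_upwards [self_mem_nhdsWithin] with z hz using hy2 hz
  · have hpp : 0 < p / (p - 1) := div_pos (by linarith) (by linarith)
    -- For `p > 1` the given limit is one in mean, while `feyn` converges at every `y`. Fatou's
    -- lemma along a sequence shows that the two limits agree.
    obtain ⟨z, hz, hz'⟩ := exists_seq_tendsto_Cplus hq1
    have hlim := (h2 hp1 ρ hρ).comp hz'
    let g : ℕ → C0 T → ℝ≥0∞ := fun n y =>
      ‖feyn φ μ Θ a b (ρ • y) (z n) - Φ (ρ • y)‖ₑ ^ (p / (p - 1))
    have hmz : ∀ w : ℂ, AEMeasurable (fun y : C0 T => ‖feyn φ μ Θ a b (ρ • y) w - Φ (ρ • y)‖ₑ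
        ^ (p / (p - 1))) m := fun w =>
      ((scaleMeasurable_of_measurable (measurable_feyn hT hφ hΘ ha hb w) ρ hρ).sub
        (hΦm ρ hρ)).enorm.pow_const _
    have hg : Tendsto (fun n => ∫⁻ y, g n y ∂m) atTop (𝓝 0) := by
      refine hlim.congr fun n => lintegral_congr_ae ?_
      filter_upwards [hEq ρ hρ] with y hy
      simp only [g]
      rw [hy (hz n)]
    have hgy : ∀ y, Tendsto (fun n => g n y) atTop
        (𝓝 (‖feyn φ μ Θ a b (ρ • y) (-(Complex.I * (q : ℂ))) - Φ (ρ • y)‖ₑ ^ (p / (p - 1)))) := by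
      intro y
      have h3 := (tendsto_feyn (μ := μ) hT hφ hΘ hΘ1 ha hb (ρ • y) hq0 hq1).comp hz'
      exact ((ENNReal.continuous_rpow_const.comp continuous_enorm).tendsto _).comp
        (h3.sub_const (Φ (ρ • y)))
    have hF0 : ∫⁻ y, ‖feyn φ μ Θ a b (ρ • y) (-(Complex.I * (q : ℂ))) - Φ (ρ • y)‖ₑ
        ^ (p / (p - 1)) ∂m = 0 := by
      refine le_antisymm ?_ zero_le
      calc _ = ∫⁻ y, liminf (fun n => g n y) atTop ∂m :=
            lintegral_congr fun y => (hgy y).liminf_eq.symm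
        _ ≤ liminf (fun n => ∫⁻ y, g n y ∂m) atTop := lintegral_liminf_le' fun n => hmz (z n)
        _ = 0 := hg.liminf_eq
    rw [lintegral_eq_zero_iff' (hmz _)] at hF0
    filter_upwards [hF0] with y hy
    have h3 := (ENNReal.rpow_eq_zero_iff_of_pos hpp).1 hy
    exact (sub_eq_zero.1 (enorm_eq_zero.1 h3)).symm

end Core

variable {T : ℝ} {m : Measure (C0 T)} {φ : ℕ → ℝ → ℝ}

/-! ### Fourier representations of Fresnel functionals -/

theorem ae_ae_hasPWZ_comp {Ω : Type*} [MeasurableSpace Ω] {μ : Measure Ω} [IsFiniteMeasure μ]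
    {a : Ω → L2 T} (hT : 0 < T) (hm : IsWienerMeasure m) (hφ : IsBVBasis T φ) (ha : Measurable a) :
    ∀ᵐ x ∂m, ∀ᵐ ω ∂μ, HasPWZ φ (a ω) x (pw φ (a ω) x) := by
  filter_upwards [ae_ae_hasPWZ hT hm hφ (μ.map a)] with x hx
  exact ae_of_ae_map ha.aemeasurable hx

theorem sae_ae_hasPWZ (hT : 0 < T) (hm : IsWienerMeasure m) (hφ : IsBVBasis T φ)
    (μ : Measure (L2 T)) [IsFiniteMeasure μ] :
    SAE m fun y => ∀ᵐ u : L2 T ∂μ, HasPWZ φ u y (pw φ u y) := by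
  intro ρ _
  filter_upwards [ae_ae_hasPWZ hT hm hφ μ] with y hy
  filter_upwards [hy] with u hu
  have h1 := hasPWZ_path_smul hT hφ ρ hu
  rwa [h1.pw_eq]

section Reps

set_option linter.unusedSectionVars false

variable {μ ν : Measure (L2 T)} [IsFiniteMeasure μ] [IsFiniteMeasure ν] {θ ϑ : L2 T → ℂ}
  {F G : C0 T → ℂ}

/-- For almost all `y` and `x` the integral `⟨u, y + r Z x⟩` exists for almost every `u` and equals
`⟨u,y⟩ + r⟨hu,x⟩`. So the Fresnel formula is available at the shifted path and the character splits.
-/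
theorem IsFresnel.isFourierRep (hT : 0 < T) (hm : IsWienerMeasure m) (hφ : IsBVBasis T φ)
    (hF : IsFresnel φ μ θ F) {h : ℝ → ℝ} (hh : MemLp h ⊤ (leb T)) {Z : C0 T → C0 T}
    (hZ : IsGaussProc m φ h Z) :
    IsFourierRep m φ μ θ (fun u => u) (fun u => mulOp hh u) fun y r x => F (y + r • Z x) := by
  intro ρ hρ
  filter_upwards [sae_ae_hasPWZ hT hm hφ μ ρ hρ] with y hy r _
  filter_upwards [ae_ae_hasPWZ_gaussProc hT hm hφ hh hZ μ] with x hx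
  have h1 : ∀ᵐ u : L2 T ∂μ, HasPWZ φ u (ρ • y + r • Z x)
      (pw φ u (ρ • y) + r * pw φ (mulOp hh u) x) := by
    filter_upwards [hy, hx] with u hu hu'
    exact hasPWZ_path_add hT hφ hu (hasPWZ_path_smul hT hφ r hu')
  rw [hF _ (h1.mono fun u hu => ⟨_, hu⟩)]
  refine integral_congr_ae ?_
  filter_upwards [h1] with u hu
  rw [hu.pw_eq, expI_add]
  ring

/-- Both processes are driven by the same `x`, so the product is one Fourier integral over `μ × ν`.
The sign `ε = 1` serves the transform of a product and `ε = -1` the convolution product. -/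
theorem isFourierRep_mul (hT : 0 < T) (hm : IsWienerMeasure m) (hφ : IsBVBasis T φ)
    (hF : IsFresnel φ μ θ F) (hG : IsFresnel φ ν ϑ G) (c ε : ℝ) (A₁ A₂ : L2 T →L[ℝ] L2 T)
    {Z₁ Z₂ : C0 T → C0 T} (hZ₁ : ∀ᵐ x ∂m, ∀ᵐ u : L2 T ∂μ, HasPWZ φ u (Z₁ x) (pw φ (A₁ u) x))
    (hZ₂ : ∀ᵐ x ∂m, ∀ᵐ u : L2 T ∂ν, HasPWZ φ u (Z₂ x) (pw φ (A₂ u) x)) :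
    IsFourierRep m φ (μ.prod ν) (fun w => θ w.1 * ϑ w.2) (fun w => c • (w.1 + w.2))
      (fun w => c • (A₁ w.1 + ε • A₂ w.2))
      fun y r x => F (c • (y + r • Z₁ x)) * G (c • (y + (ε * r) • Z₂ x)) := by
  intro ρ hρ
  filter_upwards [sae_ae_hasPWZ hT hm hφ μ ρ hρ, sae_ae_hasPWZ hT hm hφ ν ρ hρ] with y hy₁ hy₂ r _
  filter_upwards [hZ₁, hZ₂, ae_ae_hasPWZ_comp (μ := μ) hT hm hφ A₁.continuous.measurable,
    ae_ae_hasPWZ_comp (μ := ν) hT hm hφ A₂.continuous.measurable] with x hx₁ hx₂ ha₁ ha₂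
  have h1 : ∀ᵐ u : L2 T ∂μ, HasPWZ φ u (c • (ρ • y + r • Z₁ x))
      (c * (pw φ u (ρ • y) + r * pw φ (A₁ u) x)) := by
    filter_upwards [hy₁, hx₁] with u hu hu'
    exact hasPWZ_path_smul hT hφ c (hasPWZ_path_add hT hφ hu (hasPWZ_path_smul hT hφ r hu'))
  have h2 : ∀ᵐ u : L2 T ∂ν, HasPWZ φ u (c • (ρ • y + (ε * r) • Z₂ x))
      (c * (pw φ u (ρ • y) + (ε * r) * pw φ (A₂ u) x)) := by
    filter_upwards [hy₂, hx₂] with u hu hu'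
    exact hasPWZ_path_smul hT hφ c (hasPWZ_path_add hT hφ hu (hasPWZ_path_smul hT hφ _ hu'))
  rw [hF _ (h1.mono fun u hu => ⟨_, hu⟩), hG _ (h2.mono fun u hu => ⟨_, hu⟩), ← integral_prod_mul]
  refine integral_congr_ae ?_
  have q₁ : Measure.QuasiMeasurePreserving (Prod.fst : L2 T × L2 T → L2 T) (μ.prod ν) μ :=
    Measure.quasiMeasurePreserving_fst
  have q₂ : Measure.QuasiMeasurePreserving (Prod.snd : L2 T × L2 T → L2 T) (μ.prod ν) ν :=
    Measure.quasiMeasurePreserving_snd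
  filter_upwards [q₁.ae h1, q₂.ae h2, q₁.ae hy₁, q₂.ae hy₂, q₁.ae ha₁, q₂.ae ha₂]
    with w w1 w2 w3 w4 w5 w6
  have e1 := (hasPWZ_smul hT hφ c (hasPWZ_add hT hφ w3 w4)).pw_eq
  have e2 := (hasPWZ_smul hT hφ c (hasPWZ_add hT hφ w5 (hasPWZ_smul hT hφ ε w6))).pw_eq
  rw [w1.pw_eq, w2.pw_eq, e1, e2]
  have e3 : ∀ s t s' t' : ℝ, s + t = s' + t' → expI s * θ w.1 * (expI t * ϑ w.2)
      = θ w.1 * ϑ w.2 * expI s' * expI t' := fun s t s' t' hst => by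
    have h3 : expI s * expI t = expI s' * expI t' := by rw [← expI_add, hst, expI_add]
    linear_combination (θ w.1 * ϑ w.2) * h3
  exact e3 _ _ _ _ (by ring)

/-! ### Transforms of Fresnel functionals -/

/-- The energy `∫ (g u)² dt`. -/
def energy (g : ℝ → ℝ) (u : L2 T) : ℝ := ∫ t, (g t * u t) ^ 2 ∂(leb T)

theorem norm_sq_mulOp {g : ℝ → ℝ} (hg : MemLp g ⊤ (leb T)) (u : L2 T) :
    ‖mulOp hg u‖ ^ 2 = energy g u := by
  rw [norm_sq_eq_integral, energy]
  refine integral_congr_ae ?_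
  filter_upwards [coeFn_mulOp hg u] with t ht
  rw [ht, sq]

theorem measurable_energy {g : ℝ → ℝ} (hg : MemLp g ⊤ (leb T)) :
    Measurable fun u : L2 T => energy g u := by
  simp only [← norm_sq_mulOp hg]
  exact ((mulOp hg).continuous.norm.pow 2).measurable

theorem integrable_sq_mul {g : ℝ → ℝ} (hg : MemLp g ⊤ (leb T)) (u : L2 T) :
    Integrable (fun t => (g t * u t) ^ 2) (leb T) := by
  refine (Lp.memLp (mulOp hg u)).integrable_sq.congr ?_
  filter_upwards [coeFn_mulOp hg u] with t ht
  rw [ht]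

/-- The multiplier of a complex measure which corresponds to the GFFT. -/
def transformed (q : ℝ) (θ : L2 T → ℂ) (e : L2 T → ℝ) (u : L2 T) : ℂ :=
  θ u * damp (e u) (-(Complex.I * (q : ℂ)))

theorem measurable_transformed (q : ℝ) (hθm : Measurable θ) {e : L2 T → ℝ} (he : Measurable e) :
    Measurable (transformed q θ e) :=
  hθm.mul ((measurable_damp _).comp he)

/-- At the imaginary point `-iq` the damping factor is a pure phase; the transform therefore has a
polar form with the same `μ`. -/
theorem norm_transformed (q : ℝ) (hθ : ∀ u, ‖θ u‖ = 1) (e : L2 T → ℝ) (u : L2 T) :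
    ‖transformed q θ e u‖ = 1 := by
  rw [transformed, norm_mul, hθ, norm_damp_eq_one _ (neg_I_mul_re q), mul_one]

theorem feyn_eq_transformed {g : ℝ → ℝ} (hg : MemLp g ⊤ (leb T)) (q : ℝ) (y : C0 T) :
    feyn φ μ θ (fun u => u) (fun u => mulOp hg u) y (-(Complex.I * (q : ℂ)))
      = ∫ u, expI (pw φ u y) * transformed q θ (energy g) u ∂μ := by
  unfold feyn transformed
  congr 1
  funext u
  rw [norm_sq_mulOp]
  ring

theorem exists_isGFFTInS (hT : 0 < T) (hm : IsWienerMeasure m) (hφ : IsBVBasis T φ)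
    (hθm : Measurable θ) (hθ : ∀ u, ‖θ u‖ = 1) (hF : IsFresnel φ μ θ F) {g : ℝ → ℝ}
    (hg : MemLp g ⊤ (leb T)) (p : ℝ) {q : ℝ} (hq : q ≠ 0) :
    ∃ Φ, IsGFFTInS m φ p q g F Φ ∧ IsFresnel φ μ (transformed q θ (energy g)) Φ := by
  have h1 : IsFresnel φ μ (transformed q θ (energy g)) fun y =>
      feyn φ μ θ (fun u => u) (fun u => mulOp hg u) y (-(Complex.I * (q : ℂ))) :=
    fun y _ => feyn_eq_transformed hg q y
  refine ⟨_, ⟨⟨_, (isFresnelOf_iff hT hφ (measurable_transformed q hθm (measurable_energy hg))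
    (norm_transformed q hθ _) _).2 h1⟩, ?_⟩, h1⟩
  exact isGFFT_feyn hT hm hφ hθm (fun u => (hθ u).le) measurable_id
    (mulOp hg).continuous.measurable hg (fun Z hZ => hF.isFourierRep hT hm hφ hg hZ) hq

/-- The given version has some representing measure of its own. Its functional agrees with the
explicit transform almost everywhere, so the measures coincide, and the formula holds at every path
where it is meaningful. This strengthening of almost sure equality allows a further transform or a
convolution to be taken. -/
theorem IsGFFTInS.isFresnel (hT : 0 < T) (hm : IsWienerMeasure m) (hφ : IsBVBasis T φ)
    (hθm : Measurable θ) (hθ : ∀ u, ‖θ u‖ = 1) (hF : IsFresnel φ μ θ F) {g : ℝ → ℝ}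
    (hg : MemLp g ⊤ (leb T)) {p q : ℝ} (hp : 1 ≤ p) (hq : q ≠ 0) {Φ : C0 T → ℂ}
    (hΦ : IsGFFTInS m φ p q g F Φ) : IsFresnel φ μ (transformed q θ (energy g)) Φ := by
  obtain ⟨hS, hΦ⟩ := hΦ
  obtain ⟨μ', θ', hfin, hθm', hθ', hΦ'⟩ := exists_isFresnel hT hφ hS
  have hm1 := measurable_transformed q hθm (measurable_energy hg)
  have hm2 := norm_transformed q hθ (energy g)
  have h1 := hΦ.ae_eq_feyn hT hm hφ hθm (fun u => (hθ u).le) measurable_id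
    (mulOp hg).continuous.measurable (fun Z hZ => hF.isFourierRep hT hm hφ hg hZ) hp hq
  have h2 := withDensity_eq_of_fresnel_eq hT hm hφ hθm' hθ' hm1 hm2 (by
    filter_upwards [h1 1 one_pos, sae_ae_hasPWZ hT hm hφ μ' 1 one_pos] with y hy1 hy2
    rw [one_smul] at hy1 hy2
    rw [← hΦ' y (hy2.mono fun u hu => ⟨_, hu⟩), hy1]
    exact feyn_eq_transformed hg q y)
  rw [← isFresnelOf_iff hT hφ hm1 hm2, ← h2, isFresnelOf_iff hT hφ hθm' hθ']
  exact hΦ'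

theorem transformed_transformed (q : ℝ) (θ : L2 T → ℂ) (e e' : L2 T → ℝ) :
    transformed q (transformed q θ e) e' = transformed q θ fun u => e u + e' u := by
  funext u
  simp only [transformed, damp_add, mul_assoc]

theorem IsIteratedGFFT.isFresnel (hT : 0 < T) (hm : IsWienerMeasure m) (hφ : IsBVBasis T φ)
    {p q : ℝ} (hp : 1 ≤ p) (hq : q ≠ 0) {l : List (ℝ → ℝ)} (hl : ∀ g ∈ l, MemLp g ⊤ (leb T))
    (hθm : Measurable θ) (hθ : ∀ u, ‖θ u‖ = 1) (hF : IsFresnel φ μ θ F) {Φ : C0 T → ℂ}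
    (hΦ : IsIteratedGFFT m φ p q l F Φ) :
    IsFresnel φ μ (transformed q θ fun u => (l.map fun g => energy g u).sum) Φ := by
  induction l generalizing θ F with
  | nil =>
    have e : transformed q θ (fun u => (([] : List (ℝ → ℝ)).map fun g => energy g u).sum) = θ := by
      funext u
      simp [transformed, damp_zero]
    rw [e, show Φ = F from hΦ]
    exact hF
  | cons g l ih =>
    obtain ⟨F₁, h1, h2⟩ := hΦ
    have hg := hl g List.mem_cons_self
    have h3 := ih (fun g hg => hl g (List.mem_cons_of_mem _ hg))
      (measurable_transformed q hθm (measurable_energy hg)) (norm_transformed q hθ _)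
      (h1.isFresnel hT hm hφ hθm hθ hF hg hp hq) h2
    rw [transformed_transformed] at h3
    simpa only [List.map_cons, List.sum_cons] using h3

theorem exists_isIteratedGFFT (hT : 0 < T) (hm : IsWienerMeasure m) (hφ : IsBVBasis T φ)
    (p : ℝ) {q : ℝ} (hq : q ≠ 0) {l : List (ℝ → ℝ)} (hl : ∀ g ∈ l, MemLp g ⊤ (leb T))
    (hθm : Measurable θ) (hθ : ∀ u, ‖θ u‖ = 1) (hF : IsFresnel φ μ θ F) :
    ∃ Φ, IsIteratedGFFT m φ p q l F Φ := by
  induction l generalizing θ F with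
  | nil => exact ⟨F, rfl⟩
  | cons g l ih =>
    have hg := hl g List.mem_cons_self
    obtain ⟨F₁, h1, h2⟩ := exists_isGFFTInS hT hm hφ hθm hθ hF hg p hq
    obtain ⟨Φ, hΦ⟩ := ih (fun g hg => hl g (List.mem_cons_of_mem _ hg))
      (measurable_transformed q hθm (measurable_energy hg)) (norm_transformed q hθ _) h2
    exact ⟨Φ, F₁, h1, hΦ⟩

end Reps

variable {T : ℝ} {m : Measure (C0 T)} {φ : ℕ → ℝ → ℝ}

/-! ### Energy identities -/

theorem energy_divSqrtTwo (g : ℝ → ℝ) (u : L2 T) : energy (divSqrtTwo g) u = energy g u / 2 := by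
  unfold energy
  rw [← integral_div]
  congr 1
  funext t
  rw [divSqrtTwo, div_mul_eq_mul_div, div_pow, Real.sq_sqrt zero_le_two]

theorem memLp_divSqrtTwo {g : ℝ → ℝ} (hg : MemLp g ⊤ (leb T)) :
    MemLp (divSqrtTwo g) ⊤ (leb T) := by
  have e : divSqrtTwo g = fun t => (Real.sqrt 2)⁻¹ * g t := by
    funext t
    rw [divSqrtTwo, div_eq_inv_mul]
  rw [e]
  exact hg.const_mul _

theorem energy_eq_sum {ι : Type*} [Fintype ι] {h : ι → ℝ → ℝ} (hh : ∀ j, MemLp (h j) ⊤ (leb T))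
    {s : ℝ → ℝ} (hs : ∀ᵐ t ∂(leb T), s t ^ 2 = ∑ j, h j t ^ 2) (u : L2 T) :
    energy s u = ∑ j, energy (h j) u := by
  unfold energy
  rw [← integral_finsetSum _ fun j _ => integrable_sq_mul (hh j) u]
  refine integral_congr_ae ?_
  filter_upwards [hs] with t ht
  rw [mul_pow, ht, Finset.sum_mul]
  exact Finset.sum_congr rfl fun j _ => (mul_pow _ _ _).symm

theorem energy_eq_add {s k s' : ℝ → ℝ} (hs : MemLp s ⊤ (leb T)) (hk : MemLp k ⊤ (leb T))
    (h : ∀ᵐ t ∂(leb T), s' t ^ 2 = s t ^ 2 + k t ^ 2) (u : L2 T) :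
    energy s' u = energy s u + energy k u := by
  unfold energy
  rw [← integral_add (integrable_sq_mul hs u) (integrable_sq_mul hk u)]
  refine integral_congr_ae ?_
  filter_upwards [h] with t ht
  rw [mul_pow, ht]
  ring

/-- The only use of `s² = k₁k₂`: it makes the cross term of the convolution product that of the
transform with kernel `s`. -/
theorem inner_mulOp_eq {s k₁ k₂ : ℝ → ℝ} (hs : MemLp s ⊤ (leb T)) (hk₁ : MemLp k₁ ⊤ (leb T))
    (hk₂ : MemLp k₂ ⊤ (leb T)) (h : ∀ᵐ t ∂(leb T), s t ^ 2 = k₁ t * k₂ t) (u v : L2 T) :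
    ⟪mulOp hk₁ u, mulOp hk₂ v⟫_ℝ = ⟪mulOp hs u, mulOp hs v⟫_ℝ := by
  rw [L2.inner_def, L2.inner_def]
  refine integral_congr_ae ?_
  filter_upwards [coeFn_mulOp hk₁ u, coeFn_mulOp hk₂ v, coeFn_mulOp hs u, coeFn_mulOp hs v, h]
    with t h1 h2 h3 h4 h5
  rw [h1, h2, h3, h4]
  simp only [RCLike.inner_apply, conj_trivial]
  linear_combination (-(u t * v t)) * h5

/-- Expanding the square cancels the energies of `k₁` and `k₂`. The energies of `s` and the cross
term remain, and they form a complete square. -/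
theorem energy_add_sub_norm_sq {s k₁ k₂ : ℝ → ℝ} (hs : MemLp s ⊤ (leb T))
    (hk₁ : MemLp k₁ ⊤ (leb T)) (hk₂ : MemLp k₂ ⊤ (leb T))
    (h : ∀ᵐ t ∂(leb T), s t ^ 2 = k₁ t * k₂ t) (u v : L2 T) :
    (energy s u + energy k₁ u) / 2 + (energy s v + energy k₂ v) / 2
      - ‖(Real.sqrt 2)⁻¹ • (mulOp hk₁ u + (-1 : ℝ) • mulOp hk₂ v)‖ ^ 2
      = ‖(Real.sqrt 2)⁻¹ • (mulOp hs u + (1 : ℝ) • mulOp hs v)‖ ^ 2 := by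
  rw [norm_smul, norm_smul, mul_pow, mul_pow, norm_inv, inv_pow, Real.norm_eq_abs, sq_abs,
    Real.sq_sqrt zero_le_two, one_smul, neg_one_smul, ← sub_eq_add_neg, norm_sub_sq_real,
    norm_add_sq_real, inner_mulOp_eq hs hk₁ hk₂ h, norm_sq_mulOp, norm_sq_mulOp, norm_sq_mulOp,
    norm_sq_mulOp]
  ring

/-- Changing `q` to `-q` reverses the sign of an energy, so the convolution undoes part of the
transforms. -/
theorem damp_neg_right (t : ℝ) (z : ℂ) : damp t (-z) = damp (-t) z := by
  unfold damp
  congr 1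
  rw [Complex.ofReal_neg, neg_neg, mul_neg, neg_div_neg_eq]

/-! ### Convolution products of transforms -/

theorem measurable_smul_clm_add {E : Type*} [NormedAddCommGroup E] [NormedSpace ℝ E]
    [MeasurableSpace E] [BorelSpace E] [SecondCountableTopology E] (c ε : ℝ) (A₁ A₂ : E →L[ℝ] E) :
    Measurable fun w : E × E => c • (A₁ w.1 + ε • A₂ w.2) :=
  Continuous.measurable (by fun_prop)

section Product

variable {μ ν : Measure (L2 T)} [IsFiniteMeasure μ] [IsFiniteMeasure ν] {θ ϑ : L2 T → ℂ}
  {F G : C0 T → ℂ}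

/-- The product functional and the Gaussian process of `s`. -/
theorem isFourierRep_product (hT : 0 < T) (hm : IsWienerMeasure m) (hφ : IsBVBasis T φ)
    (hF : IsFresnel φ μ θ F) (hG : IsFresnel φ ν ϑ G) {s : ℝ → ℝ} (hs : MemLp s ⊤ (leb T))
    {Z : C0 T → C0 T} (hZ : IsGaussProc m φ s Z) :
    IsFourierRep m φ (μ.prod ν) (fun w => θ w.1 * ϑ w.2)
      (fun w => (Real.sqrt 2)⁻¹ • (w.1 + w.2))
      (fun w => (Real.sqrt 2)⁻¹ • (mulOp hs w.1 + (1 : ℝ) • mulOp hs w.2))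
      fun y r x => F ((Real.sqrt 2)⁻¹ • (y + r • Z x)) * G ((Real.sqrt 2)⁻¹ • (y + r • Z x)) := by
  have h1 := isFourierRep_mul hT hm hφ hF hG (Real.sqrt 2)⁻¹ 1 (mulOp hs) (mulOp hs)
    (ae_ae_hasPWZ_gaussProc hT hm hφ hs hZ μ) (ae_ae_hasPWZ_gaussProc hT hm hφ hs hZ ν)
  simpa only [one_mul] using h1

theorem measurable_smul_add_smul (c ε : ℝ) (A₁ A₂ : L2 T →L[ℝ] L2 T) :
    Measurable fun w : L2 T × L2 T => c • (A₁ w.1 + ε • A₂ w.2) := by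
  have := secondCountable_L2 T
  exact measurable_smul_clm_add c ε A₁ A₂

theorem measurable_smul_add (c : ℝ) : Measurable fun w : L2 T × L2 T => c • (w.1 + w.2) := by
  have h1 := measurable_smul_add_smul c 1 (ContinuousLinearMap.id ℝ (L2 T))
    (ContinuousLinearMap.id ℝ (L2 T))
  simpa only [one_smul, ContinuousLinearMap.id_apply] using h1

theorem measurable_mul_prod (hθm : Measurable θ) (hϑm : Measurable ϑ) :
    Measurable fun w : L2 T × L2 T => θ w.1 * ϑ w.2 :=
  (hθm.comp measurable_fst).mul (hϑm.comp measurable_snd)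

theorem norm_mul_prod_le (hθ : ∀ u, ‖θ u‖ = 1) (hϑ : ∀ u, ‖ϑ u‖ = 1) (w : L2 T × L2 T) :
    ‖θ w.1 * ϑ w.2‖ ≤ 1 := by
  rw [norm_mul, hθ, hϑ, one_mul]

theorem exists_isGFFT_product (hT : 0 < T) (hm : IsWienerMeasure m) (hφ : IsBVBasis T φ)
    (hθm : Measurable θ) (hθ : ∀ u, ‖θ u‖ = 1) (hϑm : Measurable ϑ) (hϑ : ∀ u, ‖ϑ u‖ = 1)
    (hF : IsFresnel φ μ θ F) (hG : IsFresnel φ ν ϑ G) {s : ℝ → ℝ} (hs : MemLp s ⊤ (leb T))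
    (p : ℝ) {q : ℝ} (hq : q ≠ 0) :
    ∃ E, IsGFFT m φ p q s (fun x => F ((Real.sqrt 2)⁻¹ • x) * G ((Real.sqrt 2)⁻¹ • x)) E := by
  have hfin : IsFiniteMeasure (μ.prod ν) := inferInstance
  have h1 := measurable_mul_prod hθm hϑm
  have h2 := norm_mul_prod_le hθ hϑ
  have h3 := measurable_smul_add (T := T) (Real.sqrt 2)⁻¹
  have h4 := measurable_smul_add_smul (Real.sqrt 2)⁻¹ 1 (mulOp hs) (mulOp hs)
  have h5 := fun Z (hZ : IsGaussProc m φ s Z) => isFourierRep_product hT hm hφ hF hG hs hZ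
  have h6 := isGFFT_feyn (μ := μ.prod ν) hT hm hφ h1 h2 h3 h4 hs
    (F := fun x => F ((Real.sqrt 2)⁻¹ • x) * G ((Real.sqrt 2)⁻¹ • x)) h5 (p := p) hq
  exact ⟨_, h6⟩

/-- The convolution product of two transforms is the transform of the product. -/
theorem isGCP_of_isFresnel_transformed (hT : 0 < T) (hm : IsWienerMeasure m) (hφ : IsBVBasis T φ)
    (hθm : Measurable θ) (hθ : ∀ u, ‖θ u‖ = 1) (hϑm : Measurable ϑ) (hϑ : ∀ u, ‖ϑ u‖ = 1)
    (hF : IsFresnel φ μ θ F) (hG : IsFresnel φ ν ϑ G) {s k₁ k₂ : ℝ → ℝ} (hs : MemLp s ⊤ (leb T))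
    (hk₁ : MemLp k₁ ⊤ (leb T)) (hk₂ : MemLp k₂ ⊤ (leb T))
    (hsk : ∀ᵐ t ∂(leb T), s t ^ 2 = k₁ t * k₂ t) {p q : ℝ} (hp : 1 ≤ p) (hq : q ≠ 0)
    {A B E : C0 T → ℂ}
    (hA : IsFresnel φ μ (transformed q θ fun u => (energy s u + energy k₁ u) / 2) A)
    (hB : IsFresnel φ ν (transformed q ϑ fun u => (energy s u + energy k₂ u) / 2) B)
    (hE : IsGFFT m φ p q s (fun x => F ((Real.sqrt 2)⁻¹ • x) * G ((Real.sqrt 2)⁻¹ • x)) E) :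
    IsGCP m φ (-q) k₁ k₂ A B E := by
  obtain ⟨Z₁, hZ₁⟩ := exists_isGaussProc hT hm hφ hk₁
  obtain ⟨Z₂, hZ₂⟩ := exists_isGaussProc hT hm hφ hk₂
  refine ⟨Z₁, Z₂, hZ₁, hZ₂, ?_⟩
  obtain ⟨c, hc⟩ : ∃ c, c = (Real.sqrt 2)⁻¹ := ⟨_, rfl⟩
  rw [← hc] at hE ⊢
  obtain ⟨θ', hθ'⟩ : ∃ θ', θ' = transformed q θ fun u => (energy s u + energy k₁ u) / 2 := ⟨_, rfl⟩
  obtain ⟨ϑ', hϑ'⟩ : ∃ ϑ', ϑ' = transformed q ϑ fun u => (energy s u + energy k₂ u) / 2 := ⟨_, rfl⟩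
  rw [← hθ'] at hA
  rw [← hϑ'] at hB
  have hθm' : Measurable θ' := hθ' ▸ measurable_transformed q hθm
    (((measurable_energy hs).add (measurable_energy hk₁)).div_const 2)
  have hϑm' : Measurable ϑ' := hϑ' ▸ measurable_transformed q hϑm
    (((measurable_energy hs).add (measurable_energy hk₂)).div_const 2)
  have hθ1' : ∀ u, ‖θ' u‖ = 1 := hθ' ▸ norm_transformed q hθ _
  have hϑ1' : ∀ u, ‖ϑ' u‖ = 1 := hϑ' ▸ norm_transformed q hϑ _
  have hfin : IsFiniteMeasure (μ.prod ν) := inferInstance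
  have hΘ := measurable_mul_prod hθm' hϑm'
  have hΘ1 := norm_mul_prod_le hθ1' hϑ1'
  have ha := measurable_smul_add (T := T) c
  have hb := measurable_smul_add_smul c (-1) (mulOp hk₁) (mulOp hk₂)
  have hbE := measurable_smul_add_smul c 1 (mulOp hs) (mulOp hs)
  have hFG := fun Z (hZ : IsGaussProc m φ s Z) => isFourierRep_product hT hm hφ hF hG hs hZ
  rw [← hc] at hFG
  have hΘE := measurable_mul_prod hθm hϑm
  have hΘE1 := norm_mul_prod_le hθ hϑ
  have h1 := IsGFFT.ae_eq_feyn (μ := μ.prod ν) hT hm hφ hΘE hΘE1 ha hbE hFG hp hq hE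
  have hAB := isFourierRep_mul hT hm hφ hA hB c (-1) (mulOp hk₁) (mulOp hk₂)
    (ae_ae_hasPWZ_gaussProc hT hm hφ hk₁ hZ₁ μ) (ae_ae_hasPWZ_gaussProc hT hm hφ hk₂ hZ₂ ν)
  have h2 := hAB.isAnalyticWiener hT hm hφ hΘ hΘ1 ha hb
  -- The integrands agree pointwise in `(u,v)`: three phases, two from the transforms at `-iq` and
  -- one from the convolution at `iq`, combine into the phase of kernel `s`.
  have h3 : ∀ y, feyn φ (μ.prod ν) (fun w => θ w.1 * ϑ w.2) (fun w => c • (w.1 + w.2))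
      (fun w => c • (mulOp hs w.1 + (1 : ℝ) • mulOp hs w.2)) y (-(Complex.I * (q : ℂ)))
      = feyn φ (μ.prod ν) (fun w => θ' w.1 * ϑ' w.2) (fun w => c • (w.1 + w.2))
      (fun w => c • (mulOp hk₁ w.1 + (-1 : ℝ) • mulOp hk₂ w.2)) y
      (-(Complex.I * ((-q : ℝ) : ℂ))) := by
    intro y
    unfold feyn
    congr 1
    funext w
    simp only [hθ', hϑ', transformed]
    have e := energy_add_sub_norm_sq hs hk₁ hk₂ hsk w.1 w.2
    rw [← hc] at e
    rw [← e, sub_eq_add_neg, damp_add, damp_add,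
      Complex.ofReal_neg, mul_neg, damp_neg_right _ (-(Complex.I * (q : ℂ)))]
    ring
  intro ρ hρ
  filter_upwards [h1 ρ hρ, h2 ρ hρ] with y hy1 hy2
  have e : (fun (r : ℝ) (x : C0 T) => A (c • (ρ • y + r • Z₁ x)) *
      B (c • (ρ • y + (-1 * r) • Z₂ x))) =
      fun r x => A (c • (ρ • y + r • Z₁ x)) * B (c • (ρ • y - r • Z₂ x)) := by
    funext r x
    have e' : ρ • y + (-1 * r) • Z₂ x = ρ • y - r • Z₂ x := by module
    rw [e']
  rw [e] at hy2
  refine ⟨_, hy2, ?_⟩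
  rw [hy1, h3]
  exact tendsto_feyn (μ := μ.prod ν) hT hφ hΘ hΘ1 ha hb _
    (neg_I_mul_ne_zero (neg_ne_zero.2 hq)) (neg_I_mul_re _).ge

end Product

/-- Dividing each kernel by `√2` halves its energy, and the energies of the `h_j` add up to that of
`s`. The result is also the energy of `s₁/√2` or `s₂/√2` for `k = k₁` or `k = k₂`. -/
theorem sum_energy_list {n : ℕ} {h : Fin n → ℝ → ℝ} (hh : ∀ j, MemLp (h j) ⊤ (leb T))
    {s : ℝ → ℝ} (hs : ∀ᵐ t ∂(leb T), s t ^ 2 = ∑ j, h j t ^ 2) (k : ℝ → ℝ) (u : L2 T) :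
    ((List.ofFn (fun j => divSqrtTwo (h j)) ++ [divSqrtTwo k]).map fun g => energy g u).sum
      = (energy s u + energy k u) / 2 := by
  simp only [List.map_append, List.map_ofFn, List.map_cons, List.map_nil, List.sum_append,
    List.sum_ofFn, List.sum_cons, List.sum_nil, add_zero, Function.comp_def, energy_divSqrtTwo,
    energy_eq_sum hh hs]
  rw [← Finset.sum_div]
  ring

theorem memLp_of_mem_list {n : ℕ} {h : Fin n → ℝ → ℝ} (hh : ∀ j, MemLp (h j) ⊤ (leb T))
    {k : ℝ → ℝ} (hk : MemLp k ⊤ (leb T)) :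
    ∀ g ∈ List.ofFn (fun j => divSqrtTwo (h j)) ++ [divSqrtTwo k], MemLp g ⊤ (leb T) := by
  intro g hg
  rw [List.mem_append, List.mem_ofFn, List.mem_singleton] at hg
  rcases hg with ⟨j, rfl⟩ | rfl
  · exact memLp_divSqrtTwo (hh j)
  · exact memLp_divSqrtTwo hk

end WienerGFFT

end

/-! ### The main theorem -/

theorem theorem5p2 (T : ℝ) (hT : 0 < T)
    (m : Measure (WienerGFFT.C0 T)) (hm : WienerGFFT.IsWienerMeasure m)
    (φ : ℕ → ℝ → ℝ) (hφ : WienerGFFT.IsBVBasis T φ)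
    (F G : WienerGFFT.C0 T → ℂ) (hF : WienerGFFT.InS φ F) (hG : WienerGFFT.InS φ G)
    (n : ℕ) (hn : 0 < n) (h : Fin n → ℝ → ℝ) (hh : ∀ j, WienerGFFT.NonzeroLinfty T (h j))
    (k₁ k₂ : ℝ → ℝ) (hk₁ : WienerGFFT.NonzeroLinfty T k₁) (hk₂ : WienerGFFT.NonzeroLinfty T k₂)
    (s s₁ s₂ : ℝ → ℝ) (hs : MemLp s ⊤ (WienerGFFT.leb T))
    (hs₁ : MemLp s₁ ⊤ (WienerGFFT.leb T)) (hs₂ : MemLp s₂ ⊤ (WienerGFFT.leb T))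
    (hsH : ∀ᵐ t ∂(WienerGFFT.leb T), s t ^ 2 = ∑ j, h j t ^ 2)
    (hsk : ∀ᵐ t ∂(WienerGFFT.leb T), s t ^ 2 = k₁ t * k₂ t)
    (hsH₁ : ∀ᵐ t ∂(WienerGFFT.leb T), s₁ t ^ 2 = (∑ j, h j t ^ 2) + k₁ t ^ 2)
    (hsH₂ : ∀ᵐ t ∂(WienerGFFT.leb T), s₂ t ^ 2 = (∑ j, h j t ^ 2) + k₂ t ^ 2)
    (p : ℝ) (hp₁ : 1 ≤ p) (hp₂ : p ≤ 2) (q : ℝ) (hq : q ≠ 0) :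
    -- all the transforms exist
    (∃ A, WienerGFFT.IsIteratedGFFT m φ p q
      (List.ofFn (fun j => WienerGFFT.divSqrtTwo (h j)) ++ [WienerGFFT.divSqrtTwo k₁]) F A) ∧
    (∃ B, WienerGFFT.IsIteratedGFFT m φ p q
      (List.ofFn (fun j => WienerGFFT.divSqrtTwo (h j)) ++ [WienerGFFT.divSqrtTwo k₂]) G B) ∧
    (∃ C, WienerGFFT.IsGFFTInS m φ p q (WienerGFFT.divSqrtTwo s₁) F C) ∧
    (∃ D, WienerGFFT.IsGFFTInS m φ p q (WienerGFFT.divSqrtTwo s₂) G D) ∧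
    (∃ E, WienerGFFT.IsGFFT m φ p q s
      (fun x => F ((Real.sqrt 2)⁻¹ • x) * G ((Real.sqrt 2)⁻¹ • x)) E) ∧
    -- both convolution products exist and agree s-a.e. with the transform of the product
    ∀ A B C D E : WienerGFFT.C0 T → ℂ,
      WienerGFFT.IsIteratedGFFT m φ p q
        (List.ofFn (fun j => WienerGFFT.divSqrtTwo (h j)) ++ [WienerGFFT.divSqrtTwo k₁]) F A →
      WienerGFFT.IsIteratedGFFT m φ p q
        (List.ofFn (fun j => WienerGFFT.divSqrtTwo (h j)) ++ [WienerGFFT.divSqrtTwo k₂]) G B →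
      WienerGFFT.IsGFFTInS m φ p q (WienerGFFT.divSqrtTwo s₁) F C →
      WienerGFFT.IsGFFTInS m φ p q (WienerGFFT.divSqrtTwo s₂) G D →
      WienerGFFT.IsGFFT m φ p q s
        (fun x => F ((Real.sqrt 2)⁻¹ • x) * G ((Real.sqrt 2)⁻¹ • x)) E →
      WienerGFFT.IsGCP m φ (-q) k₁ k₂ A B E ∧ WienerGFFT.IsGCP m φ (-q) k₁ k₂ C D E := by
  have hh' : ∀ j, MemLp (h j) ⊤ (WienerGFFT.leb T) := fun j => (hh j).1
  have hs₁' : ∀ᵐ t ∂(WienerGFFT.leb T), s₁ t ^ 2 = s t ^ 2 + k₁ t ^ 2 := by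
    filter_upwards [hsH, hsH₁] with t h1 h2
    rw [h1, h2]
  have hs₂' : ∀ᵐ t ∂(WienerGFFT.leb T), s₂ t ^ 2 = s t ^ 2 + k₂ t ^ 2 := by
    filter_upwards [hsH, hsH₂] with t h1 h2
    rw [h1, h2]
  obtain ⟨μ, θ, hμ, hθm, hθ, hF'⟩ := WienerGFFT.exists_isFresnel hT hφ hF
  obtain ⟨ν, ϑ, hν, hϑm, hϑ, hG'⟩ := WienerGFFT.exists_isFresnel hT hφ hG
  have hl₁ := WienerGFFT.memLp_of_mem_list hh' hk₁.1
  have hl₂ := WienerGFFT.memLp_of_mem_list hh' hk₂.1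
  have hd₁ := WienerGFFT.memLp_divSqrtTwo hs₁
  have hd₂ := WienerGFFT.memLp_divSqrtTwo hs₂
  obtain ⟨C₀, hC₀, -⟩ := WienerGFFT.exists_isGFFTInS hT hm hφ hθm hθ hF' hd₁ p hq
  obtain ⟨D₀, hD₀, -⟩ := WienerGFFT.exists_isGFFTInS hT hm hφ hϑm hϑ hG' hd₂ p hq
  refine ⟨WienerGFFT.exists_isIteratedGFFT hT hm hφ p hq hl₁ hθm hθ hF',
    WienerGFFT.exists_isIteratedGFFT hT hm hφ p hq hl₂ hϑm hϑ hG', ⟨C₀, hC₀⟩, ⟨D₀, hD₀⟩,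
    WienerGFFT.exists_isGFFT_product hT hm hφ hθm hθ hϑm hϑ hF' hG' hs p hq, ?_⟩
  intro A B C D E hA hB hC hD hE
  have hA' := hA.isFresnel hT hm hφ hp₁ hq hl₁ hθm hθ hF'
  have hB' := hB.isFresnel hT hm hφ hp₁ hq hl₂ hϑm hϑ hG'
  have hC' := hC.isFresnel hT hm hφ hθm hθ hF' hd₁ hp₁ hq
  have hD' := hD.isFresnel hT hm hφ hϑm hϑ hG' hd₂ hp₁ hq
  -- With this `C` and `D` get the same densities as `A` and `B`, and one lemma on convolution
  -- products settles both pairs.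
  have e₁ : WienerGFFT.energy (WienerGFFT.divSqrtTwo s₁)
      = fun u : WienerGFFT.L2 T => (WienerGFFT.energy s u + WienerGFFT.energy k₁ u) / 2 :=
    funext fun u => by
      rw [WienerGFFT.energy_divSqrtTwo, WienerGFFT.energy_eq_add hs hk₁.1 hs₁']
  have e₂ : WienerGFFT.energy (WienerGFFT.divSqrtTwo s₂)
      = fun u : WienerGFFT.L2 T => (WienerGFFT.energy s u + WienerGFFT.energy k₂ u) / 2 :=
    funext fun u => by
      rw [WienerGFFT.energy_divSqrtTwo, WienerGFFT.energy_eq_add hs hk₂.1 hs₂']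
  rw [e₁] at hC'
  rw [e₂] at hD'
  simp only [WienerGFFT.sum_energy_list hh' hsH] at hA' hB'
  exact ⟨WienerGFFT.isGCP_of_isFresnel_transformed hT hm hφ hθm hθ hϑm hϑ hF' hG' hs hk₁.1 hk₂.1
      hsk hp₁ hq hA' hB' hE,
    WienerGFFT.isGCP_of_isFresnel_transformed hT hm hφ hθm hθ hϑm hϑ hF' hG' hs hk₁.1 hk₂.1
      hsk hp₁ hq hC' hD' hE⟩
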